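/- All manifolds are smooth. A \emph{spacetime} is a connected, Hausdorff, second countable, orientable, time-oriented $4$-manifold with a smooth Lorentzian metric of signature $(-,+,+,+)$; it is \emph{globally hyperbolic} if it has a closed achronal subset (Cauchy hypersurface) whose domain of dependence is the whole spacetime. An \emph{expanding universe with (geodesically complete) cosmological (particle) horizon} $(M,g,\Omega,X,\gamma)$ consists of a globally hyperbolic spacetime $(M,g)$, a smooth function $\Omega:M\to(0,\infty)$, a smooth future-directed timelike vector field $X$ on $M$ and a constant $\gamma\neq 0$ such that: (1) $(M,g)$ is isometrically embedded (preserving the time orientation) as the interior of a submanifold with boundary $M\cup\Im^-$ of a larger spacetime $(\widetilde M,\widetilde g)$, whose boundary $\Im^-=\partial M$ satisfies $\Im^-\cap J^+(M;\widetilde M)=\emptyset$; (2) $\Omega$ extends to a smooth function on $\widetilde M$ with $\Omega=0$ and $d\Omega\neq 0$ at every point of $\Im^-$; (3) in the intersection of $M$ with a neighbourhood of $\Im^-$ one has $\mathcal L_X \widetilde g=2X(\ln\Omega)\,\widetilde g$ (that is, $X$ is a Killing field of $\Omega^{-2}g$ there); moreover $X(\ln\Omega)\to 0$ approaching $\Im^-$,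 and $X$ does not tend to the zero vector at every point of $\Im^-$; (4) $\Im^-$ is diffeomorphic to $\mathbb R\times\mathbb S^2$, by coordinates $(u,\theta,\phi)$ which extend smoothly to a neighbourhood of $\Im^-$, and at the points of $\Im^-$ $$\widetilde g=\gamma^2\left(-du\otimes d\Omega-d\Omega\otimes du+d\mathbb S^2(\theta,\phi)\right),$$ where $d\mathbb S^2$ is the standard metric of the unit sphere; the curves $\mathbb R\ni u\mapsto(u,\theta,\phi)\in\Im^-$ are complete (affinely parametrised) null geodesics of $\widetilde g$. A Killing field $Y$ of $(M,g)$ \emph{preserves} $\Im^-$ if $g(Y,X)\to 0$ approaching $\Im^-$. The \emph{horizon symmetry group} $SG_{\Im^-}$ is the group of all diffeomorphisms $(u,q)\mapsto(e^{a(q)}u+b(q),Rq)$ of $\mathbb R\times\mathbb S^2$ with $a,b\in C^\infty(\mathbb S^2)$, $R\in SO(3)$. The \emph{horizon Lie algebra} $\mathfrak g_{\Im^-}$ is the real Lie algebra of vector fields on $\mathbb R\times\mathbb S^2$ generated by the three fields $S_1,S_2,S_3$ on $\mathbb S^2$ generating the rotations about the coordinate axes and by all $\beta\,\partial_u$ and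 $u\alpha\,\partial_u$ with $\alpha,\beta\in C^\infty(\mathbb S^2)$. \textbf{Theorem.} Let $(M,g,\Omega,X,\gamma)$ be an expanding universe with cosmological horizon, identify $\Im^-$ with $\mathbb R\times\mathbb S^2$ by the coordinates in (4), and let $Y$ be a smooth Killing vector field of $(M,g)$ preserving $\Im^-$. Then $Y$ extends to a smooth vector field on the manifold with boundary $M\cup\Im^-$; the restriction $\widetilde Y$ of the extension to $\Im^-$ is uniquely determined by $Y$ and is tangent to $\Im^-$; and (1) $\widetilde Y$ belongs to $\mathfrak g_{\Im^-}$; (2) $\widetilde Y$ is complete and the one-parameter group $\{\exp(t\widetilde Y)\}_{t\in\mathbb R}$ that it generates is a subgroup of $SG_{\Im^-}$. -/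

import Mathlib

open Set Filter
open scoped Manifold ContDiff Topology

noncomputable section

namespace CosmologicalHorizon

/-! ### Spacetimes -/

/-- The model space `ℝ⁴`. -/
abbrev E4 : Type := EuclideanSpace ℝ (Fin 4)

/-- Euclidean `ℝ³`. -/
abbrev E3 : Type := EuclideanSpace ℝ (Fin 3)

/-- The unit sphere `𝕊²` in `ℝ³`, with Mathlib's smooth structure. -/
abbrev S2 : Type := Metric.sphere (0 : E3) 1

/-- A vector field (no regularity) on a four-dimensional manifold. -/
abbrev VField (M : Type*) [TopologicalSpace M] [ChartedSpace E4 M] : Type _ :=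
  ∀ x : M, TangentSpace (𝓡 4) x

/-- Smoothness of a vector field at a point. -/
def SmoothFieldAt {M : Type*} [TopologicalSpace M] [ChartedSpace E4 M]
    [IsManifold (𝓡 4) ∞ M] (V : VField M) (x : M) : Prop :=
  ContMDiffAt (𝓡 4) (𝓡 4).tangent ∞ (fun y => (⟨y, V y⟩ : TangentBundle (𝓡 4) M)) x

/-- Smoothness of a vector field on a set; on a set which is a codimension-zero submanifold with
boundary this is smoothness up to and including the boundary. -/
def SmoothFieldOn {M : Type*} [TopologicalSpace M] [ChartedSpace E4 M]
    [IsManifold (𝓡 4) ∞ M] (V : VField M) (s : Set M) : Prop :=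
  ContMDiffOn (𝓡 4) (𝓡 4).tangent ∞ (fun y => (⟨y, V y⟩ : TangentBundle (𝓡 4) M)) s

/-- A global smooth vector field. -/
def SmoothField {M : Type*} [TopologicalSpace M] [ChartedSpace E4 M]
    [IsManifold (𝓡 4) ∞ M] (V : VField M) : Prop :=
  ContMDiff (𝓡 4) (𝓡 4).tangent ∞ (fun y => (⟨y, V y⟩ : TangentBundle (𝓡 4) M))

/-- A smooth manifold is orientable if it has a smooth atlas all of whose transition maps have
positive Jacobian determinant. -/
def IsOrientable (M : Type*) [TopologicalSpace M] [ChartedSpace E4 M] : Prop :=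
  ∃ A : Set (OpenPartialHomeomorph M E4),
    A ⊆ IsManifold.maximalAtlas (𝓡 4) ∞ M ∧
    (∀ x : M, ∃ e ∈ A, x ∈ e.source) ∧
    ∀ e ∈ A, ∀ e' ∈ A, ∀ y ∈ (e.symm.trans e').source,
      0 < (fderiv ℝ (fun z => e' (e.symm z)) y).det

/-- An oriented-in-time spacetime structure on a four-dimensional smooth manifold `M` (assumed
connected, Hausdorff and second countable): `M` is orientable, and carries a smooth Lorentzian
metric of signature `(-,+,+,+)` and a time orientation, given by a smooth timelike field. -/
structure Spacetime (M : Type*) [TopologicalSpace M] [T2Space M] [SecondCountableTopology M]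
    [ConnectedSpace M] [ChartedSpace E4 M] [IsManifold (𝓡 4) ∞ M] where
  orientable : IsOrientable M
  metric (x : M) : TangentSpace (𝓡 4) x →L[ℝ] TangentSpace (𝓡 4) x →L[ℝ] ℝ
  metric_symm (x : M) (v w : TangentSpace (𝓡 4) x) : metric x v w = metric x w v
  metric_signature (x : M) : ∃ b : Module.Basis (Fin 4) ℝ (TangentSpace (𝓡 4) x),
    ∀ i j, metric x (b i) (b j) = if i = j then (if i = 0 then -1 else 1) else 0
  metric_smooth : ContMDiff (𝓡 4) ((𝓡 4).prod 𝓘(ℝ, E4 →L[ℝ] E4 →L[ℝ] ℝ)) ∞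
    (fun x => Bundle.TotalSpace.mk' (E4 →L[ℝ] E4 →L[ℝ] ℝ)
      (E := fun x : M => TangentSpace (𝓡 4) x →L[ℝ] TangentSpace (𝓡 4) x →L[ℝ] ℝ) x (metric x))
  timeField : VField M
  timeField_smooth : SmoothField timeField
  timeField_timelike (x : M) : metric x (timeField x) (timeField x) < 0

/-- A curve `c` is, on the interval `[s, t]` with `s < t`, smooth with all its tangent vectors
satisfying `P` (one-sided derivatives at the end points). -/
def IsSmoothSegment {M : Type*} [TopologicalSpace M] [ChartedSpace E4 M]
    (P : ∀ x : M, TangentSpace (𝓡 4) x → Prop) (c : ℝ → M) (s t : ℝ) : Prop :=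
  s < t ∧ ContMDiffOn 𝓘(ℝ, ℝ) (𝓡 4) ∞ c (Icc s t) ∧
    ∀ r ∈ Icc s t, P (c r) (mfderivWithin 𝓘(ℝ, ℝ) (𝓡 4) c (Icc s t) r (1 : ℝ))

/-- `c` is a continuous piecewise smooth curve on the interval `I` whose (one-sided) tangent
vectors satisfy `P`: every point of `I` which is not its maximum (minimum) is the left (right) end
point of a smooth segment contained in `I`. On a compact interval this is the existence of a finite
partition into smooth segments. -/
def IsPiecewiseSmoothCurve {M : Type*} [TopologicalSpace M] [ChartedSpace E4 M]
    (P : ∀ x : M, TangentSpace (𝓡 4) x → Prop) (c : ℝ → M) (I : Set ℝ) : Prop :=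
  I.OrdConnected ∧ ∀ t ∈ I,
    ((∃ t' ∈ I, t < t') → ∃ r, Icc t r ⊆ I ∧ IsSmoothSegment P c t r) ∧
    ((∃ t' ∈ I, t' < t) → ∃ r, Icc r t ⊆ I ∧ IsSmoothSegment P c r t)

namespace Spacetime

variable {M : Type*} [TopologicalSpace M] [T2Space M] [SecondCountableTopology M]
  [ConnectedSpace M] [ChartedSpace E4 M] [IsManifold (𝓡 4) ∞ M] (S : Spacetime M)

/-! ### Causal structure -/

/-- Future-directed causal vectors: non-zero, timelike or null, in the fold of the cone containing
the time orientation. -/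
def FutureCausal (x : M) (v : TangentSpace (𝓡 4) x) : Prop :=
  v ≠ 0 ∧ S.metric x v v ≤ 0 ∧ S.metric x (S.timeField x) v < 0

/-- Future-directed timelike vectors. -/
def FutureTimelike (x : M) (v : TangentSpace (𝓡 4) x) : Prop :=
  S.metric x v v < 0 ∧ S.metric x (S.timeField x) v < 0

/-- The causal future `J⁺(A)`. -/
def causalFuture (A : Set M) : Set M :=
  {q | ∃ p ∈ A, q = p ∨ ∃ (c : ℝ → M) (a b : ℝ), a < b ∧
    IsPiecewiseSmoothCurve S.FutureCausal c (Icc a b) ∧ c a = p ∧ c b = q}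

/-- The chronological future `I⁺(A)`. -/
def chronologicalFuture (A : Set M) : Set M :=
  {q | ∃ p ∈ A, ∃ (c : ℝ → M) (a b : ℝ), a < b ∧
    IsPiecewiseSmoothCurve S.FutureTimelike c (Icc a b) ∧ c a = p ∧ c b = q}

/-- The curve `c` on the interval `I` has no past end point: there is no point `q` such that `c`
eventually stays in every neighbourhood of `q` towards the past. -/
def PastInextensible (c : ℝ → M) (I : Set ℝ) : Prop :=
  ¬ ∃ q : M, ∀ O ∈ 𝓝 q, ∃ t₀ ∈ I, ∀ t ∈ I, t ≤ t₀ → c t ∈ O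

/-- The curve `c` on the interval `I` has no future end point. -/
def FutureInextensible (c : ℝ → M) (I : Set ℝ) : Prop :=
  ¬ ∃ q : M, ∀ O ∈ 𝓝 q, ∃ t₀ ∈ I, ∀ t ∈ I, t₀ ≤ t → c t ∈ O

/-- The future domain of dependence `D⁺(Σ)`: every past-inextensible causal curve (parametrised
towards the future, ending at the point) meets `Σ`. -/
def futureDomain (Sig : Set M) : Set M :=
  {p | ∀ (c : ℝ → M) (I : Set ℝ) (b : ℝ), IsPiecewiseSmoothCurve S.FutureCausal c I →
    IsGreatest I b → c b = p → PastInextensible c I → ∃ t ∈ I, c t ∈ Sig}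

/-- The past domain of dependence `D⁻(Σ)`. -/
def pastDomain (Sig : Set M) : Set M :=
  {p | ∀ (c : ℝ → M) (I : Set ℝ) (a : ℝ), IsPiecewiseSmoothCurve S.FutureCausal c I →
    IsLeast I a → c a = p → FutureInextensible c I → ∃ t ∈ I, c t ∈ Sig}

/-- A Cauchy hypersurface: a closed achronal set whose domain of dependence is everything. -/
def IsCauchyHypersurface (Sig : Set M) : Prop :=
  IsClosed Sig ∧ S.chronologicalFuture Sig ∩ Sig = ∅ ∧ S.futureDomain Sig ∪ S.pastDomain Sig = univ

/-- Global hyperbolicity: there is a Cauchy hypersurface. -/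
def IsGloballyHyperbolic : Prop := ∃ Sig : Set M, S.IsCauchyHypersurface Sig

/-! ### Lie derivatives of the metric, Killing fields, geodesics -/

/-- `(𝓛_X g)(V, W) = X(g(V,W)) - g([X,V],W) - g(V,[X,W])` at the point `x`. -/
def lieDerivMetric (X V W : VField M) (x : M) : ℝ :=
  mvfderiv (𝓡 4) (fun y => S.metric y (V y) (W y)) x (X x)
    - S.metric x (VectorField.mlieBracket (𝓡 4) X V x) (W x)
    - S.metric x (V x) (VectorField.mlieBracket (𝓡 4) X W x)

/-- `𝓛_X g = φ g` at the point `x`. -/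
def LieDerivMetricEqAt (X : VField M) (φ : ℝ) (x : M) : Prop :=
  ∀ V W : VField M, SmoothFieldAt V x → SmoothFieldAt W x →
    S.lieDerivMetric X V W x = φ * S.metric x (V x) (W x)

/-- Killing vector fields: smooth fields with `𝓛_Y g = 0`. -/
def IsKillingField (Y : VField M) : Prop :=
  SmoothField Y ∧ ∀ x : M, S.LieDerivMetricEqAt Y 0 x

/-- The metric in the preferred chart around `p`, as a bilinear form `g_{ij}(y) vⁱ wʲ`. -/
def chartMetric (p : M) (y v w : E4) : ℝ :=
  S.metric ((extChartAt (𝓡 4) p).symm y)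
    (mfderiv 𝓘(ℝ, E4) (𝓡 4) (extChartAt (𝓡 4) p).symm y v)
    (mfderiv 𝓘(ℝ, E4) (𝓡 4) (extChartAt (𝓡 4) p).symm y w)

/-- The Christoffel symbols of the first kind of the Levi-Civita connection in the preferred chart
around `p`: `Γ(a,b;w) = ½ (∂_a g(b,w) + ∂_b g(a,w) - ∂_w g(a,b))`. -/
def christoffel (p : M) (y a b w : E4) : ℝ :=
  (1 / 2) * (fderiv ℝ (fun z => S.chartMetric p z b w) y a
    + fderiv ℝ (fun z => S.chartMetric p z a w) y b
    - fderiv ℝ (fun z => S.chartMetric p z a b) y w)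

/-- Affinely parametrised geodesics defined on the whole of `ℝ`, i.e. smooth curves with
`∇_ċ ċ = 0`. The equation at parameter `t` is `g(ẍ, w) + Γ(ẋ, ẋ; w) = 0` for all `w`, written
in the preferred chart around `c t`. -/
def IsCompleteGeodesic (c : ℝ → M) : Prop :=
  ContMDiff 𝓘(ℝ, ℝ) (𝓡 4) ∞ c ∧ ∀ (t : ℝ) (w : E4),
    let x : ℝ → E4 := fun r => extChartAt (𝓡 4) (c t) (c r)
    S.chartMetric (c t) (x t) (deriv (deriv x) t) w
      + S.christoffel (c t) (x t) (deriv x t) (deriv x t) w = 0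

/-- Null (lightlike) curves: the tangent vectors are null and non-zero. -/
def IsNullCurve (c : ℝ → M) : Prop :=
  ∀ t : ℝ, mfderiv 𝓘(ℝ, ℝ) (𝓡 4) c t (1 : ℝ) ≠ 0 ∧
    S.metric (c t) (mfderiv 𝓘(ℝ, ℝ) (𝓡 4) c t (1 : ℝ)) (mfderiv 𝓘(ℝ, ℝ) (𝓡 4) c t (1 : ℝ)) = 0

end Spacetime

/-! ### Expanding universes with cosmological horizon -/

/-- An expanding universe with (geodesically complete) cosmological (particle) horizon: a globally
hyperbolic spacetime structure `bulk` on `M` with a positive function `Omega` and a future-directed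
timelike vector field `X`, isometrically embedded by `embed` in a larger spacetime `ambient` on `N`.
The horizon `ℑ⁻` is the set `horizon` in `N`. -/
structure ExpandingUniverse
    (M : Type*) [TopologicalSpace M] [T2Space M] [SecondCountableTopology M]
    [ConnectedSpace M] [ChartedSpace E4 M] [IsManifold (𝓡 4) ∞ M]
    (N : Type*) [TopologicalSpace N] [T2Space N] [SecondCountableTopology N]
    [ConnectedSpace N] [ChartedSpace E4 N] [IsManifold (𝓡 4) ∞ N] where
  bulk : Spacetime M
  globallyHyperbolic : bulk.IsGloballyHyperbolic
  Omega : M → ℝ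
  Omega_smooth : ContMDiff (𝓡 4) 𝓘(ℝ, ℝ) ∞ Omega
  Omega_pos (x : M) : 0 < Omega x
  X : VField M
  X_smooth : SmoothField X
  X_future (x : M) : bulk.FutureTimelike x (X x)
  /- The isometric embedding in a larger (time-oriented) spacetime. -/
  ambient : Spacetime N
  embed : M → N
  embed_smooth : ContMDiff (𝓡 4) (𝓡 4) ∞ embed
  embed_open : Topology.IsOpenEmbedding embed
  embed_isometric (x : M) (v w : TangentSpace (𝓡 4) x) :
    ambient.metric (embed x) (mfderiv (𝓡 4) (𝓡 4) embed x v) (mfderiv (𝓡 4) (𝓡 4) embed x w)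
      = bulk.metric x v w
  embed_future (x : M) :
    ambient.FutureTimelike (embed x) (mfderiv (𝓡 4) (𝓡 4) embed x (bulk.timeField x))
  /- `M ∪ ℑ⁻` is a submanifold with boundary of `N`, with interior `M` and boundary `ℑ⁻`. -/
  horizon : Set N
  boundary_chart : ∀ p ∈ horizon, ∃ e ∈ IsManifold.maximalAtlas (𝓡 4) ∞ N, p ∈ e.source ∧
    e.source ∩ range embed = {q ∈ e.source | 0 < e q 0} ∧
    e.source ∩ horizon = {q ∈ e.source | e q 0 = 0}
  horizon_causal : horizon ∩ ambient.causalFuture (range embed) = ∅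
  /- The extension of `Omega`. -/
  OmegaExt : N → ℝ
  OmegaExt_smooth : ContMDiff (𝓡 4) 𝓘(ℝ, ℝ) ∞ OmegaExt
  OmegaExt_embed (x : M) : OmegaExt (embed x) = Omega x
  OmegaExt_horizon : ∀ p ∈ horizon, OmegaExt p = 0
  OmegaExt_regular : ∀ p ∈ horizon, mvfderiv (𝓡 4) OmegaExt p ≠ 0
  /- `X` is conformal Killing near `ℑ⁻` with `𝓛_X g = 2 X(log Omega) g`, i.e. it is Killing for
  `Omega⁻² g`; moreover `X(log Omega) → 0` at `ℑ⁻`, while `X` does not tend to `0` everywhere. -/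
  X_conformal : ∃ O : Set N, IsOpen O ∧ horizon ⊆ O ∧ ∀ x : M, embed x ∈ O →
    bulk.LieDerivMetricEqAt X
      (2 * mvfderiv (𝓡 4) (fun y => Real.log (Omega y)) x (X x)) x
  X_log_tendsto : ∀ p ∈ horizon,
    Tendsto (fun x : M => mvfderiv (𝓡 4) (fun y => Real.log (Omega y)) x (X x))
      (comap embed (𝓝 p)) (𝓝 0)
  X_not_tendsto_zero : ¬ ∀ p ∈ horizon,
    Tendsto (fun x : M =>
        (⟨embed x, mfderiv (𝓡 4) (𝓡 4) embed x (X x)⟩ : TangentBundle (𝓡 4) N))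
      (comap embed (𝓝 p)) (𝓝 (⟨p, 0⟩ : TangentBundle (𝓡 4) N))
  /- The identification `bondi : ℝ × 𝕊² → ℑ⁻` and the coordinates `u`, `s = (θ, φ)`, smooth near
  `ℑ⁻` and inverting `bondi` there. In the coordinates `(u, Omega, θ, φ)` the metric has Bondi form
  at the points of `ℑ⁻`. -/
  gamma : ℝ
  gamma_ne_zero : gamma ≠ 0
  bondi : ℝ × S2 → N
  bondi_smooth : ContMDiff (𝓘(ℝ, ℝ).prod (𝓡 2)) (𝓡 4) ∞ bondi
  bondi_range : range bondi = horizon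
  bondiDomain : Set N
  bondiDomain_open : IsOpen bondiDomain
  horizon_subset : horizon ⊆ bondiDomain
  u : N → ℝ
  u_smooth : ContMDiffOn (𝓡 4) 𝓘(ℝ, ℝ) ∞ u bondiDomain
  s : N → S2
  s_smooth : ContMDiffOn (𝓡 4) (𝓡 2) ∞ s bondiDomain
  u_bondi (z : ℝ × S2) : u (bondi z) = z.1
  s_bondi (z : ℝ × S2) : s (bondi z) = z.2
  bondi_form : ∀ p ∈ horizon, ∀ v w : TangentSpace (𝓡 4) p,
    ambient.metric p v w = gamma ^ 2 *
      (- (mvfderiv (𝓡 4) u p v * mvfderiv (𝓡 4) OmegaExt p w)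
        - mvfderiv (𝓡 4) OmegaExt p v * mvfderiv (𝓡 4) u p w
        + inner ℝ (mvfderiv (𝓡 4) (fun q => (s q : E3)) p v)
            (mvfderiv (𝓡 4) (fun q => (s q : E3)) p w))
  bondi_geodesic (q : S2) : ambient.IsCompleteGeodesic (fun r : ℝ => bondi (r, q))
  bondi_null (q : S2) : ambient.IsNullCurve (fun r : ℝ => bondi (r, q))

namespace ExpandingUniverse

variable {M : Type*} [TopologicalSpace M] [T2Space M] [SecondCountableTopology M]
    [ConnectedSpace M] [ChartedSpace E4 M] [IsManifold (𝓡 4) ∞ M]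
    {N : Type*} [TopologicalSpace N] [T2Space N] [SecondCountableTopology N]
    [ConnectedSpace N] [ChartedSpace E4 N] [IsManifold (𝓡 4) ∞ N] (U : ExpandingUniverse M N)

/-- `Y` preserves `ℑ⁻`: `g(Y, X) → 0` approaching `ℑ⁻`. -/
def PreservesHorizon (Y : VField M) : Prop :=
  ∀ p ∈ U.horizon, Tendsto (fun x : M => U.bulk.metric x (Y x) (U.X x))
    (comap U.embed (𝓝 p)) (𝓝 0)

/-- `W` is a smooth extension of the vector field `Y` of `M` to the manifold with boundary
`M ∪ ℑ⁻` (the values of `W` at other points of `N` are irrelevant). -/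
def IsSmoothExtension (Y : VField M) (W : VField N) : Prop :=
  SmoothFieldOn W (range U.embed ∪ U.horizon) ∧
    ∀ x : M, W (U.embed x) = mfderiv (𝓡 4) (𝓡 4) U.embed x (Y x)

end ExpandingUniverse

/-! ### The horizon symmetry group and the horizon Lie algebra -/

/-- The model with corners of `ℝ × 𝕊²`. -/
abbrev scriModel : ModelWithCorners ℝ (ℝ × EuclideanSpace ℝ (Fin 2))
    (ModelProd ℝ (EuclideanSpace ℝ (Fin 2))) :=
  𝓘(ℝ, ℝ).prod (𝓡 2)

/-- Vector fields (no regularity) on `ℝ × 𝕊²`. -/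
abbrev ScriField : Type := ∀ z : ℝ × S2, TangentSpace scriModel z

/-- The action of a linear isometry of `ℝ³` on the unit sphere. -/
def rotate (R : E3 ≃ₗᵢ[ℝ] E3) (q : S2) : S2 :=
  ⟨R q, by have := q.2; simp only [mem_sphere_iff_norm, sub_zero] at this ⊢; simp [this]⟩

theorem contMDiff_rotate (R : E3 ≃ₗᵢ[ℝ] E3) : ContMDiff (𝓡 2) (𝓡 2) ∞ (rotate R) := by
  have : Fact (Module.finrank ℝ E3 = 2 + 1) := ⟨by simp⟩
  refine ContMDiff.codRestrict_sphere (n := 2) (f := fun q : S2 => R (q : E3)) ?_ _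
  exact R.contDiff.contMDiff.comp contMDiff_coe_sphere

/-- `F` is the transformation `(u, q) ↦ (e^{a(q)} u + b(q), R q)` for some smooth functions `a, b`
on `𝕊²` and some rotation `R ∈ SO(3)`. -/
def IsHorizonSymmetry (F : ℝ × S2 → ℝ × S2) : Prop :=
  ∃ (a b : S2 → ℝ) (R : E3 ≃ₗᵢ[ℝ] E3),
    ContMDiff (𝓡 2) 𝓘(ℝ, ℝ) ∞ a ∧ ContMDiff (𝓡 2) 𝓘(ℝ, ℝ) ∞ b ∧
    LinearMap.det (R.toLinearEquiv : E3 →ₗ[ℝ] E3) = 1 ∧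
    ∀ z : ℝ × S2, F z = (Real.exp (a z.2) * z.1 + b z.2, rotate R z.2)

/-- The horizon symmetry group `SG_{ℑ⁻}`, as a group of transformations of `ℝ × 𝕊²`. -/
def horizonSymmetryGroup : Subgroup (Equiv.Perm (ℝ × S2)) where
  carrier := {F | IsHorizonSymmetry F}
  one_mem' := by
    refine ⟨fun _ => 0, fun _ => 0, 1, contMDiff_const, contMDiff_const, ?_, ?_⟩
    · exact LinearMap.det_id
    · intro z; simp [rotate]
  mul_mem' := by
    rintro F G ⟨a, b, R, ha, hb, hR, hF⟩ ⟨a', b', R', ha', hb', hR', hG⟩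
    have hr := contMDiff_rotate R'
    refine ⟨fun q => a' q + a (rotate R' q),
      fun q => Real.exp (a (rotate R' q)) * b' q + b (rotate R' q), R * R',
      ha'.add (ha.comp hr),
      ((Real.contDiff_exp.contMDiff.comp (ha.comp hr)).mul hb').add (hb.comp hr), ?_, ?_⟩
    · have : ((R * R').toLinearEquiv : E3 →ₗ[ℝ] E3)
          = (R.toLinearEquiv : E3 →ₗ[ℝ] E3) ∘ₗ (R'.toLinearEquiv : E3 →ₗ[ℝ] E3) := rfl
      rw [this, LinearMap.det_comp, hR, hR', one_mul]
    · intro z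
      simp only [Equiv.Perm.coe_mul, Function.comp_apply, hF, hG, Prod.mk.injEq]
      refine ⟨?_, rfl⟩
      rw [Real.exp_add]; ring
  inv_mem' := by
    rintro F ⟨a, b, R, ha, hb, hR, hF⟩
    have hr := contMDiff_rotate R⁻¹
    refine ⟨fun q => - a (rotate R⁻¹ q),
      fun q => - (Real.exp (- a (rotate R⁻¹ q)) * b (rotate R⁻¹ q)), R⁻¹,
      (ha.comp hr).neg,
      ((Real.contDiff_exp.contMDiff.comp (ha.comp hr).neg).mul (hb.comp hr)).neg, ?_, ?_⟩
    · have h1 : (R.toLinearEquiv : E3 →ₗ[ℝ] E3) ∘ₗ (R⁻¹.toLinearEquiv : E3 →ₗ[ℝ] E3)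
          = LinearMap.id := by
        ext1 v; exact R.apply_symm_apply v
      have h2 := congrArg LinearMap.det h1
      rwa [LinearMap.det_comp, hR, one_mul, LinearMap.det_id] at h2
    · intro z
      rw [Equiv.Perm.inv_eq_iff_eq, hF]
      have h3 : rotate R (rotate R⁻¹ z.2) = z.2 := Subtype.ext (R.apply_symm_apply _)
      refine Prod.ext ?_ h3.symm
      have h4 : Real.exp (a (rotate R⁻¹ z.2)) * Real.exp (- a (rotate R⁻¹ z.2)) = 1 := by
        rw [← Real.exp_add]; simp
      simp only
      linear_combination (b (rotate R⁻¹ z.2) - z.1) * h4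

/-- `Z` is the `i`-th rotation field `S_i` on `𝕊²` (regarded as a field on `ℝ × 𝕊²`): it has no
`∂_u` component, and its value at `(u, q)` is, as a vector of `ℝ³`, the cross product `e_i × q`. -/
def IsRotationField (i : Fin 3) (Z : ScriField) : Prop :=
  ∀ z : ℝ × S2, (Z z).1 = 0 ∧
    mvfderiv (𝓡 2) (fun q : S2 => (q : E3)) z.2 (Z z).2
      = WithLp.toLp 2 (crossProduct (Pi.single i (1 : ℝ)) (WithLp.ofLp (z.2 : E3)))

/-- The generators `S_1, S_2, S_3`, `β ∂_u` and `u α ∂_u` with `α, β ∈ C^∞(𝕊²)`. -/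
def horizonGenerators : Set ScriField :=
  {Z | ∃ i : Fin 3, IsRotationField i Z} ∪
  {Z | ∃ β : S2 → ℝ, ContMDiff (𝓡 2) 𝓘(ℝ, ℝ) ∞ β ∧ ∀ z, Z z = (β z.2, 0)} ∪
  {Z | ∃ α : S2 → ℝ, ContMDiff (𝓡 2) 𝓘(ℝ, ℝ) ∞ α ∧ ∀ z, Z z = (z.1 * α z.2, 0)}

/-- The horizon Lie algebra `𝔤_{ℑ⁻}`: the smallest real vector space of vector fields on `ℝ × 𝕊²`
which contains the generators and is closed under the Lie bracket of vector fields. -/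
def horizonLieAlgebra : Submodule ℝ ScriField :=
  sInf {V | horizonGenerators ⊆ V ∧
    ∀ Z ∈ V, ∀ Z' ∈ V, VectorField.mlieBracket scriModel Z Z' ∈ V}

end CosmologicalHorizon

end

open CosmologicalHorizon

open Set Filter
open scoped Manifold ContDiff Topology
noncomputable section
namespace CosmologicalHorizon
set_option maxSynthPendingDepth 3

/-! Extension. The value and first derivative of a Killing field satisfy a closed linear first-order
system: differentiating the Killing equation and permuting cyclically, as in Koszul's formula,
expresses the second derivative through the 1-jet, with coefficients built from the metric
(`eq_killingHessian`). The larger metric is smooth and nondegenerate across the horizon, so in a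
boundary chart these coefficients are smooth up to the flat face of a half ball. Grönwall bounds the
jet, the system then makes it Lipschitz, and its extension to the closure solves the same system,
hence is smooth by bootstrapping (`exists_contDiffOn_extension`, `exists_killingJet`). Every horizon
point is a limit of bulk points, so the local extensions agree and glue
(`exists_isSmoothExtension`).

Tangency. Through a horizon point runs a null geodesic transversal to the horizon. For the conformal
Killing field `X` the product of `X` with the velocity is constant along it, and it is nonzero
because `X` is timelike; hence `X` is frequently bounded below in norm near the point
(`exists_frequently_le_norm`). A limit `ξ` of `X / ‖X‖` is causal, annihilated by `dΩ` and
orthogonal to the extended Killing field (`exists_unit_limit`). The Bondi form makes `ξ` a nonzero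
multiple of `∂_u`, and orthogonality to `∂_u` is tangency (`IsSmoothExtension.dOmega_eq_zero`).

Spherical part. The Killing equation restricts to the degenerate metric of `ℝ × 𝕊²`. Extended to `ℝ
× (ℝ³ \ {0})` with degree one, the spherical component has skew-symmetric derivative, hence does not
depend on `u` and is a fixed skew linear map `A` (`IsSmoothExtension.exists_skew`).

Component along the generators. Killing fields satisfy the Jacobi equation along geodesics, and so
do the variation fields of the family of generators. Comparing the two for `f ∂_u + A` leaves `∂_u²
f` times the metric dual of the velocity, so `f = u α + β` (`IsSmoothExtension.coneU_eq`).

The restricted field is therefore `(u α + β) ∂_u + A`, a linear combination of the generators of the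
Lie algebra. Its flow is obtained by integrating the rotation `exp (t A)` and then a scalar linear
equation; it exists for all times and has the form required of a horizon symmetry
(`existsUnique_scriFlowHom`). -/

/-! ### Closed linear first-order systems and their extension to the closure of a convex set. -/

theorem exists_bound_of_homogeneous {E S G : Type*} [NormedAddCommGroup E] [NormedSpace ℝ E]
    [NormedAddCommGroup S] [NormedSpace ℝ S] [FiniteDimensional ℝ S]
    [NormedAddCommGroup G] [NormedSpace ℝ G] {K : Set E} (hK : IsCompact K)
    {R : E → S → G} (hR : ContinuousOn (fun p : E × S => R p.1 p.2) (K ×ˢ univ))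
    (hom : ∀ x ∈ K, ∀ (c : ℝ) v, R x (c • v) = c • R x v) :
    ∃ C : ℝ, 0 ≤ C ∧ ∀ x ∈ K, ∀ v, ‖R x v‖ ≤ C * ‖v‖ := by
  have : ProperSpace S := FiniteDimensional.proper ℝ S
  have hc : IsCompact (K ×ˢ Metric.sphere (0 : S) 1) := hK.prod (isCompact_sphere 0 1)
  obtain ⟨C, hC⟩ := hc.exists_bound_of_continuousOn
    (hR.mono (prod_mono Subset.rfl (subset_univ _)))
  -- The constant `C` may be negative when the compact set is empty.
  refine ⟨|C|, abs_nonneg _, fun x hx v => ?_⟩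
  by_cases hv : v = 0
  · have := hom x hx 0 v
    simp only [zero_smul] at this
    simp [hv, this]
  · have hv' : ‖v‖ ≠ 0 := norm_ne_zero_iff.2 hv
    have h1 : R x v = ‖v‖ • R x (‖v‖⁻¹ • v) := by
      rw [hom x hx, smul_smul, mul_inv_cancel₀ hv', one_smul]
    rw [h1, norm_smul, norm_norm, mul_comm]
    gcongr
    refine (hC (x, ‖v‖⁻¹ • v) ⟨hx, ?_⟩).trans (le_abs_self C)
    simp [norm_smul, hv']

/-- Grönwall's inequality along the segment from a base point: the system turns into an ordinary
differential inequality with constant `C * D`, where `D` bounds the distance to the base point. -/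
theorem exists_bound_of_closed_system {E S : Type*} [NormedAddCommGroup E] [NormedSpace ℝ E]
    [NormedAddCommGroup S] [NormedSpace ℝ S] {V : Set E} (hV : Convex ℝ V)
    (hVb : Bornology.IsBounded V) {R : E → S → E →L[ℝ] S} {C : ℝ} (hC : 0 ≤ C)
    (hR : ∀ x ∈ V, ∀ v, ‖R x v‖ ≤ C * ‖v‖) {Ψ : E → S}
    (hΨ : ∀ x ∈ V, HasFDerivAt Ψ (R x (Ψ x)) x) :
    ∃ B : ℝ, ∀ x ∈ V, ‖Ψ x‖ ≤ B := by
  rcases V.eq_empty_or_nonempty with rfl | ⟨x₀, hx₀⟩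
  · exact ⟨0, by simp⟩
  obtain ⟨D, hD⟩ := hVb.subset_closedBall x₀
  have hD0 : 0 ≤ D := by simpa using hD hx₀
  refine ⟨gronwallBound ‖Ψ x₀‖ (C * D) 0 1, fun x hx => ?_⟩
  have hseg : ∀ t ∈ Icc (0 : ℝ) 1, x₀ + t • (x - x₀) ∈ V := fun t ht =>
    hV.add_smul_sub_mem hx₀ hx ht
  have hder : ∀ t ∈ Icc (0 : ℝ) 1, HasDerivAt (fun t : ℝ => Ψ (x₀ + t • (x - x₀)))
      (R (x₀ + t • (x - x₀)) (Ψ (x₀ + t • (x - x₀))) (x - x₀)) t := by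
    intro t ht
    have h1 : HasDerivAt (fun t : ℝ => x₀ + t • (x - x₀)) (x - x₀) t := by
      simpa using ((hasDerivAt_id t).smul_const (x - x₀)).const_add x₀
    exact (hΨ _ (hseg t ht)).comp_hasDerivAt t h1
  have := norm_le_gronwallBound_of_norm_deriv_right_le (f := fun t : ℝ => Ψ (x₀ + t • (x - x₀)))
    (δ := ‖Ψ x₀‖) (K := C * D) (ε := 0) (a := 0) (b := 1)
    (fun t ht => (hder t ht).continuousAt.continuousWithinAt)
    (fun t ht => (hder t ⟨ht.1, ht.2.le⟩).hasDerivWithinAt) (by simp) (fun t ht => ?_) 1 (by simp)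
  · simpa using this
  · have htm := hseg t ⟨ht.1, ht.2.le⟩
    have hxD : ‖x - x₀‖ ≤ D := by simpa [dist_eq_norm] using hD hx
    calc _ ≤ ‖R (x₀ + t • (x - x₀)) (Ψ (x₀ + t • (x - x₀)))‖ * ‖x - x₀‖ :=
          ContinuousLinearMap.le_opNorm _ _
      _ ≤ (C * ‖Ψ (x₀ + t • (x - x₀))‖) * D := by
          gcongr
          exact hR _ htm _
      _ = _ := by ring

/-- A bounded solution has bounded derivative, so it is Lipschitz on the convex set and has limits
at the boundary. The right-hand side then has limits too, which makes the extension differentiable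
within the closure with the same system. -/
theorem exists_contDiffOn_extension {E S : Type*} [NormedAddCommGroup E] [NormedSpace ℝ E]
    [NormedAddCommGroup S] [NormedSpace ℝ S] [FiniteDimensional ℝ S]
    {V Ω : Set E} (hV : IsOpen V) (hVc : Convex ℝ V) (hK : IsCompact (closure V))
    (hVΩ : closure V ⊆ Ω) {R : E → S → E →L[ℝ] S}
    (hR : ContDiffOn ℝ ∞ (fun p : E × S => R p.1 p.2) (Ω ×ˢ univ))
    (hom : ∀ x ∈ Ω, ∀ (c : ℝ) v, R x (c • v) = c • R x v) {Ψ : E → S}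
    (hΨ : ∀ x ∈ V, HasFDerivAt Ψ (R x (Ψ x)) x) :
    ∃ Φ : E → S, EqOn Φ Ψ V ∧ ContDiffOn ℝ ∞ Φ (closure V) ∧
      ∀ x ∈ closure V, HasFDerivWithinAt Φ (R x (Φ x)) (closure V) x := by
  rcases V.eq_empty_or_nonempty with rfl | hne
  · exact ⟨Ψ, eqOn_refl _ _, by simp, by simp⟩
  obtain ⟨C, hC0, hC⟩ := exists_bound_of_homogeneous hK
    (hR.continuousOn.mono (prod_mono hVΩ Subset.rfl)) fun x hx => hom x (hVΩ hx)
  obtain ⟨B, hB⟩ := exists_bound_of_closed_system hVc (hK.isBounded.subset subset_closure) hC0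
    (fun x hx => hC x (subset_closure hx)) hΨ
  have hlip : LipschitzOnWith (Real.toNNReal (C * B)) Ψ V := by
    refine hVc.lipschitzOnWith_of_nnnorm_hasFDerivWithin_le
      (fun x hx => (hΨ x hx).hasFDerivWithinAt) fun x hx => ?_
    rw [← NNReal.coe_le_coe, coe_nnnorm]
    refine le_trans ((hC x (subset_closure hx) _).trans ?_) (Real.le_coe_toNNReal _)
    gcongr
    exact hB x hx
  obtain ⟨Φ, hΦl, hΦ⟩ := hlip.extend_finite_dimension
  have hΦc : Continuous Φ := hΦl.continuous
  have hRc : ContinuousOn (fun x => R x (Φ x)) (closure V) := by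
    have h1 : ContinuousOn (fun x => (x, Φ x)) (closure V) :=
      (continuous_id.prodMk hΦc).continuousOn
    exact hR.continuousOn.comp h1 fun x hx => ⟨hVΩ hx, mem_univ _⟩
  have hderV : ∀ x ∈ V, HasFDerivAt Φ (R x (Φ x)) x := fun x hx => by
    rw [hΦ.symm hx]
    exact (hΨ x hx).congr_of_eventuallyEq
      (by filter_upwards [hV.mem_nhds hx] with y hy using (hΦ hy).symm)
  have hder : ∀ x ∈ closure V, HasFDerivWithinAt Φ (R x (Φ x)) (closure V) x := by
    intro x hx
    refine hasFDerivWithinAt_closure_of_tendsto_fderiv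
      (fun y hy => (hderV y hy).differentiableAt.differentiableWithinAt) hVc hV
      (fun y _ => hΦc.continuousWithinAt) ?_
    refine ((hRc x hx).mono_left (nhdsWithin_mono _ subset_closure)).congr' ?_
    filter_upwards [self_mem_nhdsWithin] with y hy using (hderV y hy).fderiv.symm
  refine ⟨Φ, hΦ.symm, ?_, hder⟩
  have hu : UniqueDiffOn ℝ (closure V) :=
    uniqueDiffOn_convex hVc.closure (hne.mono (interior_maximal subset_closure hV))
  refine contDiffOn_infty.2 fun n => ?_
  -- Bootstrapping: if `Φ` is `C^n` on the closure, its derivative `R x (Φ x)` is `C^n`, so `Φ` is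
  -- `C^(n+1)`.
  induction n with
  | zero => exact contDiffOn_zero.2 hΦc.continuousOn
  | succ n ih =>
    rw [Nat.cast_succ, contDiffOn_succ_iff_fderivWithin hu]
    refine ⟨fun x hx => (hder x hx).differentiableWithinAt, by simp, ?_⟩
    have h2 : ContDiffOn ℝ n (fun x => R x (Φ x)) (closure V) :=
      (hR.of_le (by exact_mod_cast le_top)).comp (contDiffOn_id.prodMk ih)
        fun x hx => ⟨hVΩ hx, mem_univ _⟩
    exact h2.congr fun x hx => (hder x hx).fderivWithin (hu x hx)

theorem two_le_infty : (2 : WithTop ℕ∞) ≤ ∞ := by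
  exact WithTop.coe_le_coe.2 le_top

/-! ### Prolongation of the Killing equation in coordinates. -/

section KillingSystem

variable {E : Type*} [NormedAddCommGroup E] [NormedSpace ℝ E]

/-- The expression `g([Y,a],b)`-free part of the Lie derivative of `G` on constant fields, as a
function of the value `v` and the derivative `m` of the vector field at the point `x`. -/
def lieForm (G : E → E →L[ℝ] E →L[ℝ] ℝ) (x v : E) (m : E →L[ℝ] E) (a b : E) : ℝ :=
  fderiv ℝ G x v a b + G x (m a) b + G x a (m b)

/-- The derivative of the metric terms of `lieForm` in the direction `c`, up to sign. -/
def killingSource (G : E → E →L[ℝ] E →L[ℝ] ℝ) (x v : E) (m : E →L[ℝ] E) :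
    E →L[ℝ] E →L[ℝ] E →L[ℝ] ℝ :=
  (fderiv ℝ (fderiv ℝ G) x).flip v + fderiv ℝ G x ∘L m
    + ((ContinuousLinearMap.compL ℝ E E (E →L[ℝ] ℝ)).flip m) ∘L fderiv ℝ G x
    + (ContinuousLinearMap.compL ℝ E (E →L[ℝ] ℝ) (E →L[ℝ] ℝ)
        ((ContinuousLinearMap.compL ℝ E E ℝ).flip m)) ∘L fderiv ℝ G x

theorem killingSource_apply (G : E → E →L[ℝ] E →L[ℝ] ℝ) (x v : E) (m : E →L[ℝ] E) (c a b : E) :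
    killingSource G x v m c a b = fderiv ℝ (fderiv ℝ G) x c v a b + fderiv ℝ G x (m c) a b
      + fderiv ℝ G x c (m a) b + fderiv ℝ G x c a (m b) := by
  simp [killingSource]

/-- The cyclic permutation of the arguments of a trilinear form. -/
def cyclicL : (E →L[ℝ] E →L[ℝ] E →L[ℝ] ℝ) →L[ℝ] (E →L[ℝ] E →L[ℝ] E →L[ℝ] ℝ) :=
  (ContinuousLinearMap.flipₗᵢ ℝ E E (E →L[ℝ] ℝ)).toContinuousLinearEquiv.toContinuousLinearMap ∘L
    ContinuousLinearMap.compL ℝ E (E →L[ℝ] E →L[ℝ] ℝ) (E →L[ℝ] E →L[ℝ] ℝ)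
      (ContinuousLinearMap.flipₗᵢ ℝ E E ℝ).toContinuousLinearEquiv.toContinuousLinearMap

theorem cyclicL_apply (T : E →L[ℝ] E →L[ℝ] E →L[ℝ] ℝ) (c a b : E) :
    cyclicL T c a b = T a b c := by
  simp [cyclicL]

/-- The second derivative of a Killing field in terms of its value `v` and its derivative `m`. -/
def killingHessian (G : E → E →L[ℝ] E →L[ℝ] ℝ) (x v : E) (m : E →L[ℝ] E) : E →L[ℝ] E →L[ℝ] E :=
  ContinuousLinearMap.compL ℝ E (E →L[ℝ] ℝ) E (G x).inverse ∘L
    ((-(1 / 2) : ℝ) • (killingSource G x v m + cyclicL (killingSource G x v m)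
      - cyclicL (cyclicL (killingSource G x v m))))

theorem killingHessian_smul (G : E → E →L[ℝ] E →L[ℝ] ℝ) (x v : E) (m : E →L[ℝ] E) (r : ℝ) :
    killingHessian G x (r • v) (r • m) = r • killingHessian G x v m := by
  have h : killingSource G x (r • v) (r • m) = r • killingSource G x v m := by
    ext c a b
    simp only [killingSource_apply, map_smul, smul_apply, smul_eq_mul]
    ring
  ext1 c
  ext1 a
  simp only [killingHessian, h, map_smul, ContinuousLinearMap.comp_apply, smul_apply,
    add_apply, sub_apply, map_add, map_sub, ContinuousLinearMap.compL_apply]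
  module

variable [FiniteDimensional ℝ E]

theorem isInvertible_of_nondegenerate {B : E →L[ℝ] E →L[ℝ] ℝ}
    (hB : ∀ v, (∀ w, B v w = 0) → v = 0) : B.IsInvertible := by
  have hinj : Function.Injective (B : E →ₗ[ℝ] E →L[ℝ] ℝ) := by
    rw [← LinearMap.ker_eq_bot, LinearMap.ker_eq_bot']
    intro v hv
    exact hB v fun w => by simpa using congrArg (fun L : E →L[ℝ] ℝ => L w) hv
  have hdim : Module.finrank ℝ E = Module.finrank ℝ (E →L[ℝ] ℝ) := by
    rw [← (LinearMap.toContinuousLinearMap (𝕜 := ℝ) (E := E) (F' := ℝ)).finrank_eq]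
    exact (Subspace.dual_finrank_eq (K := ℝ) (V := E)).symm
  refine ⟨(LinearEquiv.ofInjectiveOfFinrankEq (B : E →ₗ[ℝ] E →L[ℝ] ℝ) hinj
    hdim).toContinuousLinearEquiv, ?_⟩
  ext v w
  rfl

theorem killingHessian_spec {G : E → E →L[ℝ] E →L[ℝ] ℝ} {x : E}
    (hnd : ∀ v, (∀ w, G x v w = 0) → v = 0) (v : E) (m : E →L[ℝ] E) (c a b : E) :
    G x (killingHessian G x v m c a) b = -(1 / 2) * (killingSource G x v m c a b
      + killingSource G x v m a b c - killingSource G x v m b c a) := by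
  obtain ⟨e, he⟩ := isInvertible_of_nondegenerate hnd
  simp only [killingHessian, ← he, ContinuousLinearMap.inverse_equiv,
    ContinuousLinearMap.comp_apply, ContinuousLinearMap.compL_apply,
    ContinuousLinearEquiv.coe_coe, ContinuousLinearEquiv.apply_symm_apply]
  simp [cyclicL_apply]

/-- Koszul's trick: in the sum of the differentiated Killing equations at `(c, a, b)` and `(a, b,
c)` minus the one at `(b, c, a)`, the symmetries of `L` and of the metric leave only `2 G (L c a) b`
and source terms. -/
theorem eq_killingHessian {G : E → E →L[ℝ] E →L[ℝ] ℝ} {x : E}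
    (hnd : ∀ v, (∀ w, G x v w = 0) → v = 0) (hs : ∀ v w, G x v w = G x w v) (v : E)
    (m : E →L[ℝ] E) (L : E →L[ℝ] E →L[ℝ] E) (hL : ∀ a b, L a b = L b a)
    (h : ∀ c a b, killingSource G x v m c a b + G x (L c a) b + G x a (L c b) = 0) :
    L = killingHessian G x v m := by
  ext1 c
  ext1 a
  rw [← sub_eq_zero]
  refine hnd _ fun b => ?_
  rw [map_sub, sub_apply, killingHessian_spec hnd]
  have h1 := h c a b
  have h2 := h a b c
  have h3 := h b c a
  rw [hs a] at h1
  rw [hs b, hL a c] at h2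
  rw [hs c, hL b c, hL b a] at h3
  linarith

/-- The only non-polynomial ingredient is the inverse of the metric, and inversion is smooth at
invertible operators. -/
theorem ContDiffOn.killingHessian {G : E → E →L[ℝ] E →L[ℝ] ℝ} {Ω : Set E} (hΩ : IsOpen Ω)
    (hG : ContDiffOn ℝ ∞ G Ω) (hnd : ∀ x ∈ Ω, ∀ v, (∀ w, G x v w = 0) → v = 0) :
    ContDiffOn ℝ ∞ (fun p : E × E × (E →L[ℝ] E) => killingHessian G p.1 p.2.1 p.2.2)
      (Ω ×ˢ univ) := by
  have hD1 : ContDiffOn ℝ ∞ (fderiv ℝ G) Ω := hG.fderiv_of_isOpen hΩ (by simp)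
  have hD2 : ContDiffOn ℝ ∞ (fderiv ℝ (fderiv ℝ G)) Ω := hD1.fderiv_of_isOpen hΩ (by simp)
  have hfst : ContDiffOn ℝ ∞ (fun p : E × E × (E →L[ℝ] E) => p.1) (Ω ×ˢ univ) :=
    contDiff_fst.contDiffOn
  have hv : ContDiffOn ℝ ∞ (fun p : E × E × (E →L[ℝ] E) => p.2.1) (Ω ×ˢ univ) :=
    (contDiff_fst.comp contDiff_snd).contDiffOn
  have hm : ContDiffOn ℝ ∞ (fun p : E × E × (E →L[ℝ] E) => p.2.2) (Ω ×ˢ univ) :=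
    (contDiff_snd.comp contDiff_snd).contDiffOn
  have hmaps : MapsTo (fun p : E × E × (E →L[ℝ] E) => p.1) (Ω ×ˢ univ) Ω := fun p hp => hp.1
  have hD1' := hD1.comp hfst hmaps
  have hD2' := hD2.comp hfst hmaps
  have hI : ContDiffOn ℝ ∞ (fun x => (G x).inverse) Ω := by
    intro x hx
    obtain ⟨e, he⟩ := isInvertible_of_nondegenerate (hnd x hx)
    have := contDiffAt_map_inverse (n := ∞) e
    rw [he] at this
    exact this.comp_contDiffWithinAt x (hG x hx)
  have hI' := hI.comp hfst hmaps
  have hflip : ContDiffOn ℝ ∞ (fun p : E × E × (E →L[ℝ] E) =>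
      (fderiv ℝ (fderiv ℝ G) p.1).flip p.2.1) (Ω ×ˢ univ) :=
    contDiffOn_clm_apply.2 fun c => (hD2'.clm_apply contDiffOn_const).clm_apply hv
  have hsrc : ContDiffOn ℝ ∞ (fun p : E × E × (E →L[ℝ] E) => killingSource G p.1 p.2.1 p.2.2)
      (Ω ×ˢ univ) := by
    refine ((hflip.add (hD1'.clm_comp hm)).add (ContDiffOn.clm_comp ?_ hD1')).add
      (ContDiffOn.clm_comp ?_ hD1')
    · exact ((ContinuousLinearMap.compL ℝ E E (E →L[ℝ] ℝ)).flip).contDiff.comp_contDiffOn hm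
    · exact (ContinuousLinearMap.compL ℝ E (E →L[ℝ] ℝ) (E →L[ℝ] ℝ)).contDiff.comp_contDiffOn
        (((ContinuousLinearMap.compL ℝ E E ℝ).flip).contDiff.comp_contDiffOn hm)
  have hcyc := (cyclicL (E := E)).contDiff.comp_contDiffOn (n := ∞) hsrc
  have hcyc2 := (cyclicL (E := E)).contDiff.comp_contDiffOn (n := ∞) hcyc
  exact ContDiffOn.clm_comp
    ((ContinuousLinearMap.compL ℝ E (E →L[ℝ] ℝ) E).contDiff.comp_contDiffOn hI')
    (((hsrc.add hcyc).sub hcyc2).const_smul _)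

end KillingSystem

/-- A vector field `y` on the set `T`, with first and second derivatives `Y₁` and `Y₂` within `T`,
which satisfies the Killing equation and its first derivative on `T`. -/
structure KillingJet {E : Type*} [NormedAddCommGroup E] [NormedSpace ℝ E]
    (G : E → E →L[ℝ] E →L[ℝ] ℝ) (T : Set E) (y : E → E) (Y₁ : E → E →L[ℝ] E)
    (Y₂ : E → E →L[ℝ] E →L[ℝ] E) : Prop where
  contDiffOn : ContDiffOn ℝ ∞ y T
  hasFDerivWithinAt : ∀ x ∈ T, HasFDerivWithinAt y (Y₁ x) T x
  hasFDerivWithinAt' : ∀ x ∈ T, HasFDerivWithinAt Y₁ (Y₂ x) T x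
  killing : ∀ x ∈ T, ∀ a b, lieForm G x (y x) (Y₁ x) a b = 0
  killing' : ∀ x ∈ T, ∀ c a b,
    killingSource G x (y x) (Y₁ x) c a b + G x (Y₂ x c a) b + G x a (Y₂ x c b) = 0
  symm : ∀ x ∈ T, ∀ a b, Y₂ x a b = Y₂ x b a

/-! ### Extension of Killing fields, with their 2-jets, to the closure of a convex domain. -/

section KillingExtension

variable {E : Type*} [NormedAddCommGroup E] [NormedSpace ℝ E]

/-- The product rule applied to the Killing operator: the terms free of second derivatives of `y`
make up `killingSource`. -/
theorem hasFDerivAt_lieForm {G : E → E →L[ℝ] E →L[ℝ] ℝ} {Ω : Set E} (hΩ : IsOpen Ω)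
    (hG : ContDiffOn ℝ ∞ G Ω) {x : E} (hx : x ∈ Ω) {y : E → E} (hy : ContDiffAt ℝ ∞ y x) (a b c : E) :
    HasDerivAt (fun t : ℝ => lieForm G (x + t • c) (y (x + t • c)) (fderiv ℝ y (x + t • c)) a b)
      (killingSource G x (y x) (fderiv ℝ y x) c a b + G x (fderiv ℝ (fderiv ℝ y) x c a) b
        + G x a (fderiv ℝ (fderiv ℝ y) x c b)) 0 := by
  have hl : HasDerivAt (fun t : ℝ => x + t • c) c 0 := by
    simpa using ((hasDerivAt_id (0 : ℝ)).smul_const c).const_add x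
  have hGx : ContDiffAt ℝ ∞ G x := hG.contDiffAt (hΩ.mem_nhds hx)
  have e0 : x = x + (0 : ℝ) • c := by simp
  have key : ∀ {F : Type _} [NormedAddCommGroup F] [NormedSpace ℝ F] {f : E → F},
      DifferentiableAt ℝ f x → HasDerivAt (fun t : ℝ => f (x + t • c)) (fderiv ℝ f x c) 0 := by
    intro F _ _ f hf
    have := hf.hasFDerivAt
    nth_rewrite 2 [e0] at this
    exact this.comp_hasDerivAt 0 hl
  have h1 : HasDerivAt (fun t : ℝ => G (x + t • c)) _ 0 := key (hGx.differentiableAt (by simp))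
  have h2 : HasDerivAt (fun t : ℝ => fderiv ℝ G (x + t • c)) _ 0 :=
    key ((hGx.fderiv_right (m := ∞) (by simp)).differentiableAt (by simp))
  have h3 : HasDerivAt (fun t : ℝ => y (x + t • c)) _ 0 := key (hy.differentiableAt (by simp))
  have h4 : HasDerivAt (fun t : ℝ => fderiv ℝ y (x + t • c)) _ 0 :=
    key ((hy.fderiv_right (m := ∞) (by simp)).differentiableAt (by simp))
  have h5 := (((h2.clm_apply h3).clm_apply (hasDerivAt_const 0 a)).clm_apply
    (hasDerivAt_const 0 b))
  have h6 := ((h1.clm_apply (h4.clm_apply (hasDerivAt_const 0 a))).clm_apply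
    (hasDerivAt_const 0 b))
  have h7 := ((h1.clm_apply (hasDerivAt_const 0 a)).clm_apply
    (h4.clm_apply (hasDerivAt_const 0 b)))
  convert! (h5.add h6).add h7 using 1
  simp [killingSource_apply]
  ring

variable [FiniteDimensional ℝ E]

/-- The 1-jet solves a homogeneous linear system whose coefficients are smooth on all of `Ω`, so the
general extension result applies. The jet on the closure is kept because the horizon, where the
equations are used later, lies in the boundary of the domain. -/
theorem exists_killingJet {G : E → E →L[ℝ] E →L[ℝ] ℝ} {V Ω : Set E} (hΩ : IsOpen Ω)
    (hG : ContDiffOn ℝ ∞ G Ω) (hnd : ∀ x ∈ Ω, ∀ v, (∀ w, G x v w = 0) → v = 0)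
    (hs : ∀ x ∈ Ω, ∀ v w, G x v w = G x w v) (hV : IsOpen V) (hVc : Convex ℝ V)
    (hK : IsCompact (closure V)) (hVΩ : closure V ⊆ Ω) {y : E → E} (hy : ContDiffOn ℝ ∞ y V)
    (hkill : ∀ x ∈ V, ∀ a b, lieForm G x (y x) (fderiv ℝ y x) a b = 0) :
    ∃ y' Y₁ Y₂, EqOn y' y V ∧ KillingJet G (closure V) y' Y₁ Y₂ := by
  have hyx : ∀ x ∈ V, ContDiffAt ℝ ∞ y x := fun x hx => hy.contDiffAt (hV.mem_nhds hx)
  have hsymm : ∀ x ∈ V, ∀ a b, fderiv ℝ (fderiv ℝ y) x a b = fderiv ℝ (fderiv ℝ y) x b a :=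
    fun x hx a b => ((hyx x hx).isSymmSndFDerivAt
      (by simpa using two_le_infty)) a b
  have hkill' : ∀ x ∈ V, ∀ c a b, killingSource G x (y x) (fderiv ℝ y x) c a b
      + G x (fderiv ℝ (fderiv ℝ y) x c a) b + G x a (fderiv ℝ (fderiv ℝ y) x c b) = 0 := by
    intro x hx c a b
    have h1 := hasFDerivAt_lieForm hΩ hG (hVΩ (subset_closure hx)) (hyx x hx) a b c
    have hc : ContinuousAt (fun t : ℝ => x + t • c) 0 := by fun_prop
    have h2 : (fun t : ℝ => lieForm G (x + t • c) (y (x + t • c)) (fderiv ℝ y (x + t • c)) a b)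
        =ᶠ[𝓝 0] fun _ => 0 := by
      filter_upwards [hc.preimage_mem_nhds (t := V) (by simpa using hV.mem_nhds hx)] with t ht
      exact hkill _ ht a b
    exact h1.unique ((hasDerivAt_const (0 : ℝ) (0 : ℝ)).congr_of_eventuallyEq h2)
  have hhess : ∀ x ∈ V, fderiv ℝ (fderiv ℝ y) x = killingHessian G x (y x) (fderiv ℝ y x) :=
    fun x hx => eq_killingHessian (hnd x (hVΩ (subset_closure hx)))
      (hs x (hVΩ (subset_closure hx))) _ _ _ (hsymm x hx) (hkill' x hx)
  -- The system reads `Dy = m`, `Dm = killingHessian (y, m)` for the pair `(y, m)`.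
  let R : E → (E × (E →L[ℝ] E)) → E →L[ℝ] (E × (E →L[ℝ] E)) := fun x p =>
    ContinuousLinearMap.inl ℝ E (E →L[ℝ] E) ∘L p.2
      + ContinuousLinearMap.inr ℝ E (E →L[ℝ] E) ∘L killingHessian G x p.1 p.2
  have hRapp : ∀ x p a, R x p a = (p.2 a, killingHessian G x p.1 p.2 a) := by
    intro x p a; simp [R]
  have hR : ContDiffOn ℝ ∞ (fun p : E × (E × (E →L[ℝ] E)) => R p.1 p.2) (Ω ×ˢ univ) :=
    (contDiff_const.clm_comp (contDiff_snd.comp contDiff_snd)).contDiffOn.add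
      (contDiffOn_const.clm_comp (ContDiffOn.killingHessian hΩ hG hnd))
  have hom : ∀ x ∈ Ω, ∀ (c : ℝ) v, R x (c • v) = c • R x v := by
    intro x _ c v
    simp only [R, Prod.smul_fst, Prod.smul_snd, killingHessian_smul,
      ContinuousLinearMap.comp_smul, smul_add]
  have hΨ : ∀ x ∈ V, HasFDerivAt (fun x => (y x, fderiv ℝ y x)) (R x (y x, fderiv ℝ y x)) x := by
    intro x hx
    have h1 := ((hyx x hx).differentiableAt (by simp)).hasFDerivAt.prodMk
      (((hyx x hx).fderiv_right (m := ∞) (by simp)).differentiableAt (by simp)).hasFDerivAt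
    refine h1.congr_fderiv ?_
    ext1 a
    rw [hRapp, ContinuousLinearMap.prod_apply, hhess x hx]
  obtain ⟨Φ, hΦ, hΦs, hΦd⟩ := exists_contDiffOn_extension hV hVc hK hVΩ hR hom hΨ
  have hΦ1 : ∀ x ∈ V, (Φ x).1 = y x := fun x hx => by rw [hΦ hx]
  have hΦ2 : ∀ x ∈ V, (Φ x).2 = fderiv ℝ y x := fun x hx => by rw [hΦ hx]
  have hH : ContDiffOn ℝ ∞ (fun x => killingHessian G x (Φ x).1 (Φ x).2) (closure V) :=
    (ContDiffOn.killingHessian hΩ hG hnd).comp (contDiffOn_id.prodMk hΦs)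
      fun x hx => ⟨hVΩ hx, mem_univ _⟩
  have hGc : ContinuousOn G (closure V) := hG.continuousOn.mono hVΩ
  have hD1 : ContDiffOn ℝ ∞ (fderiv ℝ G) Ω := hG.fderiv_of_isOpen hΩ (by simp)
  have hD1c : ContinuousOn (fderiv ℝ G) (closure V) := hD1.continuousOn.mono hVΩ
  have hD2c : ContinuousOn (fderiv ℝ (fderiv ℝ G)) (closure V) :=
    (hD1.fderiv_of_isOpen (m := ∞) hΩ (by simp)).continuousOn.mono hVΩ
  have hc1 : ContinuousOn (fun x => (Φ x).1) (closure V) := hΦs.continuousOn.fst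
  have hc2 : ContinuousOn (fun x => (Φ x).2) (closure V) := hΦs.continuousOn.snd
  -- The Killing equation and its derivative are closed conditions, so they pass from `V` to its
  -- closure by continuity.
  have hcl : ∀ f : E → ℝ, ContinuousOn f (closure V) → (∀ x ∈ V, f x = 0) →
      ∀ x ∈ closure V, f x = 0 := fun f hf h0 =>
    Set.EqOn.of_subset_closure (g := fun _ => 0) h0 hf continuousOn_const subset_closure
      Subset.rfl
  refine ⟨fun x => (Φ x).1, fun x => (Φ x).2, fun x => killingHessian G x (Φ x).1 (Φ x).2,
    hΦ1, hΦs.fst, fun x hx => ?_, fun x hx => ?_, fun x hx a b => ?_, fun x hx c a b => ?_,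
    fun x hx a b => ?_⟩
  · refine (hasFDerivAt_fst.comp_hasFDerivWithinAt x (hΦd x hx)).congr_fderiv ?_
    ext1 a
    simp [R]
  · refine (hasFDerivAt_snd.comp_hasFDerivWithinAt x (hΦd x hx)).congr_fderiv ?_
    ext1 a
    simp [R]
  · refine hcl (fun x => lieForm G x (Φ x).1 (Φ x).2 a b) ?_ (fun x hx => ?_) x hx
    · exact (((hD1c.clm_apply hc1).clm_apply continuousOn_const).clm_apply
        continuousOn_const).add ((hGc.clm_apply (hc2.clm_apply continuousOn_const)).clm_apply
        continuousOn_const) |>.add ((hGc.clm_apply continuousOn_const).clm_apply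
        (hc2.clm_apply continuousOn_const))
    · simp only [hΦ1 x hx, hΦ2 x hx]
      exact hkill x hx a b
  · refine hcl (fun x => killingSource G x (Φ x).1 (Φ x).2 c a b
      + G x (killingHessian G x (Φ x).1 (Φ x).2 c a) b
      + G x a (killingHessian G x (Φ x).1 (Φ x).2 c b)) ?_ (fun x hx => ?_) x hx
    · have hHc := hH.continuousOn
      have k : ∀ c : E, ContinuousOn (fun _ : E => c) (closure V) := fun c => continuousOn_const
      simp only [killingSource_apply]
      exact ((((((hD2c.clm_apply (k c)).clm_apply hc1).clm_apply (k a)).clm_apply (k b)).add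
        (((hD1c.clm_apply (hc2.clm_apply (k c))).clm_apply (k a)).clm_apply (k b))).add
        (((hD1c.clm_apply (k c)).clm_apply (hc2.clm_apply (k a))).clm_apply (k b))).add
        (((hD1c.clm_apply (k c)).clm_apply (k a)).clm_apply (hc2.clm_apply (k b))) |>.add
        ((hGc.clm_apply ((hHc.clm_apply (k c)).clm_apply (k a))).clm_apply (k b)) |>.add
        ((hGc.clm_apply (k a)).clm_apply ((hHc.clm_apply (k c)).clm_apply (k b)))
    · simp only [hΦ1 x hx, hΦ2 x hx, ← hhess x hx]
      exact hkill' x hx c a b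
  · have hHc := hH.continuousOn
    have k : ∀ a b : E, ContinuousOn (fun x => killingHessian G x (Φ x).1 (Φ x).2 a b)
        (closure V) := fun a b =>
      (hHc.clm_apply continuousOn_const).clm_apply continuousOn_const
    refine Set.EqOn.of_subset_closure (s := V) (t := closure V)
      (f := fun x => killingHessian G x (Φ x).1 (Φ x).2 a b)
      (g := fun x => killingHessian G x (Φ x).1 (Φ x).2 b a) (fun x hx => ?_) (k a b)
      (k b a) subset_closure Subset.rfl hx
    simp only [hΦ1 x hx, hΦ2 x hx, ← hhess x hx]
    exact hsymm x hx a b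

end KillingExtension

/-! ### Geodesic and Jacobi equations in coordinates. -/

section Geodesics

variable {E : Type*} [NormedAddCommGroup E] [NormedSpace ℝ E]

/-- Christoffel symbols of the first kind of the metric `G`. -/
def chris (G : E → E →L[ℝ] E →L[ℝ] ℝ) (x a b w : E) : ℝ :=
  (1 / 2) * (fderiv ℝ G x a b w + fderiv ℝ G x b a w - fderiv ℝ G x w a b)

/-- The left-hand side of the geodesic equation at a point `x` of a curve with velocity `k` and
second derivative `l`, paired with `w`. -/
def geodesicForm (G : E → E →L[ℝ] E →L[ℝ] ℝ) (x k l w : E) : ℝ :=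
  G x l w + chris G x k k w

/-- The linearisation of `geodesicForm` at `(x, k, l)` in the direction `(j₀, j₁, j₂)`. -/
def jacobiForm (G : E → E →L[ℝ] E →L[ℝ] ℝ) (x k l j₀ j₁ j₂ w : E) : ℝ :=
  fderiv ℝ G x j₀ l w + G x j₂ w
    + (fderiv ℝ (fderiv ℝ G) x j₀ k k w - (1 / 2) * fderiv ℝ (fderiv ℝ G) x j₀ w k k)
    + (fderiv ℝ G x j₁ k w + fderiv ℝ G x k j₁ w
      - (1 / 2) * (fderiv ℝ G x w j₁ k + fderiv ℝ G x w k j₁))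

theorem jacobiForm_combination (G : E → E →L[ℝ] E →L[ℝ] ℝ) (x k l n a₀ a₁ a₂ w : E)
    (f f' f'' : ℝ) (hs : ∀ v a b, fderiv ℝ G x v a b = fderiv ℝ G x v b a)
    (h : jacobiForm G x k l (f • k + a₀) (f' • k + f • l + a₁)
      (f'' • k + (2 * f') • l + f • n + a₂) w = 0)
    (hk : jacobiForm G x k l k l n w = 0) (ha : jacobiForm G x k l a₀ a₁ a₂ w = 0)
    (hg : geodesicForm G x k l w = 0) : f'' * G x k w = 0 := by
  simp only [jacobiForm, geodesicForm, chris, map_add, map_smul, add_apply, smul_apply,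
    smul_eq_mul] at *
  have h1 := hs w a₁ k
  have h2 := hs w l k
  linear_combination h - f * hk - ha - 2 * f' * hg

/-- Here `t` is any variation parameter: the three curves `x`, `k`, `l` need not be related by
differentiation, only the pointwise geodesic equation is differentiated. -/
theorem HasDerivAt.jacobiForm_eq_zero {G : E → E →L[ℝ] E →L[ℝ] ℝ} {x k l : ℝ → E}
    {j₀ j₁ j₂ w : E} {t : ℝ} (hG : ContDiffAt ℝ ∞ G (x t)) (hx : HasDerivAt x j₀ t)
    (hk : HasDerivAt k j₁ t) (hl : HasDerivAt l j₂ t)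
    (h : ∀ᶠ s in 𝓝 t, geodesicForm G (x s) (k s) (l s) w = 0) :
    jacobiForm G (x t) (k t) (l t) j₀ j₁ j₂ w = 0 := by
  have h1 : HasDerivAt (fun s => G (x s)) (fderiv ℝ G (x t) j₀) t :=
    (hG.differentiableAt (by simp)).hasFDerivAt.comp_hasDerivAt t hx
  have h2 : HasDerivAt (fun s => fderiv ℝ G (x s)) (fderiv ℝ (fderiv ℝ G) (x t) j₀) t :=
    ((hG.fderiv_right (m := ∞) (by simp)).differentiableAt
      (by simp)).hasFDerivAt.comp_hasDerivAt t hx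
  have hw := hasDerivAt_const t w
  have h3 := (h1.clm_apply hl).clm_apply hw
  have h4 := ((h2.clm_apply hk).clm_apply hk).clm_apply hw
  have h5 := ((h2.clm_apply hw).clm_apply hk).clm_apply hk
  have h6 := h3.add (((h4.add h4).sub h5).const_mul (1 / 2))
  have h7 := h6.unique ((hasDerivAt_const t (0 : ℝ)).congr_of_eventuallyEq h)
  rw [← h7]
  simp only [jacobiForm, add_apply, map_zero, add_zero]
  ring

/-- A Killing field satisfies the Jacobi equation along geodesics. -/
theorem jacobiForm_killing {G : E → E →L[ℝ] E →L[ℝ] ℝ} {x v : E} {m : E →L[ℝ] E}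
    {L : E →L[ℝ] E →L[ℝ] E} (hL : ∀ a b, L a b = L b a)
    (hG2 : ∀ a b, fderiv ℝ (fderiv ℝ G) x a b = fderiv ℝ (fderiv ℝ G) x b a)
    (hs : ∀ a b, G x a b = G x b a) (hs1 : ∀ v a b, fderiv ℝ G x v a b = fderiv ℝ G x v b a)
    (h1 : ∀ a b, lieForm G x v m a b = 0)
    (h2 : ∀ c a b, killingSource G x v m c a b + G x (L c a) b + G x a (L c b) = 0)
    {k l : E} (hg : ∀ w, geodesicForm G x k l w = 0) (w : E) :
    jacobiForm G x k l v (m k) (L k k + m l) w = 0 := by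
  have e1 := h1 l w
  have e2 := h2 k k w
  have e3 := h2 w k k
  have e4 := hg (m w)
  simp only [killingSource_apply, lieForm, geodesicForm, chris, jacobiForm, map_add,
    add_apply] at *
  rw [hG2 k v] at e2
  rw [hG2 w v, hL w k, hs k (L k w)] at e3
  rw [hs k (L k w)] at e2
  have e5 := hs1 w k (m k)
  have e6 := hs1 (m w) k k
  linear_combination e1 + e2 - (1 / 2) * e3 - e4

/-- Covariance of the geodesic equation. The second derivatives of `ψ` in the derivative of the
pulled-back metric match the term `D²ψ(k, k)` in the transformed acceleration. -/
theorem geodesicForm_pullback {G₁ G₂ : E → E →L[ℝ] E →L[ℝ] ℝ} {ψ : E → E} {x : E}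
    (hψ : ContDiffAt ℝ ∞ ψ x) (hG : DifferentiableAt ℝ G₂ (ψ x))
    (hs : ∀ᶠ y in 𝓝 (ψ x), ∀ a b, G₂ y a b = G₂ y b a)
    (h : ∀ᶠ y in 𝓝 x, ∀ a b, G₁ y a b = G₂ (ψ y) (fderiv ℝ ψ y a) (fderiv ℝ ψ y b))
    (hG₁ : DifferentiableAt ℝ G₁ x) (k l w : E) :
    geodesicForm G₂ (ψ x) (fderiv ℝ ψ x k) (fderiv ℝ (fderiv ℝ ψ) x k k + fderiv ℝ ψ x l)
      (fderiv ℝ ψ x w) = geodesicForm G₁ x k l w := by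
  have hsym : ∀ a b, fderiv ℝ (fderiv ℝ ψ) x a b = fderiv ℝ (fderiv ℝ ψ) x b a := fun a b =>
    (hψ.isSymmSndFDerivAt (by simpa using two_le_infty)) a b
  have hd : ∀ c a b, fderiv ℝ G₁ x c a b =
      fderiv ℝ G₂ (ψ x) (fderiv ℝ ψ x c) (fderiv ℝ ψ x a) (fderiv ℝ ψ x b)
      + G₂ (ψ x) (fderiv ℝ (fderiv ℝ ψ) x c a) (fderiv ℝ ψ x b)
      + G₂ (ψ x) (fderiv ℝ ψ x a) (fderiv ℝ (fderiv ℝ ψ) x c b) := by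
    intro c a b
    have h1 : HasFDerivAt (fun y => G₂ (ψ y)) _ x :=
      hG.hasFDerivAt.comp x (hψ.differentiableAt (by simp)).hasFDerivAt
    have h2 := ((hψ.fderiv_right (m := ∞) (by simp)).differentiableAt (by simp)).hasFDerivAt
    have h3 := (h1.clm_apply (h2.clm_apply (hasFDerivAt_const a x))).clm_apply
      (h2.clm_apply (hasFDerivAt_const b x))
    have h4 := (hG₁.hasFDerivAt.clm_apply (hasFDerivAt_const a x)).clm_apply
      (hasFDerivAt_const b x)
    have h5 := h4.unique (h3.congr_of_eventuallyEq (by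
      filter_upwards [h] with y hy using hy a b))
    have h6 := congrArg (fun T : E →L[ℝ] ℝ => T c) h5
    simpa [add_comm, add_left_comm, add_assoc] using h6
  have h0 := h.self_of_nhds
  have hs0 := hs.self_of_nhds
  simp only [geodesicForm, chris, hd, h0, map_add, add_apply]
  rw [hsym k w, hs0 (fderiv ℝ ψ x k) (fderiv ℝ (fderiv ℝ ψ) x w k)]
  ring

/-- Geodesics have constant squared speed: test the geodesic equation against the velocity. -/
theorem hasDerivAt_metric_velocity {G : E → E →L[ℝ] E →L[ℝ] ℝ} {x k : ℝ → E} {l : E} {t : ℝ}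
    (hG : DifferentiableAt ℝ G (x t)) (hs : ∀ a b, G (x t) a b = G (x t) b a)
    (hx : HasDerivAt x (k t) t) (hk : HasDerivAt k l t)
    (hg : ∀ w, geodesicForm G (x t) (k t) l w = 0) :
    HasDerivAt (fun s => G (x s) (k s) (k s)) 0 t := by
  have h1 : HasDerivAt (fun s => G (x s)) (fderiv ℝ G (x t) (k t)) t :=
    hG.hasFDerivAt.comp_hasDerivAt t hx
  refine ((h1.clm_apply hk).clm_apply hk).congr_deriv ?_
  have := hg (k t)
  simp only [geodesicForm, chris, add_apply] at *
  rw [hs (k t) l]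
  linear_combination 2 * this

/-- A conservation law: along a geodesic the derivative of `G(X, k)` is half of the Lie derivative
of `G` on `(k, k)`, which is proportional to `G(k, k) = 0`. -/
theorem hasDerivAt_metric_conformal {G : E → E →L[ℝ] E →L[ℝ] ℝ} {x k : ℝ → E} {l : E} {t φ : ℝ}
    {X : E → E} (hG : DifferentiableAt ℝ G (x t)) (hs : ∀ a b, G (x t) a b = G (x t) b a)
    (hs1 : ∀ v a b, fderiv ℝ G (x t) v a b = fderiv ℝ G (x t) v b a)
    (hx : HasDerivAt x (k t) t) (hk : HasDerivAt k l t)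
    (hg : ∀ w, geodesicForm G (x t) (k t) l w = 0) (hX : DifferentiableAt ℝ X (x t))
    (hX' : ∀ a b, lieForm G (x t) (X (x t)) (fderiv ℝ X (x t)) a b = φ * G (x t) a b)
    (hnull : G (x t) (k t) (k t) = 0) :
    HasDerivAt (fun s => G (x s) (X (x s)) (k s)) 0 t := by
  have h1 : HasDerivAt (fun s => G (x s)) (fderiv ℝ G (x t) (k t)) t :=
    hG.hasFDerivAt.comp_hasDerivAt t hx
  have h2 : HasDerivAt (fun s => X (x s)) (fderiv ℝ X (x t) (k t)) t :=
    hX.hasFDerivAt.comp_hasDerivAt t hx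
  refine ((h1.clm_apply h2).clm_apply hk).congr_deriv ?_
  have e1 := hg (X (x t))
  have e2 := hX' (k t) (k t)
  simp only [geodesicForm, chris, lieForm, add_apply] at *
  rw [hnull, hs (k t) (fderiv ℝ X (x t) (k t))] at e2
  rw [hs (X (x t)) l, hs1 _ (X (x t))]
  linear_combination e1 + (1 / 2) * e2

variable [FiniteDimensional ℝ E]

/-- Picard–Lindelöf for the first-order system `x' = k`, `k' = -G⁻¹ C(x, k)`, with the time interval
shrunk so that the solution stays in `Ω`. -/
theorem exists_geodesic {G : E → E →L[ℝ] E →L[ℝ] ℝ} {Ω : Set E} (hΩ : IsOpen Ω)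
    (hG : ContDiffOn ℝ ∞ G Ω) (hnd : ∀ x ∈ Ω, ∀ v, (∀ w, G x v w = 0) → v = 0)
    {x₀ : E} (hx₀ : x₀ ∈ Ω) (k₀ : E) :
    ∃ (x k : ℝ → E) (ε : ℝ), 0 < ε ∧ x 0 = x₀ ∧ k 0 = k₀ ∧ ∀ t ∈ Ioo (-ε) ε, x t ∈ Ω ∧
      HasDerivAt x (k t) t ∧ ∃ l, HasDerivAt k l t ∧ ∀ w, geodesicForm G (x t) (k t) l w = 0 := by
  have hD1 : ContDiffOn ℝ ∞ (fderiv ℝ G) Ω := hG.fderiv_of_isOpen hΩ (by simp)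
  let C : E × E → E →L[ℝ] ℝ := fun p => (1 / 2 : ℝ) • ((fderiv ℝ G p.1 p.2).flip.flip p.2
    + fderiv ℝ G p.1 p.2 p.2 - ((fderiv ℝ G p.1).flip p.2).flip p.2)
  have hC : ∀ p w, C p w = chris G p.1 p.2 p.2 w := by
    intro p w
    simp [C, chris]
  have hCs : ContDiffOn ℝ ∞ C (Ω ×ˢ univ) := by
    refine contDiffOn_clm_apply.2 fun w => ?_
    simp only [hC, chris]
    have hD1' := hD1.comp (contDiff_fst.contDiffOn (s := Ω ×ˢ (univ : Set E))) fun p hp => hp.1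
    have hk : ContDiffOn ℝ ∞ (fun p : E × E => p.2) (Ω ×ˢ univ) := contDiff_snd.contDiffOn
    exact contDiffOn_const.mul (((((hD1'.clm_apply hk).clm_apply hk).clm_apply
      contDiffOn_const).add (((hD1'.clm_apply hk).clm_apply hk).clm_apply contDiffOn_const)).sub
      (((hD1'.clm_apply contDiffOn_const).clm_apply hk).clm_apply hk))
  have hI : ContDiffOn ℝ ∞ (fun x => (G x).inverse) Ω := by
    intro x hx
    obtain ⟨e, he⟩ := isInvertible_of_nondegenerate (hnd x hx)
    have := contDiffAt_map_inverse (n := ∞) e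
    rw [he] at this
    exact this.comp_contDiffWithinAt x (hG x hx)
  have hI' := hI.comp (contDiff_fst.contDiffOn (s := Ω ×ˢ (univ : Set E))) fun p hp => hp.1
  have hv : ContDiffAt ℝ 1 (fun p : E × E => (p.2, (G p.1).inverse (-C p))) (x₀, k₀) := by
    refine ((contDiff_snd.contDiffOn.prodMk (hI'.clm_apply hCs.neg)).contDiffAt ?_).of_le
      (by exact_mod_cast le_top)
    exact (hΩ.prod isOpen_univ).mem_nhds ⟨hx₀, mem_univ _⟩
  obtain ⟨f, hf0, ε, hε, hf⟩ :=
    hv.exists_forall_mem_closedBall_exists_eq_forall_mem_Ioo_hasDerivAt₀ 0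
  simp only [zero_sub, zero_add] at hf
  have hfc : ContinuousAt f 0 := (hf 0 ⟨by linarith, hε⟩).continuousAt
  have hnb : ∀ᶠ t in 𝓝 (0 : ℝ), (f t).1 ∈ Ω := by
    refine (continuous_fst.continuousAt.comp hfc).eventually_mem (hΩ.mem_nhds ?_)
    simpa [hf0] using hx₀
  obtain ⟨δ, hδ, hball⟩ := Metric.eventually_nhds_iff_ball.1 hnb
  refine ⟨fun t => (f t).1, fun t => (f t).2, min ε δ, lt_min hε hδ, by simp [hf0], by simp [hf0],
    fun t ht => ?_⟩
  have htε : t ∈ Ioo (-ε) ε :=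
    ⟨by linarith [ht.1, min_le_left ε δ], ht.2.trans_le (min_le_left _ _)⟩
  have htδ : (f t).1 ∈ Ω := hball t (by
    rw [Real.ball_eq_Ioo]
    exact ⟨by linarith [ht.1, min_le_right ε δ], by linarith [ht.2, min_le_right ε δ]⟩)
  have hd := hf t htε
  have hd1 : HasDerivAt (fun t => (f t).1) (f t).2 t :=
    (hasFDerivAt_fst (p := f t)).comp_hasDerivAt (f := f) t hd
  have hd2 : HasDerivAt (fun t => (f t).2) ((G (f t).1).inverse (-C (f t))) t :=
    (hasFDerivAt_snd (p := f t)).comp_hasDerivAt (f := f) t hd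
  refine ⟨htδ, hd1, _, hd2, fun w => ?_⟩
  obtain ⟨e, he⟩ := isInvertible_of_nondegenerate (hnd _ htδ)
  rw [geodesicForm, ← hC (f t) w, ← he, ContinuousLinearMap.inverse_equiv]
  simp

end Geodesics

/-! ### Timelike conformal Killing fields near a hypersurface. -/

theorem tendsto_clm_apply {α E F : Type*} [NormedAddCommGroup E] [NormedSpace ℝ E]
    [NormedAddCommGroup F] [NormedSpace ℝ F] {l : Filter α} {A : α → E →L[ℝ] F} {v : α → E}
    {A₀ : E →L[ℝ] F} {v₀ : E} (hA : Tendsto A l (𝓝 A₀)) (hv : Tendsto v l (𝓝 v₀)) :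
    Tendsto (fun x => A x (v x)) l (𝓝 (A₀ v₀)) :=
  ((isBoundedBilinearMap_apply (𝕜 := ℝ) (E := E) (F := F)).continuous.tendsto (A₀, v₀)).comp
    (hA.prodMk_nhds hv)

section ConformalFields

variable {E : Type*} [NormedAddCommGroup E] [NormedSpace ℝ E] [FiniteDimensional ℝ E]

/-- A timelike conformal Killing field on one side of a hypersurface does not tend to zero at
points of the hypersurface which admit a transversal null vector. -/
theorem exists_frequently_le_norm {G : E → E →L[ℝ] E →L[ℝ] ℝ} {Ω : Set E} (hΩ : IsOpen Ω)
    (hG : ContDiffOn ℝ ∞ G Ω) (hnd : ∀ x ∈ Ω, ∀ v, (∀ w, G x v w = 0) → v = 0)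
    (hs : ∀ x ∈ Ω, ∀ v w, G x v w = G x w v)
    (hlor : ∀ x ∈ Ω, ∀ v k, G x v v < 0 → G x k k = 0 → k ≠ 0 → G x v k ≠ 0)
    {p : E} (hp : p ∈ Ω) {ℓ : E →L[ℝ] ℝ} (hℓ : ℓ p = 0) {k₀ : E} (hk₀ : 0 < ℓ k₀)
    (hnull : G p k₀ k₀ = 0) {X : E → E} {φ : E → ℝ}
    (hX : ContDiffOn ℝ ∞ X (Ω ∩ {x | 0 < ℓ x})) (ht : ∀ x ∈ Ω, 0 < ℓ x → G x (X x) (X x) < 0)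
    (hconf : ∀ x ∈ Ω, 0 < ℓ x → ∀ a b, lieForm G x (X x) (fderiv ℝ X x) a b = φ x * G x a b) :
    ∃ δ > 0, ∃ᶠ x in 𝓝[Ω ∩ {x | 0 < ℓ x}] p, δ ≤ ‖X x‖ := by
  have hUo : IsOpen (Ω ∩ {x | 0 < ℓ x}) := hΩ.inter (isOpen_lt continuous_const ℓ.continuous)
  have hGd : ∀ x ∈ Ω, DifferentiableAt ℝ G x := fun x hx =>
    (hG.contDiffAt (hΩ.mem_nhds hx)).differentiableAt (by simp)
  have hs1 : ∀ x ∈ Ω, ∀ v a b, fderiv ℝ G x v a b = fderiv ℝ G x v b a := by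
    intro x hx v a b
    have h1 := ((hGd x hx).hasFDerivAt.clm_apply (hasFDerivAt_const a x)).clm_apply
      (hasFDerivAt_const b x)
    have h2 := ((hGd x hx).hasFDerivAt.clm_apply (hasFDerivAt_const b x)).clm_apply
      (hasFDerivAt_const a x)
    have h3 := h1.unique (h2.congr_of_eventuallyEq (by
      filter_upwards [hΩ.mem_nhds hx] with y hy using hs y hy a b))
    simpa using congrArg (fun T : E →L[ℝ] ℝ => T v) h3
  -- The null geodesic issuing from `p` in the transversal direction; it stays null and enters the
  -- side where `X` is defined.
  obtain ⟨x, k, ε, hε, hx0, hk0, hgeo⟩ := exists_geodesic hΩ hG hnd hp k₀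
  have h0 : (0 : ℝ) ∈ Ioo (-ε) ε := ⟨by linarith, hε⟩
  have hxd : ∀ t ∈ Ioo (-ε) ε, HasDerivAt x (k t) t := fun t ht => (hgeo t ht).2.1
  have hkc : ContinuousAt k 0 := by
    obtain ⟨l, hl, -⟩ := (hgeo 0 h0).2.2
    exact hl.continuousAt
  have hxc : ContinuousAt x 0 := (hxd 0 h0).continuousAt
  have hnull' : ∀ t ∈ Ioo (-ε) ε, G (x t) (k t) (k t) = 0 := by
    intro t ht
    have hd : ∀ t ∈ Ioo (-ε) ε, HasDerivAt (fun s => G (x s) (k s) (k s)) 0 t := by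
      intro t ht
      obtain ⟨hxt, hx', l, hl, hg⟩ := hgeo t ht
      exact hasDerivAt_metric_velocity (hGd _ hxt) (hs _ hxt) hx' hl hg
    have := isOpen_Ioo.is_const_of_deriv_eq_zero isPreconnected_Ioo
      (fun t ht => (hd t ht).differentiableAt.differentiableWithinAt)
      (fun t ht => (hd t ht).deriv) ht h0
    rw [this, hx0, hk0, hnull]
  have hpos : ∀ᶠ t in 𝓝[>] (0 : ℝ), 0 < ℓ (x t) := by
    have hd : HasDerivAt (fun t => ℓ (x t)) (ℓ k₀) 0 := by
      have := ℓ.hasFDerivAt.comp_hasDerivAt 0 (hxd 0 h0)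
      rwa [hk0] at this
    filter_upwards [hd.tendsto_slope_zero_right.eventually (eventually_gt_nhds hk₀),
      self_mem_nhdsWithin] with t ht ht0
    simp only [zero_add, hx0, hℓ, sub_zero, smul_eq_mul] at ht
    exact (pos_iff_pos_of_mul_pos ht).1 (inv_pos.2 ht0)
  have hk0' : k₀ ≠ 0 := fun h => by simp [h] at hk₀
  have hkne : ∀ᶠ t in 𝓝[>] (0 : ℝ), k t ≠ 0 :=
    (hkc.eventually_ne (by rwa [hk0])).filter_mono nhdsWithin_le_nhds
  have hbd : ∀ᶠ t in 𝓝[>] (0 : ℝ), ‖G (x t)‖ * ‖k t‖ < ‖G p‖ * ‖k₀‖ + 1 := by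
    have hGc : ContinuousAt (fun t => G (x t)) 0 :=
      ContinuousAt.comp (by rw [hx0]; exact (hGd p hp).continuousAt) hxc
    refine Filter.Eventually.filter_mono nhdsWithin_le_nhds ?_
    refine (hGc.norm.mul hkc.norm).eventually_lt_const ?_
    simp [hx0, hk0]
  have hinε : ∀ᶠ t in 𝓝[>] (0 : ℝ), t ∈ Ioo (-ε) ε :=
    nhdsWithin_le_nhds (isOpen_Ioo.mem_nhds h0)
  obtain ⟨η, hη, hIoo⟩ := mem_nhdsGT_iff_exists_Ioo_subset.1
    (((hpos.and hkne).and (hbd.and hinε)))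
  have hη0 : (0 : ℝ) < η := hη
  -- The conservation law holds only at positive times, since `X` is not defined on the
  -- hypersurface.
  have hconst : ∀ t ∈ Ioo 0 η, G (x t) (X (x t)) (k t)
      = G (x (η / 2)) (X (x (η / 2))) (k (η / 2)) := by
    intro t ht
    have hd : ∀ t ∈ Ioo 0 η, HasDerivAt (fun s => G (x s) (X (x s)) (k s)) 0 t := by
      intro t ht
      obtain ⟨⟨htp, -⟩, -, htε⟩ := hIoo ht
      obtain ⟨hxt, hx', l, hl, hg⟩ := hgeo t htε
      exact hasDerivAt_metric_conformal (hGd _ hxt) (hs _ hxt) (hs1 _ hxt) hx' hl hg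
        ((hX.contDiffAt (hUo.mem_nhds ⟨hxt, htp⟩)).differentiableAt (by simp))
        (hconf _ hxt htp) (hnull' t htε)
    exact isOpen_Ioo.is_const_of_deriv_eq_zero isPreconnected_Ioo
      (fun t ht => (hd t ht).differentiableAt.differentiableWithinAt)
      (fun t ht => (hd t ht).deriv) ht ⟨by linarith, by linarith⟩
  set c := G (x (η / 2)) (X (x (η / 2))) (k (η / 2)) with hc
  have hc0 : c ≠ 0 := by
    obtain ⟨⟨htp, hkt⟩, -, htε⟩ := hIoo (show η / 2 ∈ Ioo 0 η from ⟨by linarith, by linarith⟩)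
    exact hlor _ (hgeo _ htε).1 _ _ (ht _ (hgeo _ htε).1 htp) (hnull' _ htε) hkt
  have hC : 0 < ‖G p‖ * ‖k₀‖ + 1 := by positivity
  -- From `|c| ≤ ‖G‖ ‖X‖ ‖k‖` and the bound on `‖G‖ ‖k‖` near time zero; the added `1` provides room
  -- for continuity and makes the denominator positive.
  refine ⟨|c| / (‖G p‖ * ‖k₀‖ + 1), by positivity, ?_⟩
  have htend : Tendsto x (𝓝[>] 0) (𝓝[Ω ∩ {x | 0 < ℓ x}] p) := by
    refine tendsto_nhdsWithin_iff.2 ⟨?_, ?_⟩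
    · rw [← hx0]
      exact hxc.mono_left nhdsWithin_le_nhds
    · filter_upwards [hpos, hinε] with t h1 h2 using ⟨(hgeo t h2).1, h1⟩
  refine htend.frequently (Filter.Eventually.frequently ?_)
  filter_upwards [Ioo_mem_nhdsGT hη0] with t ht
  obtain ⟨-, hb, -⟩ := hIoo ht
  rw [div_le_iff₀ hC, ← hconst t ht, ← Real.norm_eq_abs]
  calc ‖G (x t) (X (x t)) (k t)‖ ≤ ‖G (x t)‖ * ‖X (x t)‖ * ‖k t‖ :=
        ContinuousLinearMap.le_opNorm₂ _ _ _
    _ = ‖X (x t)‖ * (‖G (x t)‖ * ‖k t‖) := by ring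
    _ ≤ _ := by gcongr

end ConformalFields

/-- Compactness of the unit sphere applied to `X / ‖X‖`. Where `‖X‖ ≥ δ`, division by `‖X‖`
preserves convergence to zero, and the sign condition passes to the limit as a weak inequality. -/
theorem exists_unit_limit {E : Type*} [NormedAddCommGroup E] [NormedSpace ℝ E] [ProperSpace E]
    {G : E → E →L[ℝ] E →L[ℝ] ℝ} {β : E → E →L[ℝ] ℝ}
    {p : E} {F : Filter E} (hF : F ≤ 𝓝 p) (hG : ContinuousAt G p) (hβ : ContinuousAt β p)
    {X y : E → E} {y₀ : E} (hy : Tendsto y F (𝓝 y₀)) {δ : ℝ} (hδ : 0 < δ)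
    (hX : ∃ᶠ x in F, δ ≤ ‖X x‖) (ht : ∀ᶠ x in F, G x (X x) (X x) < 0)
    (hβX : Tendsto (fun x => β x (X x)) F (𝓝 0))
    (hXy : Tendsto (fun x => G x (X x) (y x)) F (𝓝 0)) :
    ∃ ξ : E, ξ ≠ 0 ∧ G p ξ ξ ≤ 0 ∧ β p ξ = 0 ∧ G p ξ y₀ = 0 := by
  have hne : (F ⊓ 𝓟 {x | δ ≤ ‖X x‖}).NeBot := frequently_mem_iff_neBot.1 hX
  -- An ultrafilter concentrated on the points with `‖X‖ ≥ δ` plays the role of a convergent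
  -- subsequence.
  obtain ⟨𝒰, h𝒰⟩ := Ultrafilter.exists_le (F ⊓ 𝓟 {x | δ ≤ ‖X x‖})
  have h𝒰F : (𝒰 : Filter E) ≤ F := h𝒰.trans inf_le_left
  have h𝒰δ : ∀ᶠ x in (𝒰 : Filter E), δ ≤ ‖X x‖ := h𝒰.trans inf_le_right (mem_principal_self _)
  let u : E → E := fun x => ‖X x‖⁻¹ • X x
  have hu : ∀ᶠ x in (𝒰 : Filter E), u x ∈ Metric.sphere (0 : E) 1 := by
    filter_upwards [h𝒰δ] with x hx
    have : ‖X x‖ ≠ 0 := (hδ.trans_le hx).ne'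
    simp [u, norm_smul, this]
  obtain ⟨ξ, hξ, hlim⟩ := (isCompact_sphere (0 : E) 1).ultrafilter_le_nhds (𝒰.map u)
    (by rw [le_principal_iff]; exact hu)
  have hul : Tendsto u 𝒰 (𝓝 ξ) := hlim
  have hG' : Tendsto G 𝒰 (𝓝 (G p)) := hG.mono_left (h𝒰F.trans hF)
  have hβ' : Tendsto β 𝒰 (𝓝 (β p)) := hβ.mono_left (h𝒰F.trans hF)
  have hinv : ∀ {g : E → ℝ}, Tendsto g F (𝓝 0) →
      Tendsto (fun x => ‖X x‖⁻¹ * g x) 𝒰 (𝓝 0) := by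
    intro g hg
    have hg' : Tendsto (fun x => δ⁻¹ * ‖g x‖) 𝒰 (𝓝 0) := by
      simpa using ((hg.mono_left h𝒰F).norm).const_mul δ⁻¹
    refine squeeze_zero_norm' ?_ hg'
    filter_upwards [h𝒰δ] with x hx
    rw [norm_mul, norm_inv, norm_norm]
    gcongr
  refine ⟨ξ, ?_, ?_, ?_, ?_⟩
  · rintro rfl
    simp at hξ
  · refine le_of_tendsto (tendsto_clm_apply (tendsto_clm_apply hG' hul) hul) ?_
    filter_upwards [h𝒰F ht] with x hx
    have hx' : G x (X x) (X x) < 0 := hx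
    simp only [u, map_smul, smul_apply, smul_eq_mul]
    have : 0 ≤ ‖X x‖⁻¹ := by positivity
    exact mul_nonpos_of_nonneg_of_nonpos this
      (mul_nonpos_of_nonneg_of_nonpos this hx'.le)
  · refine tendsto_nhds_unique (tendsto_clm_apply hβ' hul) ((hinv hβX).congr fun x => ?_)
    simp [u]
  · refine tendsto_nhds_unique (tendsto_clm_apply (tendsto_clm_apply hG' hul) (hy.mono_left h𝒰F))
      ((hinv hXy).congr fun x => ?_)
    simp [u]

/-! ### Vector fields in charts. -/

section Charts

variable {M : Type*} [TopologicalSpace M] [ChartedSpace E4 M]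

theorem mdifferentiable_of_mem_maximalAtlas [IsManifold (𝓡 4) ∞ M] {e : OpenPartialHomeomorph M E4}
    (he : e ∈ IsManifold.maximalAtlas (𝓡 4) ∞ M) : e.MDifferentiable (𝓡 4) (𝓡 4) :=
  ⟨(contMDiffOn_of_mem_maximalAtlas he).mdifferentiableOn (by simp),
    (contMDiffOn_symm_of_mem_maximalAtlas he).mdifferentiableOn (by simp)⟩

/-- The components of a vector field in the chart `e`. -/
def coordField (e : OpenPartialHomeomorph M E4) (V : VField M) (x : E4) : E4 :=
  mfderiv (𝓡 4) (𝓡 4) e (e.symm x) (V (e.symm x))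

/-- The coordinate vector field of the chart `e` with constant components `a`. -/
def constField (e : OpenPartialHomeomorph M E4) (a : E4) : VField M :=
  VectorField.mpullback (𝓡 4) (𝓡 4) e (fun _ => (a : E4))

variable {e : OpenPartialHomeomorph M E4}

theorem mfderiv_mfderiv_symm (he : e.MDifferentiable (𝓡 4) (𝓡 4)) {x : E4} (hx : x ∈ e.target)
    (a : E4) :
    mfderiv (𝓡 4) (𝓡 4) e (e.symm x) (mfderiv (𝓡 4) (𝓡 4) e.symm x a) = a :=
  congrArg (fun T : E4 →L[ℝ] E4 => T a) (he.comp_symm_deriv hx)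

theorem mfderiv_symm_mfderiv (he : e.MDifferentiable (𝓡 4) (𝓡 4)) {x : E4} (hx : x ∈ e.target)
    (v : TangentSpace (𝓡 4) (e.symm x)) :
    mfderiv (𝓡 4) (𝓡 4) e.symm x (mfderiv (𝓡 4) (𝓡 4) e (e.symm x) v) = v := by
  have h := he.symm_comp_deriv (e.map_target hx)
  rw [e.right_inv hx] at h
  exact congrArg (fun T : TangentSpace (𝓡 4) (e.symm x) →L[ℝ] TangentSpace (𝓡 4) (e.symm x) =>
    T v) h

theorem isInvertible_mfderiv (he : e.MDifferentiable (𝓡 4) (𝓡 4)) {m : M} (hm : m ∈ e.source) :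
    (mfderiv (𝓡 4) (𝓡 4) e m).IsInvertible :=
  ⟨he.mfderiv hm, rfl⟩

theorem isInvertible_mfderiv_symm (he : e.MDifferentiable (𝓡 4) (𝓡 4)) {x : E4}
    (hx : x ∈ e.target) : (mfderiv (𝓡 4) (𝓡 4) e.symm x).IsInvertible :=
  ⟨he.symm.mfderiv hx, rfl⟩

theorem mfderiv_symm_coordField (he : e.MDifferentiable (𝓡 4) (𝓡 4)) (V : VField M) {x : E4}
    (hx : x ∈ e.target) : mfderiv (𝓡 4) (𝓡 4) e.symm x (coordField e V x) = V (e.symm x) :=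
  mfderiv_symm_mfderiv he hx _

/-- This identification makes the results on pullbacks of vector fields, for smoothness and for Lie
brackets, available for components. -/
theorem mpullback_symm_eq_coordField (he : e.MDifferentiable (𝓡 4) (𝓡 4)) (V : VField M) {x : E4}
    (hx : x ∈ e.target) :
    VectorField.mpullback (𝓡 4) (𝓡 4) e.symm V x = coordField e V x := by
  obtain ⟨A, hA⟩ := isInvertible_mfderiv_symm he hx
  rw [VectorField.mpullback_apply, ← mfderiv_symm_coordField he V hx, ← hA,
    ContinuousLinearMap.inverse_equiv]
  exact A.symm_apply_apply _

theorem constField_symm (he : e.MDifferentiable (𝓡 4) (𝓡 4)) (a : E4) {x : E4}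
    (hx : x ∈ e.target) : constField e a (e.symm x) = mfderiv (𝓡 4) (𝓡 4) e.symm x a := by
  obtain ⟨A, hA⟩ := isInvertible_mfderiv he (e.map_target hx)
  have h := mfderiv_mfderiv_symm he hx a
  change (mfderiv (𝓡 4) (𝓡 4) e (e.symm x)).inverse a = _
  rw [← hA, ContinuousLinearMap.inverse_equiv]
  rw [← hA] at h
  refine (A.symm_apply_eq).2 ?_
  exact h.symm

theorem coordField_constField (he : e.MDifferentiable (𝓡 4) (𝓡 4)) (a : E4) {x : E4}
    (hx : x ∈ e.target) : coordField e (constField e a) x = a := by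
  rw [coordField, constField_symm he a hx, mfderiv_mfderiv_symm he hx]

variable [IsManifold (𝓡 4) ∞ M]

theorem smoothFieldAt_constField (he : e ∈ IsManifold.maximalAtlas (𝓡 4) ∞ M) (a : E4) {m : M}
    (hm : m ∈ e.source) : SmoothFieldAt (constField e a) m := by
  have : IsManifold (𝓡 4) 1 M := IsManifold.of_le (n := ∞) (by simp)
  exact ContMDiffAt.mpullback_vectorField_preimage (n := ∞) (m := ∞)
    (V := fun _ => (a : E4)) (contMDiffAt_vectorSpace_iff_contDiffAt.2 contDiffAt_const)
    (contMDiffAt_of_mem_maximalAtlas he hm)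
    (isInvertible_mfderiv (mdifferentiable_of_mem_maximalAtlas he) hm) (by simp)

theorem contDiffWithinAt_coordField (he : e ∈ IsManifold.maximalAtlas (𝓡 4) ∞ M) {V : VField M}
    {s : Set M} {m : M} (hm : m ∈ e.source)
    (hV : ContMDiffWithinAt (𝓡 4) (𝓡 4).tangent ∞ (fun y => (⟨y, V y⟩ : TangentBundle (𝓡 4) M))
      s m) :
    ContDiffWithinAt ℝ ∞ (coordField e V) (e.symm ⁻¹' s) (e m) := by
  have : IsManifold (𝓡 4) 1 M := IsManifold.of_le (n := ∞) (by simp)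
  have hem := mdifferentiable_of_mem_maximalAtlas he
  have hx : e m ∈ e.target := e.map_source hm
  have h1 := ContMDiffWithinAt.mpullback_vectorField_preimage_of_eq (n := ∞) (m := ∞) hV
    (contMDiffAt_symm_of_mem_maximalAtlas he hx) (isInvertible_mfderiv_symm hem hx) (by simp)
    (e.left_inv hm).symm
  have h2 := contMDiffWithinAt_vectorSpace_iff_contDiffWithinAt.1 h1
  refine h2.congr_of_eventuallyEq ?_ (mpullback_symm_eq_coordField hem V hx).symm
  filter_upwards [nhdsWithin_le_nhds (e.open_target.mem_nhds hx)] with y hy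
  exact (mpullback_symm_eq_coordField hem V hy).symm

/-- The set `T` in the chart needs only to contain the image of `s` near the point, so half balls
can be used for `M ∪ ℑ⁻`. -/
theorem contMDiffWithinAt_of_coordField (he : e ∈ IsManifold.maximalAtlas (𝓡 4) ∞ M) {V : VField M}
    {s : Set M} {m : M} (hm : m ∈ e.source) {T : Set E4}
    (hV : ContDiffWithinAt ℝ ∞ (coordField e V) T (e m)) (hT : e ⁻¹' T ∈ 𝓝[s] m) :
    ContMDiffWithinAt (𝓡 4) (𝓡 4).tangent ∞ (fun y => (⟨y, V y⟩ : TangentBundle (𝓡 4) M)) s m := by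
  have : IsManifold (𝓡 4) 1 M := IsManifold.of_le (n := ∞) (by simp)
  have hem := mdifferentiable_of_mem_maximalAtlas he
  have h1 := ContMDiffWithinAt.mpullback_vectorField_of_mem_nhdsWithin (n := ∞) (m := ∞) (s := s)
    (V := fun x => (coordField e V x : TangentSpace (𝓡 4) x))
    (contMDiffWithinAt_vectorSpace_iff_contDiffWithinAt.2 hV)
    (contMDiffAt_of_mem_maximalAtlas he hm) (isInvertible_mfderiv hem hm) (by simp) hT
  have h3 : ∀ y ∈ e.source, V y = VectorField.mpullback (𝓡 4) (𝓡 4) e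
      (fun x => (coordField e V x : TangentSpace (𝓡 4) x)) y := by
    intro y hy
    obtain ⟨A, hA⟩ := isInvertible_mfderiv hem hy
    change _ = (mfderiv (𝓡 4) (𝓡 4) e y).inverse (coordField e V (e y))
    rw [coordField, e.left_inv hy, ← hA, ContinuousLinearMap.inverse_equiv]
    exact (A.symm_apply_apply _).symm
  refine h1.congr_of_eventuallyEq ?_ (by rw [← h3 m hm])
  filter_upwards [nhdsWithin_le_nhds (e.open_source.mem_nhds hm)] with y hy
  rw [← h3 y hy]

end Charts

/-! ### Lorentzian linear algebra. -/

section BilinearForms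

/-- Vectors orthogonal to a timelike vector are spacelike. -/
theorem pos_of_orthogonal_timelike {E : Type*} [AddCommGroup E] [Module ℝ E] (B : E →ₗ[ℝ] E →ₗ[ℝ] ℝ)
    (b : Module.Basis (Fin 4) ℝ E)
    (hb : ∀ i j, B (b i) (b j) = if i = j then (if i = 0 then -1 else 1) else 0) {v k : E}
    (hv : B v v < 0) (hvk : B v k = 0) (hk : k ≠ 0) : 0 < B k k := by
  have hB : ∀ v w, B v w = -(b.repr v 0 * b.repr w 0) + b.repr v 1 * b.repr w 1
      + b.repr v 2 * b.repr w 2 + b.repr v 3 * b.repr w 3 := by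
    intro v w
    conv_lhs => rw [← b.sum_repr v, ← b.sum_repr w]
    simp only [Fin.sum_univ_four, map_add, map_smul, LinearMap.add_apply, LinearMap.smul_apply, hb,
      smul_eq_mul]
    simp
    ring
  rw [hB] at hv hvk ⊢
  by_contra! hn
  have hk0 : b.repr k 0 ≠ 0 := by
    intro h0
    rw [h0] at hn
    apply hk
    have h1 : b.repr k 1 = 0 := by nlinarith [mul_self_nonneg (b.repr k 1), mul_self_nonneg (b.repr k 2), mul_self_nonneg (b.repr k 3)]
    have h2 : b.repr k 2 = 0 := by nlinarith [mul_self_nonneg (b.repr k 1), mul_self_nonneg (b.repr k 2), mul_self_nonneg (b.repr k 3)]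
    have h3 : b.repr k 3 = 0 := by nlinarith [mul_self_nonneg (b.repr k 1), mul_self_nonneg (b.repr k 2), mul_self_nonneg (b.repr k 3)]
    refine b.ext_elem fun i => ?_
    fin_cases i <;> simp [h0, h1, h2, h3]
  generalize b.repr k 0 = k0 at *
  generalize b.repr k 1 = k1 at *
  generalize b.repr k 2 = k2 at *
  generalize b.repr k 3 = k3 at *
  generalize b.repr v 0 = v0 at *
  generalize b.repr v 1 = v1 at *
  generalize b.repr v 2 = v2 at *
  generalize b.repr v 3 = v3 at *
  -- Cauchy–Schwarz for the spatial parts. If `k` were causal, orthogonality would give `v0² k0² ≤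
  -- |v|² |k|² ≤ |v|² k0²`, against `|v|² < v0²`.
  have hcs : (v1 * k1 + v2 * k2 + v3 * k3) ^ 2
      ≤ (v1 * v1 + v2 * v2 + v3 * v3) * (k1 * k1 + k2 * k2 + k3 * k3) := by
    nlinarith [sq_nonneg (v1 * k2 - v2 * k1), sq_nonneg (v1 * k3 - v3 * k1),
      sq_nonneg (v2 * k3 - v3 * k2)]
  have h1 : v1 * k1 + v2 * k2 + v3 * k3 = v0 * k0 := by linarith
  rw [h1] at hcs
  have hkk : 0 < k0 * k0 := mul_self_pos.2 hk0
  have hV : 0 ≤ v1 * v1 + v2 * v2 + v3 * v3 :=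
    add_nonneg (add_nonneg (mul_self_nonneg _) (mul_self_nonneg _)) (mul_self_nonneg _)
  have := mul_le_mul_of_nonneg_left (show k1 * k1 + k2 * k2 + k3 * k3 ≤ k0 * k0 by linarith) hV
  have := mul_lt_mul_of_pos_right (show v1 * v1 + v2 * v2 + v3 * v3 < v0 * v0 by linarith) hkk
  nlinarith

end BilinearForms

/-! ### The metric and its Lie derivative in charts. -/

section ChartMetric

variable {M : Type*} [TopologicalSpace M] [T2Space M] [SecondCountableTopology M]
  [ConnectedSpace M] [ChartedSpace E4 M] [IsManifold (𝓡 4) ∞ M] (S : Spacetime M)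

theorem Spacetime.nondegenerate {x : M} {v : TangentSpace (𝓡 4) x}
    (h : ∀ w, S.metric x v w = 0) : v = 0 := by
  obtain ⟨b, hb⟩ := S.metric_signature x
  refine b.ext_elem fun i => ?_
  have h1 := h (b i)
  rw [← b.sum_repr v] at h1
  simp only [map_sum, map_smul, _root_.sum_apply, _root_.smul_apply, hb, smul_eq_mul] at h1
  fin_cases i <;> simpa using h1

theorem Spacetime.pos_of_orthogonal {x : M} {v k : TangentSpace (𝓡 4) x}
    (hv : S.metric x v v < 0) (hvk : S.metric x v k = 0) (hk : k ≠ 0) : 0 < S.metric x k k := by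
  obtain ⟨b, hb⟩ := S.metric_signature x
  exact pos_of_orthogonal_timelike ((ContinuousLinearMap.coeLM ℝ) ∘ₗ (S.metric x).toLinearMap) b hb
    hv hvk hk

theorem Spacetime.contMDiffWithinAt_metric {V W : VField M} {s : Set M} {x : M}
    (hV : ContMDiffWithinAt (𝓡 4) (𝓡 4).tangent ∞ (fun y => (⟨y, V y⟩ : TangentBundle (𝓡 4) M)) s x)
    (hW : ContMDiffWithinAt (𝓡 4) (𝓡 4).tangent ∞ (fun y => (⟨y, W y⟩ : TangentBundle (𝓡 4) M))
      s x) :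
    ContMDiffWithinAt (𝓡 4) 𝓘(ℝ, ℝ) ∞ (fun y => S.metric y (V y) (W y)) s x := by
  have : ContMDiffWithinAt (𝓡 4) ((𝓡 4).prod 𝓘(ℝ)) ∞
      (fun m ↦ Bundle.TotalSpace.mk' ℝ (E := Bundle.Trivial M ℝ) m (S.metric m (V m) (W m)))
      s x := by
    apply ContMDiffWithinAt.clm_bundle_apply₂ (F₁ := E4) (F₂ := E4)
    · exact S.metric_smooth.contMDiffAt.contMDiffWithinAt
    · exact hV
    · exact hW
  simp only [Bundle.contMDiffWithinAt_totalSpace] at this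
  exact this.2

/-- The metric in the chart `e`. -/
def Spacetime.chartMetricL (e : OpenPartialHomeomorph M E4) (x : E4) : E4 →L[ℝ] E4 →L[ℝ] ℝ :=
  let B : E4 →L[ℝ] E4 →L[ℝ] ℝ := S.metric (e.symm x)
  let A : E4 →L[ℝ] E4 := mfderiv (𝓡 4) (𝓡 4) e.symm x
  B.bilinearComp A A

theorem Spacetime.chartMetricL_apply (e : OpenPartialHomeomorph M E4) (x v w : E4) :
    S.chartMetricL e x v w = S.metric (e.symm x) (mfderiv (𝓡 4) (𝓡 4) e.symm x v)
      (mfderiv (𝓡 4) (𝓡 4) e.symm x w) := rfl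

theorem Spacetime.chartMetricL_symm (e : OpenPartialHomeomorph M E4) (x v w : E4) :
    S.chartMetricL e x v w = S.chartMetricL e x w v := by
  simp only [chartMetricL_apply]
  exact S.metric_symm _ _ _

variable {e : OpenPartialHomeomorph M E4}

theorem Spacetime.chartMetricL_coordField (he : e.MDifferentiable (𝓡 4) (𝓡 4)) (V W : VField M)
    {x : E4} (hx : x ∈ e.target) :
    S.chartMetricL e x (coordField e V x) (coordField e W x)
      = S.metric (e.symm x) (V (e.symm x)) (W (e.symm x)) := by
  rw [chartMetricL_apply, mfderiv_symm_coordField he V hx, mfderiv_symm_coordField he W hx]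

theorem Spacetime.chartMetricL_nondegenerate (he : e.MDifferentiable (𝓡 4) (𝓡 4)) {x : E4}
    (hx : x ∈ e.target) (v : E4) (h : ∀ w, S.chartMetricL e x v w = 0) : v = 0 := by
  have h1 : mfderiv (𝓡 4) (𝓡 4) e.symm x v = 0 := by
    refine S.nondegenerate fun w => ?_
    rw [← mfderiv_symm_mfderiv he hx w]
    exact h (mfderiv (𝓡 4) (𝓡 4) e (e.symm x) w)
  exact (mfderiv_mfderiv_symm he hx v).symm.trans
    ((congrArg (mfderiv (𝓡 4) (𝓡 4) e (e.symm x)) h1).trans (map_zero _))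

theorem Spacetime.chartMetricL_pos_of_orthogonal (he : e.MDifferentiable (𝓡 4) (𝓡 4)) {x : E4}
    (hx : x ∈ e.target) {v k : E4} (hv : S.chartMetricL e x v v < 0)
    (hvk : S.chartMetricL e x v k = 0) (hk : k ≠ 0) : 0 < S.chartMetricL e x k k := by
  refine S.pos_of_orthogonal hv hvk fun h => hk ?_
  exact (mfderiv_mfderiv_symm he hx k).symm.trans
    ((congrArg (mfderiv (𝓡 4) (𝓡 4) e (e.symm x)) h).trans (map_zero _))

/-- In finite dimension smoothness can be tested on constant vectors, for which the components are
metric products of coordinate fields. -/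
theorem Spacetime.contDiffOn_chartMetricL (he : e ∈ IsManifold.maximalAtlas (𝓡 4) ∞ M) :
    ContDiffOn ℝ ∞ (S.chartMetricL e) e.target := by
  have hem := mdifferentiable_of_mem_maximalAtlas he
  rw [contDiffOn_clm_apply]
  intro a
  rw [contDiffOn_clm_apply]
  intro b x hx
  have h1 : ContMDiffAt (𝓡 4) 𝓘(ℝ, ℝ) ∞
      (fun m => S.metric m (constField e a m) (constField e b m)) (e.symm x) :=
    S.contMDiffWithinAt_metric (smoothFieldAt_constField he a (e.map_target hx))
      (smoothFieldAt_constField he b (e.map_target hx))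
  have h2 := h1.comp x (contMDiffAt_symm_of_mem_maximalAtlas he hx)
  have h3 : ContDiffAt ℝ ∞ (fun y => S.metric (e.symm y) (constField e a (e.symm y))
    (constField e b (e.symm y))) x := contMDiffAt_iff_contDiffAt.1 h2
  refine (h3.congr_of_eventuallyEq ?_).contDiffWithinAt
  filter_upwards [e.open_target.mem_nhds hx] with y hy
  rw [chartMetricL_apply, constField_symm hem a hy, constField_symm hem b hy]

theorem mlieBracket_eq_lieBracket {F : Type*} [NormedAddCommGroup F] [NormedSpace ℝ F]
    (V W : ∀ x : F, TangentSpace 𝓘(ℝ, F) x) (x : F) :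
    VectorField.mlieBracket 𝓘(ℝ, F) V W x = VectorField.lieBracket ℝ (V : F → F) W x := by
  rw [← VectorField.mlieBracketWithin_univ]
  refine (congrFun VectorField.mlieBracketWithin_eq_lieBracketWithin x).trans ?_
  exact congrFun VectorField.lieBracketWithin_univ x

/-- The Lie derivative of the metric in coordinates. -/
theorem Spacetime.lieForm_coordField (he : e ∈ IsManifold.maximalAtlas (𝓡 4) ∞ M) {X : VField M}
    {x : E4} (hx : x ∈ e.target) (hX : SmoothFieldAt X (e.symm x)) {φ : ℝ}
    (h : S.LieDerivMetricEqAt X φ (e.symm x)) (a b : E4) :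
    lieForm (S.chartMetricL e) x (coordField e X x) (fderiv ℝ (coordField e X) x) a b
      = φ * S.chartMetricL e x a b := by
  have hem := mdifferentiable_of_mem_maximalAtlas he
  have hI : IsManifold (𝓡 4) (minSmoothness ℝ 2) M := IsManifold.of_le (n := ∞) (by simpa using two_le_infty)
  have hs := fun a => smoothFieldAt_constField he a (e.map_target hx)
  have h1 := h _ _ (hs a) (hs b)
  -- The bracket of `X` with a coordinate field is minus the corresponding partial derivative of
  -- `X`; naturality of the bracket reduces this to the vector space.
  have hbr : ∀ a, VectorField.mlieBracket (𝓡 4) X (constField e a) (e.symm x)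
      = mfderiv (𝓡 4) (𝓡 4) e.symm x (-(fderiv ℝ (coordField e X) x a)) := by
    intro a
    have h2 := VectorField.mpullback_mlieBracket (n := minSmoothness ℝ 2) (I := 𝓡 4) (I' := 𝓡 4) (f := e.symm) (x₀ := x)
      (ContMDiffAt.mdifferentiableAt hX (by simp)) (ContMDiffAt.mdifferentiableAt (hs a) (by simp))
      ((contMDiffAt_symm_of_mem_maximalAtlas he hx).of_le (by simpa using two_le_infty)) le_rfl
    rw [mpullback_symm_eq_coordField hem _ hx] at h2
    have h3 : VectorField.mlieBracket (𝓡 4) (VectorField.mpullback (𝓡 4) (𝓡 4) e.symm X)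
        (VectorField.mpullback (𝓡 4) (𝓡 4) e.symm (constField e a)) x
        = VectorField.mlieBracket (𝓡 4) (coordField e X) (fun _ => (a : E4)) x := by
      refine Filter.EventuallyEq.mlieBracket_vectorField_eq ?_ ?_
      · filter_upwards [e.open_target.mem_nhds hx] with y hy
        exact mpullback_symm_eq_coordField hem _ hy
      · filter_upwards [e.open_target.mem_nhds hx] with y hy
        rw [mpullback_symm_eq_coordField hem _ hy, coordField_constField hem a hy]
    have h4 : VectorField.mlieBracket (𝓡 4) (coordField e X) (fun _ => (a : E4)) x
        = VectorField.lieBracket ℝ (coordField e X) (fun _ => (a : E4)) x :=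
      mlieBracket_eq_lieBracket _ _ _
    refine (mfderiv_symm_coordField hem _ hx).symm.trans
      (congrArg (mfderiv (𝓡 4) (𝓡 4) e.symm x) (h2.trans (h3.trans (h4.trans ?_))))
    simp [VectorField.lieBracket]
    rfl
  have hmet : mvfderiv (𝓡 4) (fun y => S.metric y (constField e a y) (constField e b y)) (e.symm x)
      (X (e.symm x)) = fderiv ℝ (S.chartMetricL e) x (coordField e X x) a b := by
    rw [← mfderiv_symm_coordField hem X hx]
    have h4 : MDifferentiableAt (𝓡 4) 𝓘(ℝ, ℝ)
        (fun m => S.metric m (constField e a m) (constField e b m)) (e.symm x) :=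
      (S.contMDiffWithinAt_metric (hs a) (hs b)).mdifferentiableWithinAt (by simp)
    refine (mvfderiv_comp_apply x h4
      ((contMDiffAt_symm_of_mem_maximalAtlas he hx).mdifferentiableAt (by simp))
      (coordField e X x)).symm.trans ?_
    have h5 : (fun m => S.metric m (constField e a m) (constField e b m)) ∘ e.symm
        =ᶠ[𝓝 x] fun y => S.chartMetricL e y a b := by
      filter_upwards [e.open_target.mem_nhds hx] with y hy
      simp only [Function.comp_apply]
      rw [S.chartMetricL_apply, constField_symm hem a hy, constField_symm hem b hy]
    have h6 : HasFDerivAt (S.chartMetricL e) (fderiv ℝ (S.chartMetricL e) x) x :=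
      (((S.contDiffOn_chartMetricL he).contDiffAt (e.open_target.mem_nhds hx)).differentiableAt
        (by simp)).hasFDerivAt
    have h7 := (h6.clm_apply (hasFDerivAt_const a x)).clm_apply (hasFDerivAt_const b x)
    have h8 := (h7.congr_of_eventuallyEq h5).fderiv
    have h9 : mvfderiv (𝓡 4) ((fun m => S.metric m (constField e a m) (constField e b m)) ∘ e.symm) x
        = fderiv ℝ ((fun m => S.metric m (constField e a m) (constField e b m)) ∘ e.symm) x :=
      mfderiv_eq_fderiv
    refine (congrArg (fun T : E4 →L[ℝ] ℝ => T (coordField e X x)) (h9.trans h8)).trans ?_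
    simp
  have hc := fun a => constField_symm hem a hx
  rw [Spacetime.lieDerivMetric, hmet, hbr, hbr, hc, hc] at h1
  have e1 := S.chartMetricL_apply e x (-(fderiv ℝ (coordField e X) x a)) b
  have e2 := S.chartMetricL_apply e x a (-(fderiv ℝ (coordField e X) x b))
  simp only [map_neg, neg_apply] at e1 e2
  refine Eq.trans ?_ h1
  refine Eq.trans ?_ (congrArg₂ (fun p q : ℝ => fderiv ℝ (S.chartMetricL e) x (coordField e X x) a b
    - p - q) e1 e2)
  rw [lieForm]
  ring

end ChartMetric

/-! ### Transition maps. -/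

section Transition

variable {M : Type*} [TopologicalSpace M] [ChartedSpace E4 M] {e e' : OpenPartialHomeomorph M E4}

theorem fderiv_transition (he : e.MDifferentiable (𝓡 4) (𝓡 4))
    (he' : e'.MDifferentiable (𝓡 4) (𝓡 4)) {x : E4} (hx : x ∈ e.target)
    (hx' : e.symm x ∈ e'.source) (a : E4) :
    fderiv ℝ (e' ∘ e.symm) x a
      = mfderiv (𝓡 4) (𝓡 4) e' (e.symm x) (mfderiv (𝓡 4) (𝓡 4) e.symm x a) :=
  (congrArg (fun T : E4 →L[ℝ] E4 => T a) mfderiv_eq_fderiv).symm.trans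
    (mfderiv_comp_apply x (he'.mdifferentiableAt hx') (he.mdifferentiableAt_symm hx) a)

theorem contDiffAt_transition [IsManifold (𝓡 4) ∞ M]
    (he : e ∈ IsManifold.maximalAtlas (𝓡 4) ∞ M)
    (he' : e' ∈ IsManifold.maximalAtlas (𝓡 4) ∞ M) {x : E4} (hx : x ∈ e.target)
    (hx' : e.symm x ∈ e'.source) : ContDiffAt ℝ ∞ (e' ∘ e.symm) x :=
  contMDiffAt_iff_contDiffAt.1
    ((contMDiffAt_of_mem_maximalAtlas he' hx').comp x (contMDiffAt_symm_of_mem_maximalAtlas he hx))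

end Transition

/-! ### Independence of the chart for the metric and the geodesic equation. -/

section ChartChange

variable {M : Type*} [TopologicalSpace M] [T2Space M] [SecondCountableTopology M]
  [ConnectedSpace M] [ChartedSpace E4 M] [IsManifold (𝓡 4) ∞ M] (S : Spacetime M)
  {e e' : OpenPartialHomeomorph M E4}

theorem Spacetime.chartMetricL_mfderiv (he : e.MDifferentiable (𝓡 4) (𝓡 4)) {m : M}
    (hm : m ∈ e.source) (v w : TangentSpace (𝓡 4) m) :
    S.chartMetricL e (e m) (mfderiv (𝓡 4) (𝓡 4) e m v) (mfderiv (𝓡 4) (𝓡 4) e m w)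
      = S.metric m v w := by
  obtain ⟨x, hx, rfl⟩ : ∃ x ∈ e.target, e.symm x = m := ⟨e m, e.map_source hm, e.left_inv hm⟩
  have h : ∀ y a b, y = x → S.chartMetricL e y a b = S.chartMetricL e x a b := by
    rintro y a b rfl; rfl
  refine (h _ _ _ (e.right_inv hx)).trans ((S.chartMetricL_apply e x _ _).trans ?_)
  exact congrArg₂ (fun v w => S.metric (e.symm x) v w) (mfderiv_symm_mfderiv he hx v)
    (mfderiv_symm_mfderiv he hx w)

theorem Spacetime.chartMetricL_transition (he : e.MDifferentiable (𝓡 4) (𝓡 4))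
    (he' : e'.MDifferentiable (𝓡 4) (𝓡 4)) {x : E4} (hx : x ∈ e.target)
    (hx' : e.symm x ∈ e'.source) (a b : E4) :
    S.chartMetricL e x a b = S.chartMetricL e' ((e' ∘ e.symm) x) (fderiv ℝ (e' ∘ e.symm) x a)
      (fderiv ℝ (e' ∘ e.symm) x b) := by
  rw [fderiv_transition he he' hx hx', fderiv_transition he he' hx hx']
  exact (S.chartMetricL_mfderiv he' hx' _ _).symm

theorem Spacetime.christoffel_eq (p : M) {y : E4} (hy : y ∈ (chartAt E4 p).target) (a b w : E4) :
    S.christoffel p y a b w = (1 / 2) * (fderiv ℝ (S.chartMetricL (chartAt E4 p)) y a b w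
      + fderiv ℝ (S.chartMetricL (chartAt E4 p)) y b a w
      - fderiv ℝ (S.chartMetricL (chartAt E4 p)) y w a b) := by
  have h6 := (((S.contDiffOn_chartMetricL (IsManifold.chart_mem_maximalAtlas (I := 𝓡 4) (n := ∞) p)).contDiffAt
    ((chartAt E4 p).open_target.mem_nhds hy)).differentiableAt (by simp)).hasFDerivAt
  have h : ∀ a b c, fderiv ℝ (fun z => S.chartMetric p z b c) y a
      = fderiv ℝ (S.chartMetricL (chartAt E4 p)) y a b c := by
    intro a b c
    have h7 := (h6.clm_apply (hasFDerivAt_const b y)).clm_apply (hasFDerivAt_const c y)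
    have h8 : fderiv ℝ (fun z => S.chartMetric p z b c) y = _ := h7.fderiv
    rw [h8]
    simp
  rw [Spacetime.christoffel, h, h, h]

/-- The geodesic equation in an arbitrary chart. -/
theorem Spacetime.IsCompleteGeodesic.geodesicForm_eq_zero {S : Spacetime M} {c : ℝ → M}
    (hc : S.IsCompleteGeodesic c) (he : e ∈ IsManifold.maximalAtlas (𝓡 4) ∞ M) {t : ℝ}
    (ht : c t ∈ e.source) (w : E4) :
    geodesicForm (S.chartMetricL e) (e (c t)) (deriv (e ∘ c) t) (deriv (deriv (e ∘ c)) t) w = 0 := by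
  set e₀ := chartAt E4 (c t) with he₀_def
  have he₀ : e₀ ∈ IsManifold.maximalAtlas (𝓡 4) ∞ M := IsManifold.chart_mem_maximalAtlas _
  have hem := mdifferentiable_of_mem_maximalAtlas he
  have he₀m := mdifferentiable_of_mem_maximalAtlas he₀
  have ht₀ : c t ∈ e₀.source := mem_chart_source E4 (c t)
  have hx := e.map_source ht
  have hx' : e.symm (e (c t)) ∈ e₀.source := by rwa [e.left_inv ht]
  have hψ := contDiffAt_transition he he₀ hx hx'
  have hψx : (e₀ ∘ e.symm) (e (c t)) = e₀ (c t) := by simp [e.left_inv ht]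
  have hxs : ContDiffAt ℝ ∞ (e ∘ c) t := contMDiffAt_iff_contDiffAt.1
    ((contMDiffAt_of_mem_maximalAtlas he ht).comp t hc.1.contMDiffAt)
  have hG := fun y (hy : y ∈ e.target) =>
    ((S.contDiffOn_chartMetricL he).contDiffAt (e.open_target.mem_nhds hy)).differentiableAt
      (by simp)
  have hG₀ := fun y (hy : y ∈ e₀.target) =>
    ((S.contDiffOn_chartMetricL he₀).contDiffAt (e₀.open_target.mem_nhds hy)).differentiableAt
      (by simp)
  have hev : ∀ᶠ y in 𝓝 (e (c t)), y ∈ e.target ∧ e.symm y ∈ e₀.source :=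
    (e.open_target.mem_nhds hx |> Filter.Eventually.and) <|
      (e.continuousAt_symm hx).eventually (e₀.open_source.mem_nhds hx')
  -- The geodesic equation is given in the preferred chart at `c t`; it is carried to `e` by the
  -- transition map `e₀ ∘ e.symm`.
  have hpull := geodesicForm_pullback (G₁ := S.chartMetricL e) (G₂ := S.chartMetricL e₀) hψ
    (by rw [hψx]; exact hG₀ _ (e₀.map_source ht₀))
    (Eventually.of_forall fun y a b => S.chartMetricL_symm e₀ y a b)
    (hev.mono fun y hy a b => S.chartMetricL_transition hem he₀m hy.1 hy.2 a b)
    (hG _ hx) (deriv (e ∘ c) t) (deriv (deriv (e ∘ c)) t) w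
  rw [← hpull]
  have hev' : ∀ᶠ s in 𝓝 t, (e₀ ∘ c) s = (e₀ ∘ e.symm) ((e ∘ c) s) := by
    filter_upwards [hc.1.continuous.continuousAt.eventually (e.open_source.mem_nhds ht)] with s hs
    simp [e.left_inv hs]
  have hd1 : ∀ᶠ s in 𝓝 t, deriv (e₀ ∘ c) s
      = fderiv ℝ (e₀ ∘ e.symm) ((e ∘ c) s) (deriv (e ∘ c) s) := by
    have h1 : ∀ᶠ s in 𝓝 t, ContDiffAt ℝ ∞ (e₀ ∘ e.symm) ((e ∘ c) s) :=
      hxs.continuousAt.eventually (hev.mono fun y hy => contDiffAt_transition he he₀ hy.1 hy.2)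
    have h2 : ∀ᶠ s in 𝓝 t, DifferentiableAt ℝ (e ∘ c) s := by
      filter_upwards [hc.1.continuous.continuousAt.eventually (e.open_source.mem_nhds ht)] with s hs
      exact (contMDiffAt_iff_contDiffAt.1 ((contMDiffAt_of_mem_maximalAtlas he hs).comp s
        hc.1.contMDiffAt)).differentiableAt (n := ∞) (by simp)
    filter_upwards [h1, h2, hev'.eventually_nhds] with s h1 h2 h3
    rw [Filter.EventuallyEq.deriv_eq h3]
    exact ((h1.differentiableAt (by simp)).hasFDerivAt.comp_hasDerivAt s h2.hasDerivAt).deriv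
  -- The second-order chain rule produces exactly the acceleration occurring in
  -- `geodesicForm_pullback`.
  have hd2 : deriv (deriv (e₀ ∘ c)) t
      = fderiv ℝ (fderiv ℝ (e₀ ∘ e.symm)) (e (c t)) (deriv (e ∘ c) t) (deriv (e ∘ c) t)
        + fderiv ℝ (e₀ ∘ e.symm) (e (c t)) (deriv (deriv (e ∘ c)) t) := by
    rw [Filter.EventuallyEq.deriv_eq hd1]
    have h1 : HasDerivAt (fun s => fderiv ℝ (e₀ ∘ e.symm) ((e ∘ c) s))
        (fderiv ℝ (fderiv ℝ (e₀ ∘ e.symm)) (e (c t)) (deriv (e ∘ c) t)) t :=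
      HasFDerivAt.comp_hasDerivAt (f := e ∘ c) t
        (((hψ.fderiv_right (m := ∞) (by simp)).differentiableAt (by simp)).hasFDerivAt)
        (hxs.differentiableAt (by simp)).hasDerivAt
    have h2 : HasDerivAt (deriv (e ∘ c)) (deriv (deriv (e ∘ c)) t) t := by
      refine DifferentiableAt.hasDerivAt ?_
      have := (hxs.fderiv_right (m := ∞) (by simp)).differentiableAt (by simp)
      exact (this.clm_apply (differentiableAt_const (1 : ℝ)))
    exact (h1.clm_apply h2).deriv
  have hgeo := hc.2 t (fderiv ℝ (e₀ ∘ e.symm) (e (c t)) w)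
  have hfun : (fun r => extChartAt (𝓡 4) (c t) (c r)) = e₀ ∘ c := rfl
  simp only at hgeo
  have hpt : extChartAt (𝓡 4) (c t) (c t) = e₀ (c t) := rfl
  rw [hfun, hpt] at hgeo
  rw [S.christoffel_eq (c t) (e₀.map_source ht₀)] at hgeo
  rw [geodesicForm, chris, hψx, ← hd2]
  have hd1' := hd1.self_of_nhds
  simp only [Function.comp_apply] at hd1'
  rw [← hd1']
  exact hgeo

end ChartChange

/-! ### Charts of the bulk induced by charts of the larger spacetime. -/

section Embedding

variable {M : Type*} [TopologicalSpace M] {N : Type*} [TopologicalSpace N]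

/-- The chart of `M` induced by a chart of `N` through an open embedding of `M` in `N`. -/
def pullbackChart [Nonempty M] {f : M → N} (hf : Topology.IsOpenEmbedding f)
    (e : OpenPartialHomeomorph N E4) : OpenPartialHomeomorph M E4 :=
  (hf.toOpenPartialHomeomorph f).trans e

section

variable [Nonempty M] {f : M → N} (hf : Topology.IsOpenEmbedding f)
  (e : OpenPartialHomeomorph N E4)

theorem pullbackChart_apply (m : M) : pullbackChart hf e m = e (f m) := rfl

theorem mem_pullbackChart_source {m : M} : m ∈ (pullbackChart hf e).source ↔ f m ∈ e.source := by
  simp [pullbackChart]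

theorem apply_pullbackChart_symm {x : E4} (hx : x ∈ (pullbackChart hf e).target) :
    f ((pullbackChart hf e).symm x) = e.symm x := by
  have h1 := (pullbackChart hf e).map_target hx
  have h2 := (pullbackChart hf e).right_inv hx
  rw [pullbackChart_apply] at h2
  rw [mem_pullbackChart_source] at h1
  conv_rhs => rw [← h2]
  exact (e.left_inv h1).symm

theorem mem_pullbackChart_target {x : E4} :
    x ∈ (pullbackChart hf e).target ↔ x ∈ e.target ∧ e.symm x ∈ range f := by
  constructor
  · intro hx
    refine ⟨?_, ?_⟩
    · have h1 := (pullbackChart hf e).map_target hx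
      rw [mem_pullbackChart_source] at h1
      rw [← (pullbackChart hf e).right_inv hx]
      exact e.map_source h1
    · rw [← apply_pullbackChart_symm hf e hx]
      exact mem_range_self _
  · rintro ⟨hx, m, hm⟩
    have h1 : m ∈ (pullbackChart hf e).source := by
      rw [mem_pullbackChart_source, hm]; exact e.map_target hx
    have h2 := (pullbackChart hf e).map_source h1
    rwa [pullbackChart_apply, hm, e.right_inv hx] at h2

variable [ChartedSpace E4 M] [ChartedSpace E4 N]

theorem mfderiv_pullbackChart (hfs : ContMDiff (𝓡 4) (𝓡 4) ∞ f)
    {e : OpenPartialHomeomorph N E4} (hem : e.MDifferentiable (𝓡 4) (𝓡 4)) {m : M}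
    (hm : f m ∈ e.source) (v : TangentSpace (𝓡 4) m) :
    mfderiv (𝓡 4) (𝓡 4) (pullbackChart hf e) m v
      = mfderiv (𝓡 4) (𝓡 4) e (f m) (mfderiv (𝓡 4) (𝓡 4) f m v) :=
  mfderiv_comp_apply m (hem.mdifferentiableAt hm)
    (hfs.contMDiffAt.mdifferentiableAt (by simp)) v

theorem coordField_pullbackChart (hfs : ContMDiff (𝓡 4) (𝓡 4) ∞ f)
    {e : OpenPartialHomeomorph N E4} (hem : e.MDifferentiable (𝓡 4) (𝓡 4)) {Y : VField M}
    {W : VField N} (hW : ∀ m, W (f m) = mfderiv (𝓡 4) (𝓡 4) f m (Y m)) {x : E4}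
    (hx : x ∈ (pullbackChart hf e).target) :
    coordField (pullbackChart hf e) Y x = coordField e W x := by
  have h1 := (pullbackChart hf e).map_target hx
  rw [mem_pullbackChart_source] at h1
  refine (mfderiv_pullbackChart hf hfs hem h1 _).trans ?_
  rw [coordField, ← apply_pullbackChart_symm hf e hx, hW]

variable [IsManifold (𝓡 4) ∞ M] [IsManifold (𝓡 4) ∞ N]

/-- Smoothness of the inverse comes from the inverse function theorem: `f` has injective
differential between spaces of equal dimension. -/
theorem pullbackChart_mem_maximalAtlas (hfs : ContMDiff (𝓡 4) (𝓡 4) ∞ f)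
    (hinj : ∀ m, Function.Injective (mfderiv (𝓡 4) (𝓡 4) f m))
    {e : OpenPartialHomeomorph N E4} (he : e ∈ IsManifold.maximalAtlas (𝓡 4) ∞ N) :
    pullbackChart hf e ∈ IsManifold.maximalAtlas (𝓡 4) ∞ M := by
  have hem := mdifferentiable_of_mem_maximalAtlas he
  have hsm : ContMDiffOn (𝓡 4) (𝓡 4) ∞ (pullbackChart hf e) (pullbackChart hf e).source := by
    intro m hm
    rw [mem_pullbackChart_source] at hm
    exact ((contMDiffAt_of_mem_maximalAtlas he hm).comp m hfs.contMDiffAt).contMDiffWithinAt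
  refine OpenPartialHomeomorph.mem_maximalAtlas_of_contMDiffOn _ hsm fun x hx => ?_
  set e' := pullbackChart hf e
  set m := e'.symm x
  have hm : m ∈ e'.source := e'.map_target hx
  set c := chartAt E4 m
  have hc : c ∈ IsManifold.maximalAtlas (𝓡 4) ∞ M := IsManifold.chart_mem_maximalAtlas _
  have hcm := mdifferentiable_of_mem_maximalAtlas hc
  have hmc : m ∈ c.source := mem_chart_source E4 m
  let g : OpenPartialHomeomorph E4 E4 := c.symm.trans e'
  have hgx : g.symm x = c m := rfl
  have hxg : x ∈ g.target := by simp [g, hx, hmc, m]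
  have hcm' : c.symm (c m) = m := c.left_inv hmc
  have hgs : ContDiffAt ℝ ∞ g (c m) := by
    refine contMDiffAt_iff_contDiffAt.1 (ContMDiffAt.comp (g := e') (f := c.symm) (c m) ?_
      (contMDiffAt_symm_of_mem_maximalAtlas hc (c.map_source hmc)))
    rw [hcm']
    exact (hsm m hm).contMDiffAt (e'.open_source.mem_nhds hm)
  have hinj' : Function.Injective (fderiv ℝ g (c m)) := by
    have hd : MDifferentiableAt (𝓡 4) (𝓡 4) e' (c.symm (c m)) := by
      rw [hcm']
      exact ((hsm m hm).contMDiffAt (e'.open_source.mem_nhds hm)).mdifferentiableAt (by simp)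
    have h1 : ∀ a, fderiv ℝ g (c m) a = mfderiv (𝓡 4) (𝓡 4) e' (c.symm (c m))
        (mfderiv (𝓡 4) (𝓡 4) c.symm (c m) a) := fun a =>
      (congrArg (fun T : E4 →L[ℝ] E4 => T a) mfderiv_eq_fderiv).symm.trans
        (mfderiv_comp_apply (c m) hd (hcm.mdifferentiableAt_symm (c.map_source hmc)) a)
    have h2 : ∀ n ∈ e'.source, ∀ v, mfderiv (𝓡 4) (𝓡 4) e' n v = mfderiv (𝓡 4) (𝓡 4) e (f n)
        (mfderiv (𝓡 4) (𝓡 4) f n v) := fun n hn v =>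
      mfderiv_comp_apply n (hem.mdifferentiableAt ((mem_pullbackChart_source hf e).1 hn))
        (hfs.contMDiffAt.mdifferentiableAt (by simp)) v
    have hn : c.symm (c m) ∈ e'.source := by rwa [hcm']
    intro a b hab
    rw [h1, h1, h2 _ hn, h2 _ hn] at hab
    have h3 := hinj _ ((isInvertible_mfderiv hem ((mem_pullbackChart_source hf e).1 hn)).injective
      hab)
    exact (isInvertible_mfderiv_symm hcm (c.map_source hmc)).injective h3
  let A : E4 ≃L[ℝ] E4 := (LinearEquiv.ofInjectiveEndo (fderiv ℝ g (c m)).toLinearMap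
    hinj').toContinuousLinearEquiv
  have hA : HasFDerivAt g (A : E4 →L[ℝ] E4) (c m) := by
    have : (A : E4 →L[ℝ] E4) = fderiv ℝ g (c m) := by ext v; rfl
    rw [this]
    exact (hgs.differentiableAt (by simp)).hasFDerivAt
  have hsymm : ContDiffAt ℝ ∞ g.symm x := g.contDiffAt_symm hxg hA hgs
  have h4 : ContMDiffAt (𝓡 4) (𝓡 4) ∞ (c.symm ∘ g.symm) x :=
    (contMDiffAt_symm_of_mem_maximalAtlas hc (c.map_source hmc)).comp x
      (contMDiffAt_iff_contDiffAt.2 hsymm)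
  refine (h4.congr_of_eventuallyEq ?_).contMDiffWithinAt
  have h5 := (e'.continuousAt_symm hx).eventually (c.open_source.mem_nhds hmc)
  filter_upwards [h5] with y hy
  exact (c.left_inv hy).symm

end

variable [T2Space M] [SecondCountableTopology M] [ConnectedSpace M] [ChartedSpace E4 M]
  [IsManifold (𝓡 4) ∞ M] [T2Space N] [SecondCountableTopology N] [ConnectedSpace N]
  [ChartedSpace E4 N] [IsManifold (𝓡 4) ∞ N]

/-- In these charts `f` is the identity, so being isometric means equality of the components. -/
theorem chartMetricL_pullbackChart (S : Spacetime M) (T : Spacetime N) {f : M → N}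
    (hf : Topology.IsOpenEmbedding f) (hfs : ContMDiff (𝓡 4) (𝓡 4) ∞ f)
    (hiso : ∀ m v w, T.metric (f m) (mfderiv (𝓡 4) (𝓡 4) f m v) (mfderiv (𝓡 4) (𝓡 4) f m w)
      = S.metric m v w) {e : OpenPartialHomeomorph N E4}
    (he : e.MDifferentiable (𝓡 4) (𝓡 4))
    (he' : (pullbackChart hf e).MDifferentiable (𝓡 4) (𝓡 4)) {x : E4}
    (hx : x ∈ (pullbackChart hf e).target) :
    S.chartMetricL (pullbackChart hf e) x = T.chartMetricL e x := by
  have h1 := (pullbackChart hf e).map_target hx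
  have h1' := h1
  rw [mem_pullbackChart_source] at h1
  ext a b
  rw [S.chartMetricL_apply, ← hiso, ← T.chartMetricL_mfderiv he h1]
  have h2 : ∀ a : E4, mfderiv (𝓡 4) (𝓡 4) e (f ((pullbackChart hf e).symm x))
      (mfderiv (𝓡 4) (𝓡 4) f ((pullbackChart hf e).symm x)
        (mfderiv (𝓡 4) (𝓡 4) (pullbackChart hf e).symm x a)) = a := fun a =>
    (mfderiv_pullbackChart hf hfs he h1 _).symm.trans (mfderiv_mfderiv_symm he' hx a)
  rw [h2, h2]
  rw [apply_pullbackChart_symm hf e hx, e.right_inv ((mem_pullbackChart_target hf e).1 hx).1]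

end Embedding

/-! ### Half balls. -/

section HalfBall

/-- The half ball of radius `r` around `x`, without its flat face. -/
def halfBall (x : E4) (r : ℝ) : Set E4 := Metric.ball x r ∩ {y | 0 < y 0}

/-- The half ball of radius `r` around `x`, with its flat face. -/
def halfBall' (x : E4) (r : ℝ) : Set E4 := Metric.ball x r ∩ {y | 0 ≤ y 0}

theorem continuous_coord (i : Fin 4) : Continuous fun y : E4 => y i := by fun_prop

theorem isOpen_halfBall (x : E4) (r : ℝ) : IsOpen (halfBall x r) :=
  Metric.isOpen_ball.inter (isOpen_lt continuous_const (continuous_coord 0))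

theorem convex_halfBall (x : E4) (r : ℝ) : Convex ℝ (halfBall x r) :=
  (convex_ball x r).inter
    (convex_halfSpace_gt (f := fun y : E4 => y 0) ⟨fun _ _ => rfl, fun _ _ => rfl⟩ 0)

theorem closure_halfBall_subset (x : E4) (r : ℝ) : closure (halfBall x r) ⊆ Metric.closedBall x r :=
  (closure_mono inter_subset_left).trans Metric.closure_ball_subset_closedBall

/-- Points of the flat face are pushed inwards along the first coordinate vector. -/
theorem halfBall'_subset_closure (x : E4) (r : ℝ) : halfBall' x r ⊆ closure (halfBall x r) := by
  rintro y ⟨hy, hy0⟩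
  have hc : ContinuousAt (fun t : ℝ => y + t • EuclideanSpace.single (0 : Fin 4) (1 : ℝ)) 0 := by
    fun_prop
  have ht : Tendsto (fun t : ℝ => y + t • EuclideanSpace.single (0 : Fin 4) (1 : ℝ)) (𝓝[>] 0)
      (𝓝 y) := by
    have := hc.tendsto.mono_left (nhdsWithin_le_nhds (s := Ioi 0))
    simpa using this
  refine mem_closure_of_tendsto ht ?_
  filter_upwards [ht.eventually (Metric.isOpen_ball.mem_nhds hy), self_mem_nhdsWithin] with t h1 h2
  refine ⟨h1, ?_⟩
  have h2' : (0 : ℝ) < t := h2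
  have h0 : (0 : ℝ) ≤ y 0 := hy0
  simp
  linarith

end HalfBall

theorem KillingJet.mono {E : Type*} [NormedAddCommGroup E] [NormedSpace ℝ E]
    {G : E → E →L[ℝ] E →L[ℝ] ℝ} {T T' : Set E} {y : E → E} {Y₁ : E → E →L[ℝ] E}
    {Y₂ : E → E →L[ℝ] E →L[ℝ] E} (h : KillingJet G T y Y₁ Y₂) (hT : T' ⊆ T) :
    KillingJet G T' y Y₁ Y₂ :=
  ⟨h.contDiffOn.mono hT, fun x hx => (h.hasFDerivWithinAt x (hT hx)).mono hT,
    fun x hx => (h.hasFDerivWithinAt' x (hT hx)).mono hT, fun x hx => h.killing x (hT hx),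
    fun x hx => h.killing' x (hT hx), fun x hx => h.symm x (hT hx)⟩

theorem KillingJet.congr {E : Type*} [NormedAddCommGroup E] [NormedSpace ℝ E]
    {G : E → E →L[ℝ] E →L[ℝ] ℝ} {T : Set E} {y z : E → E} {Y₁ : E → E →L[ℝ] E}
    {Y₂ : E → E →L[ℝ] E →L[ℝ] E} (h : KillingJet G T y Y₁ Y₂) (hz : EqOn z y T) :
    KillingJet G T z Y₁ Y₂ :=
  ⟨h.contDiffOn.congr hz, fun x hx => (h.hasFDerivWithinAt x hx).congr hz (hz hx),
    h.hasFDerivWithinAt', fun x hx => by rw [hz hx]; exact h.killing x hx,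
    fun x hx => by rw [hz hx]; exact h.killing' x hx, h.symm⟩

/-! ### Fields with prescribed components, and their limits. -/

section LocalField

variable {N : Type*} [TopologicalSpace N] [ChartedSpace E4 N]

/-- The vector field with components `y` in the chart `e`. -/
def localField (e : OpenPartialHomeomorph N E4) (y : E4 → E4) : VField N :=
  fun n => (mfderiv (𝓡 4) (𝓡 4) e n).inverse (y (e n))

variable {e : OpenPartialHomeomorph N E4}

theorem mfderiv_localField (he : e.MDifferentiable (𝓡 4) (𝓡 4)) (y : E4 → E4) {n : N}
    (hn : n ∈ e.source) : mfderiv (𝓡 4) (𝓡 4) e n (localField e y n) = y (e n) := by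
  obtain ⟨A, hA⟩ := isInvertible_mfderiv he hn
  rw [localField, ← hA, ContinuousLinearMap.inverse_equiv]
  exact A.apply_symm_apply _

theorem coordField_localField (he : e.MDifferentiable (𝓡 4) (𝓡 4)) (y : E4 → E4) {x : E4}
    (hx : x ∈ e.target) : coordField e (localField e y) x = y x :=
  (mfderiv_localField he y (e.map_target hx)).trans (by rw [e.right_inv hx])

theorem coordField_apply (e : OpenPartialHomeomorph N E4) (V : VField N) {n : N}
    (hn : n ∈ e.source) : coordField e V (e n) = mfderiv (𝓡 4) (𝓡 4) e n (V n) := by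
  rw [coordField, e.left_inv hn]

theorem eq_of_coordField_eq (he : e.MDifferentiable (𝓡 4) (𝓡 4)) {V W : VField N} {n : N}
    (hn : n ∈ e.source) (h : coordField e V (e n) = coordField e W (e n)) : V n = W n := by
  rw [coordField_apply e V hn, coordField_apply e W hn] at h
  exact (isInvertible_mfderiv he hn).injective h

variable [IsManifold (𝓡 4) ∞ N]

theorem tendsto_coordField (he : e ∈ IsManifold.maximalAtlas (𝓡 4) ∞ N) {V : VField N}
    {s : Set N} {q : N} (hq : q ∈ e.source)
    (hV : ContMDiffWithinAt (𝓡 4) (𝓡 4).tangent ∞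
      (fun y => (⟨y, V y⟩ : TangentBundle (𝓡 4) N)) s q) :
    Tendsto (fun n => coordField e V (e n)) (𝓝[s] q) (𝓝 (coordField e V (e q))) := by
  refine (contDiffWithinAt_coordField he hq hV).continuousWithinAt.tendsto.comp ?_
  refine tendsto_nhdsWithin_iff.2 ⟨(e.continuousAt hq).tendsto.mono_left nhdsWithin_le_nhds, ?_⟩
  filter_upwards [self_mem_nhdsWithin, nhdsWithin_le_nhds (e.open_source.mem_nhds hq)] with n h1 h2
  rwa [mem_preimage, e.left_inv h2]

/-- The components of both fields are continuous within `s`, so agreement on `t` persists in the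
limit at `q`. -/
theorem eq_of_eventuallyEq_of_mem_closure {V W : VField N} {s t : Set N} (hts : t ⊆ s) {q : N}
    (hq : q ∈ closure t)
    (hV : ContMDiffWithinAt (𝓡 4) (𝓡 4).tangent ∞
      (fun y => (⟨y, V y⟩ : TangentBundle (𝓡 4) N)) s q)
    (hW : ContMDiffWithinAt (𝓡 4) (𝓡 4).tangent ∞
      (fun y => (⟨y, W y⟩ : TangentBundle (𝓡 4) N)) s q)
    (h : ∀ᶠ n in 𝓝[t] q, V n = W n) : V q = W q := by
  have he : chartAt E4 q ∈ IsManifold.maximalAtlas (𝓡 4) ∞ N :=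
    IsManifold.chart_mem_maximalAtlas _
  have hs := mem_chart_source E4 q
  have : (𝓝[t] q).NeBot := mem_closure_iff_nhdsWithin_neBot.1 hq
  refine eq_of_coordField_eq (mdifferentiable_of_mem_maximalAtlas he) hs ?_
  refine tendsto_nhds_unique_of_eventuallyEq
    ((tendsto_coordField he hs hV).mono_left (nhdsWithin_mono q hts))
    ((tendsto_coordField he hs hW).mono_left (nhdsWithin_mono q hts)) ?_
  filter_upwards [h, nhdsWithin_le_nhds ((chartAt E4 q).open_source.mem_nhds hs)] with n h1 h2
  rw [coordField_apply _ V h2, coordField_apply _ W h2, h1]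

end LocalField

/-! ### Smooth extension of Killing fields to the horizon. -/

namespace ExpandingUniverse

variable {M : Type*} [TopologicalSpace M] [T2Space M] [SecondCountableTopology M]
    [ConnectedSpace M] [ChartedSpace E4 M] [IsManifold (𝓡 4) ∞ M]
    {N : Type*} [TopologicalSpace N] [T2Space N] [SecondCountableTopology N]
    [ConnectedSpace N] [ChartedSpace E4 N] [IsManifold (𝓡 4) ∞ N] (U : ExpandingUniverse M N)

/-- Charts of the larger spacetime adapted to the horizon. -/
structure IsBoundaryChart (e : OpenPartialHomeomorph N E4) : Prop where
  mem_atlas : e ∈ IsManifold.maximalAtlas (𝓡 4) ∞ N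
  inter_range : e.source ∩ range U.embed = {q ∈ e.source | 0 < e q 0}
  inter_horizon : e.source ∩ U.horizon = {q ∈ e.source | e q 0 = 0}

theorem exists_isBoundaryChart {p : N} (hp : p ∈ U.horizon) :
    ∃ e, U.IsBoundaryChart e ∧ p ∈ e.source :=
  let ⟨e, he, hpe, h1, h2⟩ := U.boundary_chart p hp
  ⟨e, ⟨he, h1, h2⟩, hpe⟩

/-- An isometric linear map from a nondegenerate space has trivial kernel. -/
theorem injective_mfderiv_embed (m : M) :
    Function.Injective (mfderiv (𝓡 4) (𝓡 4) U.embed m) := by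
  intro v w h
  rw [← sub_eq_zero]
  refine U.bulk.nondegenerate fun z => ?_
  rw [← U.embed_isometric, map_sub, h, sub_self]
  simp

variable {U} {e : OpenPartialHomeomorph N E4}

namespace IsBoundaryChart

theorem mem_range_iff (he : U.IsBoundaryChart e) {n : N} (hn : n ∈ e.source) :
    n ∈ range U.embed ↔ 0 < e n 0 := by
  have := Set.ext_iff.1 he.inter_range n
  simpa [hn] using this

theorem mem_horizon_iff (he : U.IsBoundaryChart e) {n : N} (hn : n ∈ e.source) :
    n ∈ U.horizon ↔ e n 0 = 0 := by
  have := Set.ext_iff.1 he.inter_horizon n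
  simpa [hn] using this

theorem mem_union_iff (he : U.IsBoundaryChart e) {n : N} (hn : n ∈ e.source) :
    n ∈ range U.embed ∪ U.horizon ↔ 0 ≤ e n 0 := by
  rw [mem_union, he.mem_range_iff hn, he.mem_horizon_iff hn, le_iff_lt_or_eq, eq_comm (b := e n 0)]

theorem mem_pullbackChart_target (he : U.IsBoundaryChart e) {x : E4} :
    x ∈ (pullbackChart U.embed_open e).target ↔ x ∈ e.target ∧ 0 < x 0 := by
  rw [CosmologicalHorizon.mem_pullbackChart_target]
  refine and_congr_right fun hx => ?_
  rw [he.mem_range_iff (e.map_target hx), e.right_inv hx]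

theorem pullbackChart_mem (he : U.IsBoundaryChart e) :
    pullbackChart U.embed_open e ∈ IsManifold.maximalAtlas (𝓡 4) ∞ M :=
  pullbackChart_mem_maximalAtlas U.embed_open U.embed_smooth U.injective_mfderiv_embed he.mem_atlas

theorem chartMetricL_eq (he : U.IsBoundaryChart e) {x : E4} (hx : x ∈ e.target) (hx0 : 0 < x 0) :
    U.bulk.chartMetricL (pullbackChart U.embed_open e) x = U.ambient.chartMetricL e x :=
  chartMetricL_pullbackChart U.bulk U.ambient U.embed_open U.embed_smooth U.embed_isometric
    (mdifferentiable_of_mem_maximalAtlas he.mem_atlas)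
    (mdifferentiable_of_mem_maximalAtlas he.pullbackChart_mem)
    (he.mem_pullbackChart_target.2 ⟨hx, hx0⟩)

/-- The Lie derivative of the metric in a chart adapted to the horizon. -/
theorem lieForm_eq (he : U.IsBoundaryChart e) {X : VField M} (hX : SmoothField X) {x : E4}
    (hx : x ∈ e.target) (hx0 : 0 < x 0) {φ : ℝ}
    (h : U.bulk.LieDerivMetricEqAt X φ ((pullbackChart U.embed_open e).symm x)) (a b : E4) :
    lieForm (U.ambient.chartMetricL e) x (coordField (pullbackChart U.embed_open e) X x)
      (fderiv ℝ (coordField (pullbackChart U.embed_open e) X) x) a b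
      = φ * U.ambient.chartMetricL e x a b := by
  have hx' := he.mem_pullbackChart_target.2 ⟨hx, hx0⟩
  have h1 := U.bulk.lieForm_coordField he.pullbackChart_mem hx' (hX _) h a b
  have h2 : U.bulk.chartMetricL (pullbackChart U.embed_open e) =ᶠ[𝓝 x]
      U.ambient.chartMetricL e := by
    filter_upwards [(pullbackChart U.embed_open e).open_target.mem_nhds hx'] with y hy
    rw [he.mem_pullbackChart_target] at hy
    exact he.chartMetricL_eq hy.1 hy.2
  rwa [lieForm, h2.fderiv_eq, he.chartMetricL_eq hx hx0] at h1

/-- The half ball is convex with compact closure inside the chart, and there the coefficients come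
from the larger metric, which is regular across the face. -/
theorem exists_killingJet (he : U.IsBoundaryChart e) {Y : VField M} (hY : U.bulk.IsKillingField Y)
    {x : E4} {r : ℝ} (hr : Metric.closedBall x r ⊆ e.target) :
    ∃ y' Y₁ Y₂, EqOn y' (coordField (pullbackChart U.embed_open e) Y) (halfBall x r) ∧
      KillingJet (U.ambient.chartMetricL e) (closure (halfBall x r)) y' Y₁ Y₂ := by
  have hem := mdifferentiable_of_mem_maximalAtlas he.mem_atlas
  have hsub := (closure_halfBall_subset x r).trans hr
  have hV : ∀ z ∈ halfBall x r, z ∈ e.target := fun z hz => hsub (subset_closure hz)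
  refine CosmologicalHorizon.exists_killingJet e.open_target
    (U.ambient.contDiffOn_chartMetricL he.mem_atlas)
    (fun z hz => U.ambient.chartMetricL_nondegenerate hem hz)
    (fun z _ => U.ambient.chartMetricL_symm e z) (isOpen_halfBall x r) (convex_halfBall x r)
    ((isCompact_closedBall x r).of_isClosed_subset isClosed_closure (closure_halfBall_subset x r))
    hsub ?_ ?_
  · intro z hz
    have hz' := he.mem_pullbackChart_target.2 ⟨hV z hz, hz.2⟩
    have h1 := contDiffWithinAt_coordField he.pullbackChart_mem (V := Y) (s := univ)
      ((pullbackChart U.embed_open e).map_target hz') (contMDiffWithinAt_univ.2 (hY.1 _))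
    rw [(pullbackChart U.embed_open e).right_inv hz', preimage_univ] at h1
    exact h1.mono (subset_univ _)
  · intro z hz a b
    have := he.lieForm_eq hY.1 (hV z hz) hz.2 (hY.2 _) a b
    rwa [zero_mul] at this

theorem mem_closure_range (he : U.IsBoundaryChart e) {p : N} (hpe : p ∈ e.source)
    (hp : p ∈ U.horizon) : p ∈ closure (range U.embed) := by
  have hx := e.map_source hpe
  obtain ⟨r, hr, hrt⟩ := Metric.isOpen_iff.1 e.open_target _ hx
  have h1 : e p ∈ closure (halfBall (e p) r) := by
    apply halfBall'_subset_closure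
    exact ⟨Metric.mem_ball_self hr, ((he.mem_horizon_iff hpe).1 hp).ge⟩
  have h2 := mem_closure_iff_nhdsWithin_neBot.1 h1
  have h3 : Tendsto e.symm (𝓝[halfBall (e p) r] (e p)) (𝓝 p) := by
    have := (e.continuousAt_symm hx).tendsto
    rw [e.left_inv hpe] at this
    exact this.mono_left nhdsWithin_le_nhds
  refine mem_closure_of_tendsto h3 ?_
  filter_upwards [self_mem_nhdsWithin] with y hy
  have hyt := hrt hy.1
  rw [he.mem_range_iff (e.map_target hyt), e.right_inv hyt]
  exact hy.2

end IsBoundaryChart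

theorem mem_closure_range {p : N} (hp : p ∈ U.horizon) : p ∈ closure (range U.embed) :=
  let ⟨_, he, hpe⟩ := U.exists_isBoundaryChart hp
  he.mem_closure_range hpe hp

/-- Smooth extensions are unique on the horizon, locally. -/
theorem eq_on_horizon {V W : VField N} {p : N} (hp : p ∈ U.horizon)
    (hV : ContMDiffWithinAt (𝓡 4) (𝓡 4).tangent ∞
      (fun y => (⟨y, V y⟩ : TangentBundle (𝓡 4) N)) (range U.embed ∪ U.horizon) p)
    (hW : ContMDiffWithinAt (𝓡 4) (𝓡 4).tangent ∞
      (fun y => (⟨y, W y⟩ : TangentBundle (𝓡 4) N)) (range U.embed ∪ U.horizon) p)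
    {O : Set N} (hO : O ∈ 𝓝 p) (h : ∀ m, U.embed m ∈ O → V (U.embed m) = W (U.embed m)) :
    V p = W p := by
  refine eq_of_eventuallyEq_of_mem_closure subset_union_left (mem_closure_range hp) hV hW ?_
  filter_upwards [self_mem_nhdsWithin, nhdsWithin_le_nhds hO] with n hn hnO
  obtain ⟨m, rfl⟩ := hn
  exact h m hnO

theorem isSmoothExtension_unique {Y : VField M} {W W' : VField N} (hW : U.IsSmoothExtension Y W)
    (hW' : U.IsSmoothExtension Y W') {p : N} (hp : p ∈ U.horizon) : W p = W' p :=
  eq_on_horizon hp (hW.1 p (Or.inr hp)) (hW'.1 p (Or.inr hp)) univ_mem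
    fun m _ => (hW.2 m).trans (hW'.2 m).symm

theorem exists_local_extension {Y : VField M} (hY : U.bulk.IsKillingField Y) {p : N}
    (hp : p ∈ U.horizon) : ∃ (e : OpenPartialHomeomorph N E4) (r : ℝ) (y' : E4 → E4)
      (Y₁ : E4 → E4 →L[ℝ] E4) (Y₂ : E4 → E4 →L[ℝ] E4 →L[ℝ] E4), U.IsBoundaryChart e ∧
      p ∈ e.source ∧ 0 < r ∧ Metric.closedBall (e p) r ⊆ e.target ∧
      KillingJet (U.ambient.chartMetricL e) (halfBall' (e p) r) y' Y₁ Y₂ ∧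
      (∀ n ∈ e.source, e n ∈ halfBall' (e p) r → ContMDiffWithinAt (𝓡 4) (𝓡 4).tangent ∞
        (fun y => (⟨y, localField e y' y⟩ : TangentBundle (𝓡 4) N)) (range U.embed ∪ U.horizon) n) ∧
      ∀ m, U.embed m ∈ e.source → e (U.embed m) ∈ halfBall (e p) r →
        localField e y' (U.embed m) = mfderiv (𝓡 4) (𝓡 4) U.embed m (Y m) := by
  obtain ⟨e, he, hpe⟩ := U.exists_isBoundaryChart hp
  have hem := mdifferentiable_of_mem_maximalAtlas he.mem_atlas
  obtain ⟨r, hr, hrt⟩ := Metric.nhds_basis_closedBall.mem_iff.1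
    (e.open_target.mem_nhds (e.map_source hpe))
  obtain ⟨y', Y₁, Y₂, heq, hjet⟩ := he.exists_killingJet hY hrt
  have hjet' := hjet.mono (halfBall'_subset_closure (e p) r)
  refine ⟨e, r, y', Y₁, Y₂, he, hpe, hr, hrt, hjet', ?_, ?_⟩
  · intro n hn hnb
    refine contMDiffWithinAt_of_coordField he.mem_atlas hn (T := halfBall' (e p) r) ?_ ?_
    · refine (hjet'.contDiffOn _ hnb).congr ?_ (coordField_localField hem _ (e.map_source hn))
      intro x hx
      exact coordField_localField hem _ (hrt (Metric.ball_subset_closedBall hx.1))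
    · filter_upwards [self_mem_nhdsWithin, nhdsWithin_le_nhds (e.open_source.mem_nhds hn),
        nhdsWithin_le_nhds ((e.continuousAt hn).eventually (Metric.isOpen_ball.mem_nhds hnb.1))]
        with k h1 h2 h3
      exact ⟨h3, (he.mem_union_iff h2).1 h1⟩
  · intro m hm hmb
    have hm' := (mem_pullbackChart_source U.embed_open e).2 hm
    apply (isInvertible_mfderiv hem hm).injective
    rw [mfderiv_localField hem y' hm, heq hmb]
    refine Eq.trans ?_ (mfderiv_pullbackChart U.embed_open U.embed_smooth hem hm (Y m))
    exact coordField_apply (pullbackChart U.embed_open e) Y hm'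

/-- No partition of unity is needed: a smooth extension has only one possible value at each horizon
point, so values taken from unrelated local extensions fit together. -/
theorem exists_isSmoothExtension {Y : VField M} (hY : U.bulk.IsKillingField Y) :
    ∃ W : VField N, U.IsSmoothExtension Y W := by
  classical
  have hloc : ∀ p : N, ∃ V : VField N, p ∈ U.horizon → ∃ O ∈ 𝓝 p,
      (∀ n ∈ O ∩ (range U.embed ∪ U.horizon), ContMDiffWithinAt (𝓡 4) (𝓡 4).tangent ∞
        (fun y => (⟨y, V y⟩ : TangentBundle (𝓡 4) N)) (range U.embed ∪ U.horizon) n) ∧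
      ∀ m, U.embed m ∈ O → V (U.embed m) = mfderiv (𝓡 4) (𝓡 4) U.embed m (Y m) := by
    intro p
    by_cases hp : p ∈ U.horizon
    · obtain ⟨e, r, y', Y₁, Y₂, he, hpe, hr, hrt, -, h1, h2⟩ := exists_local_extension hY hp
      refine ⟨localField e y', fun _ => ⟨e.source ∩ e ⁻¹' Metric.ball (e p) r,
        inter_mem (e.open_source.mem_nhds hpe)
          ((e.continuousAt hpe).preimage_mem_nhds (Metric.ball_mem_nhds _ hr)), ?_, ?_⟩⟩
      · rintro n ⟨⟨hn, hnb⟩, hns⟩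
        exact h1 n hn ⟨hnb, (he.mem_union_iff hn).1 hns⟩
      · rintro m ⟨hn, hnb⟩
        exact h2 m hn ⟨hnb, (he.mem_range_iff hn).1 (mem_range_self m)⟩
    · exact ⟨fun _ => 0, fun h => absurd h hp⟩
  choose V hV using hloc
  -- At a horizon point the local extension centred at that same point is evaluated.
  let W : VField N := fun n => if h : n ∈ range U.embed then
    (mfderiv (𝓡 4) (𝓡 4) U.embed h.choose (Y h.choose) : E4) else V n n
  have hWm : ∀ m, W (U.embed m) = mfderiv (𝓡 4) (𝓡 4) U.embed m (Y m) := by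
    intro m
    have h : U.embed m ∈ range U.embed := mem_range_self m
    have h1 : ∀ m', m' = m → (mfderiv (𝓡 4) (𝓡 4) U.embed m' (Y m') : E4)
        = (mfderiv (𝓡 4) (𝓡 4) U.embed m (Y m) : E4) := by rintro _ rfl; rfl
    exact (dif_pos h).trans (h1 _ (U.embed_open.injective h.choose_spec))
  refine ⟨W, ?_, hWm⟩
  have hhor : ∀ p ∈ U.horizon, ContMDiffWithinAt (𝓡 4) (𝓡 4).tangent ∞
      (fun y => (⟨y, W y⟩ : TangentBundle (𝓡 4) N)) (range U.embed ∪ U.horizon) p := by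
    intro p hp
    obtain ⟨O, hO, hsm, hem⟩ := hV p hp
    have hpO := mem_of_mem_nhds hO
    have heq : ∀ n ∈ interior O ∩ (range U.embed ∪ U.horizon), W n = V p n := by
      rintro n ⟨hnO, hn⟩
      by_cases h : n ∈ range U.embed
      · obtain ⟨m, rfl⟩ := h
        rw [hWm, hem m (interior_subset hnO)]
      · have hnh : n ∈ U.horizon := hn.resolve_left h
        have hW : W n = V n n := dif_neg h
        obtain ⟨O', hO', hsm', hem'⟩ := hV n hnh
        rw [hW]
        -- The extensions centred at `n` and at `p` both equal the push-forward of `Y` at bulk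
        -- points near `n`, hence agree at `n`.
        refine eq_on_horizon hnh (hsm' n ⟨mem_of_mem_nhds hO', hn⟩)
          (hsm n ⟨interior_subset hnO, hn⟩) (inter_mem hO' (isOpen_interior.mem_nhds hnO)) ?_
        intro m hm
        rw [hem' m hm.1, hem m (interior_subset hm.2)]
    have hp' : p ∈ interior O := mem_interior_iff_mem_nhds.2 hO
    refine (hsm p ⟨hpO, Or.inr hp⟩).congr_of_eventuallyEq ?_ (by rw [heq p ⟨hp', Or.inr hp⟩])
    filter_upwards [self_mem_nhdsWithin, nhdsWithin_le_nhds (isOpen_interior.mem_nhds hp')]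
      with n h1 h2
    rw [heq n ⟨h2, h1⟩]
  rintro n (⟨m, rfl⟩ | hn)
  · have hn : U.embed m ∈ range U.embed := mem_range_self m
    have he : chartAt E4 (U.embed m) ∈ IsManifold.maximalAtlas (𝓡 4) ∞ N :=
      IsManifold.chart_mem_maximalAtlas _
    have hs := mem_chart_source E4 (U.embed m)
    have he' := pullbackChart_mem_maximalAtlas U.embed_open U.embed_smooth
      U.injective_mfderiv_embed he
    have hms := (mem_pullbackChart_source U.embed_open (chartAt E4 (U.embed m))).2 hs
    have h1 := contDiffWithinAt_coordField he' (V := Y) (s := univ) hms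
      (contMDiffWithinAt_univ.2 (hY.1 _))
    rw [preimage_univ] at h1
    have h2 := (pullbackChart U.embed_open (chartAt E4 (U.embed m))).open_target.mem_nhds
      ((pullbackChart U.embed_open (chartAt E4 (U.embed m))).map_source hms)
    refine contMDiffWithinAt_of_coordField he hs (T := univ) ?_ (by simp)
    refine h1.congr_of_eventuallyEq ?_ ?_
    · rw [nhdsWithin_univ]
      filter_upwards [h2] with x hx
      exact (coordField_pullbackChart U.embed_open U.embed_smooth
        (mdifferentiable_of_mem_maximalAtlas he) hWm hx).symm
    · exact (coordField_pullbackChart U.embed_open U.embed_smooth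
        (mdifferentiable_of_mem_maximalAtlas he) hWm (mem_of_mem_nhds h2)).symm
  · exact hhor n hn

/-- The Killing equation and its first derivative hold on the horizon. -/
theorem IsSmoothExtension.exists_killingJet {Y : VField M} (hY : U.bulk.IsKillingField Y)
    {W : VField N} (hW : U.IsSmoothExtension Y W) {p : N} (hp : p ∈ U.horizon) :
    ∃ (e : OpenPartialHomeomorph N E4) (r : ℝ)
      (Y₁ : E4 → E4 →L[ℝ] E4) (Y₂ : E4 → E4 →L[ℝ] E4 →L[ℝ] E4), U.IsBoundaryChart e ∧
      p ∈ e.source ∧ 0 < r ∧ Metric.closedBall (e p) r ⊆ e.target ∧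
      KillingJet (U.ambient.chartMetricL e) (halfBall' (e p) r) (coordField e W) Y₁ Y₂ := by
  obtain ⟨e, r, y', Y₁, Y₂, he, hpe, hr, hrt, hjet, h1, h2⟩ := exists_local_extension hY hp
  refine ⟨e, r, Y₁, Y₂, he, hpe, hr, hrt, hjet.congr ?_⟩
  have hem := mdifferentiable_of_mem_maximalAtlas he.mem_atlas
  intro x hx
  have hxt : x ∈ e.target := hrt (Metric.ball_subset_closedBall hx.1)
  have hxs := e.map_target hxt
  have hxr := e.right_inv hxt
  rw [← coordField_localField hem y' hxt, coordField, coordField]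
  congr 1
  rcases (he.mem_union_iff hxs).2 (by rw [hxr]; exact hx.2) with ⟨m, hm⟩ | hh
  · have h3 := h2 m (by rwa [hm]) (by
      rw [hm, hxr]; refine ⟨hx.1, ?_⟩
      have := (he.mem_range_iff hxs).1 ⟨m, hm⟩
      rwa [hxr] at this)
    rw [← hm, hW.2, h3]
  · refine eq_on_horizon hh (hW.1 _ (Or.inr hh)) (h1 _ hxs (by rwa [hxr]))
      (inter_mem (e.open_source.mem_nhds hxs) ((e.continuousAt hxs).preimage_mem_nhds
        (Metric.isOpen_ball.mem_nhds (by rw [hxr]; exact hx.1)))) ?_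
    rintro m ⟨hm, hmb⟩
    rw [hW.2, h2 m hm ⟨hmb, (he.mem_range_iff hm).1 (mem_range_self m)⟩]

end ExpandingUniverse

/-! ### The tangent space of the sphere as an orthogonal complement. -/

section Sphere

theorem finrank_E3 : Fact (Module.finrank ℝ E3 = 2 + 1) := ⟨by simp⟩

theorem contMDiff_coe_S2 : ContMDiff (𝓡 2) 𝓘(ℝ, E3) ∞ (fun q : S2 => (q : E3)) :=
  have := finrank_E3
  contMDiff_coe_sphere (n := 2) (E := E3)

theorem injective_mvfderiv_coe (q : S2) :
    Function.Injective (mvfderiv (𝓡 2) (fun q : S2 => (q : E3)) q) :=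
  have := finrank_E3
  injective_mvfderiv_subtypeVal_sphere (n := 2) q

theorem range_mvfderiv_coe (q : S2) (x : E3) :
    x ∈ LinearMap.range (mvfderiv (𝓡 2) (fun q : S2 => (q : E3)) q).toLinearMap
      ↔ inner ℝ (q : E3) x = 0 := by
  have := finrank_E3
  have h : (mvfderiv (𝓡 2) (fun q : S2 => (q : E3)) q).range = (ℝ ∙ (q : E3))ᗮ :=
    range_mvfderiv_subtypeVal (n := 2) q
  have h' : x ∈ (mvfderiv (𝓡 2) (fun q : S2 => (q : E3)) q).range ↔ inner ℝ (q : E3) x = 0 := by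
    rw [h, Submodule.mem_orthogonal_singleton_iff_inner_right]
  exact h'

end Sphere

/-! ### Differentials of functions in charts. -/

section ChartDerivatives

variable {N : Type*} [TopologicalSpace N] [ChartedSpace E4 N] {e : OpenPartialHomeomorph N E4}
  {F : Type*} [NormedAddCommGroup F] [NormedSpace ℝ F] {f : N → F}

theorem fderiv_comp_symm_coordField (he : e.MDifferentiable (𝓡 4) (𝓡 4)) (V : VField N) {x : E4}
    (hx : x ∈ e.target) (hf : MDifferentiableAt (𝓡 4) 𝓘(ℝ, F) f (e.symm x)) :
    fderiv ℝ (f ∘ e.symm) x (coordField e V x) = mvfderiv (𝓡 4) f (e.symm x) (V (e.symm x)) := by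
  have h1 := mfderiv_comp_apply x hf (he.mdifferentiableAt_symm hx) (coordField e V x)
  have h2 := mfderiv_symm_coordField he V hx
  refine Eq.trans ?_ (h1.trans (congrArg (mvfderiv (𝓡 4) f (e.symm x)) h2))
  exact (congrArg (fun T : E4 →L[ℝ] F => T (coordField e V x)) mfderiv_eq_fderiv).symm

theorem fderiv_comp_symm_mfderiv (he : e.MDifferentiable (𝓡 4) (𝓡 4)) {n : N} (hn : n ∈ e.source)
    (hf : MDifferentiableAt (𝓡 4) 𝓘(ℝ, F) f n) (v : TangentSpace (𝓡 4) n) :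
    fderiv ℝ (f ∘ e.symm) (e n) (mfderiv (𝓡 4) (𝓡 4) e n v) = mvfderiv (𝓡 4) f n v := by
  obtain ⟨x, hx, rfl⟩ : ∃ x ∈ e.target, e.symm x = n := ⟨e n, e.map_source hn, e.left_inv hn⟩
  have h1 := mfderiv_comp_apply x hf (he.mdifferentiableAt_symm hx)
    (mfderiv (𝓡 4) (𝓡 4) e (e.symm x) v)
  have h2 := mfderiv_symm_mfderiv he hx v
  rw [e.right_inv hx]
  refine Eq.trans ?_ (h1.trans (congrArg (mvfderiv (𝓡 4) f (e.symm x)) h2))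
  exact (congrArg (fun T : E4 →L[ℝ] F => T (mfderiv (𝓡 4) (𝓡 4) e (e.symm x) v))
    mfderiv_eq_fderiv).symm

end ChartDerivatives

/-! ### Bondi coordinates and tangency to the horizon. -/

namespace ExpandingUniverse

variable {M : Type*} [TopologicalSpace M] [T2Space M] [SecondCountableTopology M]
    [ConnectedSpace M] [ChartedSpace E4 M] [IsManifold (𝓡 4) ∞ M]
    {N : Type*} [TopologicalSpace N] [T2Space N] [SecondCountableTopology N]
    [ConnectedSpace N] [ChartedSpace E4 N] [IsManifold (𝓡 4) ∞ N] (U : ExpandingUniverse M N)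

theorem bondi_mem (z : ℝ × S2) : U.bondi z ∈ U.horizon := by
  rw [← U.bondi_range]; exact mem_range_self z

theorem mdifferentiableAt_bondi (z : ℝ × S2) : MDifferentiableAt scriModel (𝓡 4) U.bondi z :=
  U.bondi_smooth.mdifferentiableAt (by simp)

theorem contMDiffAt_u {p : N} (hp : p ∈ U.horizon) : ContMDiffAt (𝓡 4) 𝓘(ℝ, ℝ) ∞ U.u p :=
  U.u_smooth.contMDiffAt (U.bondiDomain_open.mem_nhds (U.horizon_subset hp))

theorem contMDiffAt_s {p : N} (hp : p ∈ U.horizon) : ContMDiffAt (𝓡 4) (𝓡 2) ∞ U.s p :=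
  U.s_smooth.contMDiffAt (U.bondiDomain_open.mem_nhds (U.horizon_subset hp))

theorem contMDiffAt_coe_s {p : N} (hp : p ∈ U.horizon) :
    ContMDiffAt (𝓡 4) 𝓘(ℝ, E3) ∞ (fun q => (U.s q : E3)) p :=
  contMDiff_coe_S2.contMDiffAt.comp p (U.contMDiffAt_s hp)

theorem du_bondi (z : ℝ × S2) (ζ : TangentSpace scriModel z) :
    mvfderiv (𝓡 4) U.u (U.bondi z) (mfderiv scriModel (𝓡 4) U.bondi z ζ) = ζ.1 := by
  refine (mfderiv_comp_apply z ((U.contMDiffAt_u (U.bondi_mem z)).mdifferentiableAt (by simp))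
    (U.mdifferentiableAt_bondi z) ζ).symm.trans ?_
  have h : U.u ∘ U.bondi = Prod.fst := funext U.u_bondi
  rw [h, mfderiv_fst]
  rfl

theorem dOmega_bondi (z : ℝ × S2) (ζ : TangentSpace scriModel z) :
    mvfderiv (𝓡 4) U.OmegaExt (U.bondi z) (mfderiv scriModel (𝓡 4) U.bondi z ζ) = 0 := by
  refine (mfderiv_comp_apply z (U.OmegaExt_smooth.mdifferentiableAt (by simp))
    (U.mdifferentiableAt_bondi z) ζ).symm.trans ?_
  have h : U.OmegaExt ∘ U.bondi = fun _ => 0 := funext fun z => U.OmegaExt_horizon _ (U.bondi_mem z)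
  rw [h, mfderiv_const]
  rfl

theorem mfderiv_s_bondi (z : ℝ × S2) (ζ : TangentSpace scriModel z) :
    mfderiv (𝓡 4) (𝓡 2) U.s (U.bondi z) (mfderiv scriModel (𝓡 4) U.bondi z ζ) = ζ.2 := by
  refine (mfderiv_comp_apply z ((U.contMDiffAt_s (U.bondi_mem z)).mdifferentiableAt (by simp))
    (U.mdifferentiableAt_bondi z) ζ).symm.trans ?_
  have h : U.s ∘ U.bondi = Prod.snd := funext U.s_bondi
  rw [h, mfderiv_snd]
  rfl

theorem ds_eq {p : N} (hp : p ∈ U.horizon) (v : TangentSpace (𝓡 4) p) :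
    mvfderiv (𝓡 4) (fun q => (U.s q : E3)) p v
      = mvfderiv (𝓡 2) (fun q : S2 => (q : E3)) (U.s p) (mfderiv (𝓡 4) (𝓡 2) U.s p v) :=
  mfderiv_comp_apply p (contMDiff_coe_S2.mdifferentiableAt
    (by simp)) ((U.contMDiffAt_s hp).mdifferentiableAt (by simp)) v

theorem ds_bondi (z : ℝ × S2) (ζ : TangentSpace scriModel z) :
    mvfderiv (𝓡 4) (fun q => (U.s q : E3)) (U.bondi z) (mfderiv scriModel (𝓡 4) U.bondi z ζ)
      = mvfderiv (𝓡 2) (fun q : S2 => (q : E3)) z.2 ζ.2 := by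
  rw [U.ds_eq (U.bondi_mem z)]
  have h : ∀ q (v w : EuclideanSpace ℝ (Fin 2)), q = z.2 → v = w →
      mvfderiv (𝓡 2) (fun q : S2 => (q : E3)) q v
      = mvfderiv (𝓡 2) (fun q : S2 => (q : E3)) z.2 w := by
    rintro q v w rfl rfl; rfl
  exact h _ _ _ (U.s_bondi z) (U.mfderiv_s_bondi z ζ)

/-- The differentials of the coordinates `u`, `Omega`, `s` separate tangent vectors. -/
theorem eq_zero_of_coordinates {p : N} (hp : p ∈ U.horizon) {v : TangentSpace (𝓡 4) p}
    (hu : mvfderiv (𝓡 4) U.u p v = 0) (hO : mvfderiv (𝓡 4) U.OmegaExt p v = 0)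
    (hs : mvfderiv (𝓡 4) (fun q => (U.s q : E3)) p v = 0) : v = 0 := by
  -- On the horizon the metric depends on `v` only through these three differentials, so `v` lies in
  -- the radical.
  refine U.ambient.nondegenerate fun w => ?_
  rw [U.bondi_form p hp, hu, hO, hs]
  simp

/-- There are null vectors transversal to the horizon. -/
theorem exists_null_transversal {p : N} (hp : p ∈ U.horizon) {e : OpenPartialHomeomorph N E4}
    (he : U.IsBoundaryChart e) (hpe : p ∈ e.source) :
    ∃ k₀ : E4, 0 < k₀ 0 ∧ U.ambient.chartMetricL e (e p) k₀ k₀ = 0 := by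
  have hem := mdifferentiable_of_mem_maximalAtlas he.mem_atlas
  have hx := e.map_source hpe
  obtain ⟨z, rfl⟩ : ∃ z, U.bondi z = p := by rw [← mem_range, U.bondi_range]; exact hp
  set p := U.bondi z
  have hx0 : e p 0 = 0 := (he.mem_horizon_iff hpe).1 hp
  have hOd : MDifferentiableAt (𝓡 4) 𝓘(ℝ, ℝ) U.OmegaExt p :=
    U.OmegaExt_smooth.mdifferentiableAt (by simp)
  have hdiff : DifferentiableAt ℝ (U.OmegaExt ∘ e.symm) (e p) := by
    have h : ContDiffAt ℝ ∞ (U.OmegaExt ∘ e.symm) (e p) :=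
      contMDiffAt_iff_contDiffAt.1 (U.OmegaExt_smooth.contMDiffAt.comp (e p)
        (contMDiffAt_symm_of_mem_maximalAtlas he.mem_atlas hx))
    exact h.differentiableAt (by simp)
  -- the differential of `Omega` vanishes on vectors tangent to the coordinate hyperplane
  have htan : ∀ v : E4, v 0 = 0 → fderiv ℝ (U.OmegaExt ∘ e.symm) (e p) v = 0 := by
    intro v hv
    have h1 : HasDerivAt (fun t : ℝ => e p + t • v) v 0 := by
      simpa using ((hasDerivAt_id (0 : ℝ)).smul_const v).const_add (e p : E4)
    have h2 : HasDerivAt (fun t : ℝ => (U.OmegaExt ∘ e.symm) (e p + t • v))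
        (fderiv ℝ (U.OmegaExt ∘ e.symm) (e p) v) 0 := by
      have h5 : HasFDerivAt (U.OmegaExt ∘ e.symm) (fderiv ℝ (U.OmegaExt ∘ e.symm) (e p))
          (e p + (0 : ℝ) • v) := by
        rw [zero_smul, add_zero]
        exact hdiff.hasFDerivAt
      exact h5.comp_hasDerivAt (0 : ℝ) h1
    have h3 : (fun t : ℝ => (U.OmegaExt ∘ e.symm) (e p + t • v)) =ᶠ[𝓝 0] fun _ => 0 := by
      have h4 : ∀ᶠ t : ℝ in 𝓝 0, e p + t • v ∈ e.target :=
        h1.continuousAt.eventually (e.open_target.mem_nhds (by simpa using hx))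
      filter_upwards [h4] with t ht
      refine U.OmegaExt_horizon _ ?_
      rw [he.mem_horizon_iff (e.map_target ht), e.right_inv ht]
      simp [hx0, hv]
    rw [← h2.deriv, h3.deriv_eq]
    simp
  set e₀ : E4 := EuclideanSpace.single 0 1
  -- Otherwise the differential of `Omega`, which vanishes on the hyperplane, would vanish on all
  -- vectors.
  have he₀ : fderiv ℝ (U.OmegaExt ∘ e.symm) (e p) e₀ ≠ 0 := by
    intro h0
    refine U.OmegaExt_regular p hp (ContinuousLinearMap.ext fun v => ?_)
    rw [← fderiv_comp_symm_mfderiv hem hpe hOd v]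
    have h1 : ∀ w : E4, fderiv ℝ (U.OmegaExt ∘ e.symm) (e p) w = 0 := by
      intro w
      have h2 : w = w 0 • e₀ + (w - w 0 • e₀) := by abel
      rw [h2, map_add, map_smul, h0, htan (w - w 0 • e₀) (by simp [e₀])]
      simp
    exact h1 _
  obtain ⟨w₀, hw₀⟩ : ∃ w₀, mfderiv (𝓡 4) (𝓡 4) e p w₀ = e₀ :=
    (isInvertible_mfderiv hem hpe).surjective e₀
  set n : TangentSpace (𝓡 4) p := mfderiv scriModel (𝓡 4) U.bondi z ((1, 0) : ℝ × _)
  set n' : E4 := mfderiv (𝓡 4) (𝓡 4) e p n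
  have hdu : mvfderiv (𝓡 4) U.u p n = 1 := U.du_bondi z _
  have hdO : mvfderiv (𝓡 4) U.OmegaExt p n = 0 := U.dOmega_bondi z _
  have hds : mvfderiv (𝓡 4) (fun q => (U.s q : E3)) p n = 0 :=
    (U.ds_bondi z _).trans (map_zero _)
  have hn' : n' 0 = 0 := by
    by_contra hne
    have h2 : n' = n' 0 • e₀ + (n' - n' 0 • e₀) := by abel
    have h3 := fderiv_comp_symm_mfderiv hem hpe hOd n
    change fderiv ℝ (U.OmegaExt ∘ e.symm) (e p) n' = _ at h3
    rw [h2, map_add, map_smul, htan (n' - n' 0 • e₀) (by simp [e₀]), hdO, add_zero, smul_eq_mul]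
      at h3
    exact (mul_ne_zero hne he₀) h3
  have hγ := U.gamma_ne_zero
  have hgn : ∀ w, U.ambient.metric p n w = -(U.gamma ^ 2 * mvfderiv (𝓡 4) U.OmegaExt p w) := by
    intro w
    rw [U.bondi_form p hp, hdu, hdO, hds]
    simp
  have hg1 : U.ambient.chartMetricL e (e p) n' n' = 0 := by
    refine (U.ambient.chartMetricL_mfderiv hem hpe n n).trans ?_
    rw [hgn, hdO]; simp
  have hg2 : U.ambient.chartMetricL e (e p) n' e₀
      = -(U.gamma ^ 2 * fderiv ℝ (U.OmegaExt ∘ e.symm) (e p) e₀) := by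
    have h1 := U.ambient.chartMetricL_mfderiv hem hpe n w₀
    rw [hw₀, hgn, ← fderiv_comp_symm_mfderiv hem hpe hOd w₀, hw₀] at h1
    exact h1
  set D := fderiv ℝ (U.OmegaExt ∘ e.symm) (e p) e₀
  set A := U.ambient.chartMetricL e (e p) e₀ e₀ with hA
  -- Since `n'` is null and `G(n', e₀) = -γ² D`, the square of `e₀ + t n'` is `A - 2 t γ² D`, which
  -- vanishes for this `t`. Adding `n'` does not change the zeroth coordinate.
  refine ⟨e₀ + (A / (2 * U.gamma ^ 2 * D)) • n', by simp [e₀, hn'], ?_⟩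
  simp only [map_add, map_smul, add_apply, smul_apply, smul_eq_mul, hg1]
  rw [U.ambient.chartMetricL_symm e (e p) e₀ n', hg2, ← hA]
  field_simp
  ring

variable {U}

/-- Killing fields preserving the horizon are tangent to it. -/
theorem IsSmoothExtension.dOmega_eq_zero {Y : VField M} (hP : U.PreservesHorizon Y)
    {W : VField N} (hW : U.IsSmoothExtension Y W) {p : N} (hp : p ∈ U.horizon) :
    mvfderiv (𝓡 4) U.OmegaExt p (W p) = 0 := by
  obtain ⟨e, he, hpe⟩ := U.exists_isBoundaryChart hp
  have hem := mdifferentiable_of_mem_maximalAtlas he.mem_atlas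
  have hem' := mdifferentiable_of_mem_maximalAtlas he.pullbackChart_mem
  have hx := e.map_source hpe
  have hx0 : e p 0 = 0 := (he.mem_horizon_iff hpe).1 hp
  obtain ⟨k₀, hk₀, hnull⟩ := U.exists_null_transversal hp he hpe
  obtain ⟨O, hO, hhO, hconf⟩ := U.X_conformal
  set G := U.ambient.chartMetricL e
  set e' := pullbackChart U.embed_open e
  set A : Set E4 := e.target ∩ e.symm ⁻¹' O
  have hAo : IsOpen A := e.symm.isOpen_inter_preimage hO
  have hpA : e p ∈ A := ⟨hx, by rw [mem_preimage, e.left_inv hpe]; exact hhO hp⟩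
  let ℓ : E4 →L[ℝ] ℝ := EuclideanSpace.proj (0 : Fin 4)
  have hℓ : ∀ x, ℓ x = x 0 := fun _ => rfl
  set B : Set E4 := A ∩ {x | 0 < ℓ x}
  have hB : ∀ x ∈ B, x ∈ e'.target := fun x hx => he.mem_pullbackChart_target.2 ⟨hx.1.1, hx.2⟩
  set F := 𝓝[B] (e p)
  have hF : F ≤ 𝓝 (e p) := nhdsWithin_le_nhds
  have hFB : ∀ᶠ x in F, x ∈ B := self_mem_nhdsWithin
  have hGX : ∀ x ∈ B, ∀ V : VField M, G x (coordField e' U.X x) (coordField e' V x)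
      = U.bulk.metric (e'.symm x) (U.X (e'.symm x)) (V (e'.symm x)) := by
    intro x hx V
    rw [← U.bulk.chartMetricL_coordField hem' _ _ (hB x hx), he.chartMetricL_eq hx.1.1 hx.2]
  have hsm : ∀ V : VField M, SmoothField V → ContDiffOn ℝ ∞ (coordField e' V) B := by
    intro V hV x hx
    have h1 := contDiffWithinAt_coordField he.pullbackChart_mem (V := V) (s := univ)
      (e'.map_target (hB x hx)) (contMDiffWithinAt_univ.2 (hV _))
    rw [e'.right_inv (hB x hx), preimage_univ] at h1
    exact h1.mono (subset_univ _)
  obtain ⟨δ, hδ, hfreq⟩ := exists_frequently_le_norm (G := G) hAo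
    ((U.ambient.contDiffOn_chartMetricL he.mem_atlas).mono inter_subset_left)
    (fun x hx => U.ambient.chartMetricL_nondegenerate hem hx.1)
    (fun x _ => U.ambient.chartMetricL_symm e x)
    (fun x hx v k hv hk hk0 hvk =>
      (U.ambient.chartMetricL_pos_of_orthogonal hem hx.1 hv hvk hk0).ne' hk)
    hpA (ℓ := ℓ) hx0 hk₀ hnull (X := coordField e' U.X)
    (φ := fun x => 2 * mvfderiv (𝓡 4) (fun y => Real.log (U.Omega y)) (e'.symm x)
      (U.X (e'.symm x))) (hsm _ U.X_smooth)
    (fun x hx hx0 => by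
      rw [hGX x ⟨hx, hx0⟩]
      exact (U.X_future _).1)
    (fun x hx hx0 a b => he.lieForm_eq U.X_smooth hx.1 hx0 (hconf _ (by
      rw [apply_pullbackChart_symm U.embed_open e (hB x ⟨hx, hx0⟩)]
      exact hx.2)) a b)
  have hmt : Tendsto e'.symm F (comap U.embed (𝓝 p)) := by
    rw [tendsto_comap_iff]
    have h1 : Tendsto e.symm F (𝓝 p) := by
      have := (e.continuousAt_symm hx).tendsto
      rw [e.left_inv hpe] at this
      exact this.mono_left hF
    refine h1.congr' ?_
    filter_upwards [hFB] with x hx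
    exact (apply_pullbackChart_symm U.embed_open e (hB x hx)).symm
  have hOs : ContDiffAt ℝ ∞ (U.OmegaExt ∘ e.symm) (e p) :=
    contMDiffAt_iff_contDiffAt.1 (U.OmegaExt_smooth.contMDiffAt.comp (e p)
      (contMDiffAt_symm_of_mem_maximalAtlas he.mem_atlas hx))
  -- The identity `dΩ(X) = Ω X(log Ω)` shows that `dΩ(X)` tends to zero at the horizon.
  have hdO : ∀ x ∈ B, fderiv ℝ (U.OmegaExt ∘ e.symm) x (coordField e' U.X x)
      = (U.OmegaExt ∘ e.symm) x * mvfderiv (𝓡 4) (fun y => Real.log (U.Omega y)) (e'.symm x)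
      (U.X (e'.symm x)) := by
    intro x hx
    have h0 : U.OmegaExt ∘ e.symm =ᶠ[𝓝 x] U.Omega ∘ e'.symm := by
      filter_upwards [e'.open_target.mem_nhds (hB x hx)] with y hy
      simp only [Function.comp_apply]
      rw [← U.OmegaExt_embed, apply_pullbackChart_symm U.embed_open e hy]
    have hlog : ContMDiff (𝓡 4) 𝓘(ℝ, ℝ) ∞ (fun y => Real.log (U.Omega y)) := fun y =>
      ((Real.contDiffAt_log.2 (U.Omega_pos y).ne').contMDiffAt).comp y U.Omega_smooth.contMDiffAt
    rw [← fderiv_comp_symm_coordField hem' U.X (hB x hx) (hlog.mdifferentiableAt (by simp)),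
      h0.fderiv_eq, h0.self_of_nhds]
    have h2 : DifferentiableAt ℝ (U.Omega ∘ e'.symm) x :=
      (contMDiffAt_iff_contDiffAt.1 (U.Omega_smooth.contMDiffAt.comp x
      (contMDiffAt_symm_of_mem_maximalAtlas he.pullbackChart_mem (hB x hx)))).differentiableAt
      (n := ∞) (by simp)
    have hpos := (U.Omega_pos (e'.symm x)).ne'
    have h3 := (h2.hasFDerivAt.log hpos).fderiv
    change _ = _ * fderiv ℝ (fun y => Real.log ((U.Omega ∘ e'.symm) y)) x _
    rw [h3]
    simp only [smul_apply, smul_eq_mul, Function.comp_apply]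
    field_simp
  -- The limit direction of `X`: causal, annihilated by `dΩ`, and orthogonal to `W`.
  obtain ⟨ξ, hξ0, hξ1, hξ2, hξ3⟩ := exists_unit_limit (G := G)
    (β := fun x => fderiv ℝ (U.OmegaExt ∘ e.symm) x) hF
    ((U.ambient.contDiffOn_chartMetricL he.mem_atlas).contDiffAt
      (e.open_target.mem_nhds hx)).continuousAt
    ((hOs.fderiv_right (m := ∞) (by simp)).continuousAt) (X := coordField e' U.X)
    (y := coordField e W) (y₀ := coordField e W (e p)) (by
      have h1 := (contDiffWithinAt_coordField he.mem_atlas hpe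
        (hW.1 p (Or.inr hp))).continuousWithinAt.tendsto
      refine h1.mono_left (nhdsWithin_mono _ ?_)
      intro x hx
      refine Or.inl ?_
      rw [he.mem_range_iff (e.map_target hx.1.1), e.right_inv hx.1.1]
      exact hx.2) hδ hfreq
    (by
      filter_upwards [hFB] with x hx
      rw [hGX x hx]
      exact (U.X_future _).1)
    (by
      have h1 := (U.X_log_tendsto p hp).comp hmt
      have h2 : Tendsto (U.OmegaExt ∘ e.symm) F (𝓝 ((U.OmegaExt ∘ e.symm) (e p))) :=
        hOs.continuousAt.tendsto.mono_left hF
      have h3 := h2.mul h1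
      rw [mul_zero] at h3
      refine h3.congr' ?_
      filter_upwards [hFB] with x hx
      exact (hdO x hx).symm)
    (by
      refine ((hP p hp).comp hmt).congr' ?_
      filter_upwards [hFB] with x hx
      rw [← coordField_pullbackChart U.embed_open U.embed_smooth hem hW.2 (hB x hx), hGX x hx]
      exact U.bulk.metric_symm _ _ _)
  obtain ⟨v, rfl⟩ := (isInvertible_mfderiv hem hpe).surjective ξ
  have hγ := U.gamma_ne_zero
  rw [U.ambient.chartMetricL_mfderiv hem hpe, U.bondi_form p hp] at hξ1
  have hξ2' := fderiv_comp_symm_mfderiv hem hpe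
    (U.OmegaExt_smooth.mdifferentiableAt (x := p) (by simp)) v
  rw [hξ2] at hξ2'
  rw [← hξ2'] at hξ1
  -- As `dΩ(v) = 0`, the Bondi form reduces the causality of `v` to `γ² |ds(v)|² ≤ 0`.
  have hds : mvfderiv (𝓡 4) (fun q => (U.s q : E3)) p v = 0 := by
    rw [real_inner_self_eq_norm_sq] at hξ1
    have h1 : 0 < U.gamma ^ 2 := by positivity
    have h2 : ‖mvfderiv (𝓡 4) (fun q => (U.s q : E3)) p v‖ ^ 2 ≤ 0 := by
      by_contra! h
      have := mul_pos h1 h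
      simp only [mul_zero, zero_mul, neg_zero, sub_zero, zero_add] at hξ1
      linarith
    have h3 : ‖mvfderiv (𝓡 4) (fun q => (U.s q : E3)) p v‖ = 0 := by
      nlinarith [norm_nonneg (mvfderiv (𝓡 4) (fun q => (U.s q : E3)) p v)]
    exact norm_eq_zero.1 h3
  have hdu : mvfderiv (𝓡 4) U.u p v ≠ 0 := by
    intro h
    apply hξ0
    rw [U.eq_zero_of_coordinates hp h hξ2'.symm hds]
    exact map_zero _
  -- Of the product of `v` and `W` only `-γ² du(v) dΩ(W)` remains, and `du(v) ≠ 0`.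
  rw [coordField_apply e W hpe, U.ambient.chartMetricL_mfderiv hem hpe, U.bondi_form p hp, hds,
    ← hξ2'] at hξ3
  simpa [hγ, hdu] using hξ3

end ExpandingUniverse

/-! ### Radial projection onto the sphere. -/

section SphereProj

/-- The chart of the sphere at `g x` is the stereographic projection from `-g x`, whose formula is
smooth on a neighbourhood of `g x` in `ℝ³`. -/
theorem contMDiffAt_of_coe {H F X : Type*} [NormedAddCommGroup F] [NormedSpace ℝ F]
    [TopologicalSpace H] {I : ModelWithCorners ℝ F H} [TopologicalSpace X] [ChartedSpace H X]
    {g : X → S2} {x : X} (h : ContMDiffAt I 𝓘(ℝ, E3) ∞ (fun y => (g y : E3)) x) :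
    ContMDiffAt I (𝓡 2) ∞ g x := by
  have := finrank_E3
  rw [contMDiffAt_iff_target]
  refine ⟨Topology.IsInducing.subtypeVal.continuousAt_iff.2 h.continuousAt, ?_⟩
  let v : S2 := g x
  let L : _ ≃ₗᵢ[ℝ] _ := (OrthonormalBasis.fromOrthogonalSpanSingleton (𝕜 := ℝ) 2
    (ne_zero_of_mem_unit_sphere (-v))).repr
  have h1 : ContDiffAt ℝ ∞ (stereoToFun (-v : E3)) (g x : E3) := by
    refine contDiffOn_stereoToFun.contDiffAt (IsOpen.mem_nhds ?_ ?_)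
    · exact isOpen_ne_fun (by fun_prop) continuous_const
    · have hv : ‖(v : E3)‖ = 1 := by simp
      have : inner ℝ (-(v : E3)) (v : E3) = -1 := by
        rw [inner_neg_left, real_inner_self_eq_norm_sq, hv]; norm_num
      change inner ℝ (-(v : E3)) (v : E3) ≠ 1
      rw [this]; norm_num
  have h2 : ContDiffAt ℝ ∞ (L ∘ stereoToFun (-v : E3)) (g x : E3) :=
    L.contDiff.contDiffAt.comp _ h1
  exact ContMDiffAt.comp (g := L ∘ stereoToFun (-v : E3)) (f := fun y => (g y : E3)) x
    h2.contMDiffAt h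

/-- The radial projection to the unit sphere (with an arbitrary value at the origin). -/
def sphereProj (x : E3) : S2 :=
  if h : x = 0 then ⟨EuclideanSpace.single 0 1, by simp⟩
  else ⟨‖x‖⁻¹ • x, by simp [norm_smul, h]⟩

theorem coe_sphereProj {x : E3} (hx : x ≠ 0) : (sphereProj x : E3) = ‖x‖⁻¹ • x := by
  simp [sphereProj, hx]

theorem sphereProj_coe (q : S2) : sphereProj q = q := by
  have hq : ‖(q : E3)‖ = 1 := by simp
  have h0 : (q : E3) ≠ 0 := by intro h; simp [h] at hq
  apply Subtype.ext
  rw [coe_sphereProj h0, hq]; simp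

theorem hasFDerivAt_norm_inv_smul {x : E3} (hx : x ≠ 0) :
    HasFDerivAt (fun y : E3 => ‖y‖⁻¹ • y) (‖x‖⁻¹ • ContinuousLinearMap.id ℝ E3
      - (‖x‖ ^ 3)⁻¹ • (innerSL ℝ x).smulRight x) x := by
  have hn : ‖x‖ ≠ 0 := norm_ne_zero_iff.2 hx
  have h1 : HasFDerivAt (fun y : E3 => ‖y‖) (‖x‖⁻¹ • innerSL ℝ x) x := by
    have h2 := (hasStrictFDerivAt_norm_sq x).hasFDerivAt.sqrt (by positivity)
    have h3 : (fun y : E3 => √(‖y‖ ^ 2)) = fun y => ‖y‖ := by ext y; simp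
    rw [h3] at h2
    refine h2.congr_fderiv ?_
    rw [Real.sqrt_sq (norm_nonneg x), two_smul, ← two_smul ℝ, smul_smul]
    congr 1
    field_simp
  have h4 := (hasDerivAt_inv hn).comp_hasFDerivAt x h1
  refine (h4.smul (hasFDerivAt_id x)).congr_fderiv ?_
  ext a
  simp
  field_simp
  ring

theorem contDiffAt_norm_inv_smul {x : E3} (hx : x ≠ 0) :
    ContDiffAt ℝ ∞ (fun y : E3 => ‖y‖⁻¹ • y) x :=
  ((contDiffAt_norm ℝ hx).inv (norm_ne_zero_iff.2 hx)).smul contDiffAt_id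

theorem coe_sphereProj_eventuallyEq {x : E3} (hx : x ≠ 0) :
    (fun y => (sphereProj y : E3)) =ᶠ[𝓝 x] fun y => ‖y‖⁻¹ • y := by
  filter_upwards [isOpen_ne.mem_nhds hx] with y hy using coe_sphereProj hy

theorem contMDiffAt_sphereProj {x : E3} (hx : x ≠ 0) :
    ContMDiffAt 𝓘(ℝ, E3) (𝓡 2) ∞ sphereProj x :=
  contMDiffAt_of_coe (((contDiffAt_norm_inv_smul hx).congr_of_eventuallyEq
    (coe_sphereProj_eventuallyEq hx)).contMDiffAt)

end SphereProj

/-! ### The horizon parametrised by `ℝ × (ℝ³ \ {0})`, where calculus takes place in a vector space.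
-/

namespace ExpandingUniverse

variable {M : Type*} [TopologicalSpace M] [T2Space M] [SecondCountableTopology M]
    [ConnectedSpace M] [ChartedSpace E4 M] [IsManifold (𝓡 4) ∞ M]
    {N : Type*} [TopologicalSpace N] [T2Space N] [SecondCountableTopology N]
    [ConnectedSpace N] [ChartedSpace E4 N] [IsManifold (𝓡 4) ∞ N] (U : ExpandingUniverse M N)

/-- The parametrisation of the horizon by `ℝ × (ℝ³ \ {0})`. -/
def coneMap (z : ℝ × E3) : N := U.bondi (z.1, sphereProj z.2)

theorem coneMap_mem (z : ℝ × E3) : U.coneMap z ∈ U.horizon := U.bondi_mem _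

theorem contMDiffAt_coneMap {z : ℝ × E3} (hz : z.2 ≠ 0) :
    ContMDiffAt 𝓘(ℝ, ℝ × E3) (𝓡 4) ∞ U.coneMap z := by
  refine U.bondi_smooth.contMDiffAt.comp z (ContMDiffAt.prodMk ?_ ?_)
  · exact contDiff_fst.contMDiff.contMDiffAt
  · exact (contMDiffAt_sphereProj hz).comp z contDiff_snd.contMDiff.contMDiffAt

theorem mdifferentiableAt_coneMap {z : ℝ × E3} (hz : z.2 ≠ 0) :
    MDifferentiableAt 𝓘(ℝ, ℝ × E3) (𝓡 4) U.coneMap z :=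
  (U.contMDiffAt_coneMap hz).mdifferentiableAt (by simp)

theorem du_coneMap {z : ℝ × E3} (hz : z.2 ≠ 0) (ζ : ℝ × E3) :
    mvfderiv (𝓡 4) U.u (U.coneMap z) (mfderiv 𝓘(ℝ, ℝ × E3) (𝓡 4) U.coneMap z ζ) = ζ.1 := by
  refine (mfderiv_comp_apply z ((U.contMDiffAt_u (U.coneMap_mem z)).mdifferentiableAt (by simp))
    (U.mdifferentiableAt_coneMap hz) ζ).symm.trans ?_
  have h : U.u ∘ U.coneMap = Prod.fst := funext fun z => U.u_bondi _
  rw [h]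
  refine (congrArg (fun T : ℝ × E3 →L[ℝ] ℝ => T ζ) mfderiv_eq_fderiv).trans ?_
  rw [fderiv_fst]
  rfl

theorem dOmega_coneMap {z : ℝ × E3} (hz : z.2 ≠ 0) (ζ : ℝ × E3) :
    mvfderiv (𝓡 4) U.OmegaExt (U.coneMap z) (mfderiv 𝓘(ℝ, ℝ × E3) (𝓡 4) U.coneMap z ζ) = 0 := by
  refine (mfderiv_comp_apply z (U.OmegaExt_smooth.mdifferentiableAt (by simp))
    (U.mdifferentiableAt_coneMap hz) ζ).symm.trans ?_
  have h : U.OmegaExt ∘ U.coneMap = fun _ => 0 :=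
    funext fun z => U.OmegaExt_horizon _ (U.coneMap_mem z)
  rw [h, mfderiv_const]
  rfl

theorem ds_coneMap {z : ℝ × E3} (hz : z.2 ≠ 0) (ζ : ℝ × E3) :
    mvfderiv (𝓡 4) (fun q => (U.s q : E3)) (U.coneMap z)
      (mfderiv 𝓘(ℝ, ℝ × E3) (𝓡 4) U.coneMap z ζ)
      = ‖z.2‖⁻¹ • ζ.2 - (‖z.2‖ ^ 3)⁻¹ • (inner ℝ z.2 ζ.2 • z.2) := by
  refine (mfderiv_comp_apply z ((U.contMDiffAt_coe_s (U.coneMap_mem z)).mdifferentiableAt (by simp))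
    (U.mdifferentiableAt_coneMap hz) ζ).symm.trans ?_
  have h : (fun q => (U.s q : E3)) ∘ U.coneMap = fun z => (sphereProj z.2 : E3) :=
    funext fun z => by simp [coneMap, U.s_bondi]
  rw [h]
  refine (congrArg (fun T : ℝ × E3 →L[ℝ] E3 => T ζ) mfderiv_eq_fderiv).trans ?_
  have h1 := ((hasFDerivAt_norm_inv_smul hz).congr_of_eventuallyEq
    (coe_sphereProj_eventuallyEq hz)).comp z hasFDerivAt_snd
  have h2 := h1.fderiv
  simp only [Function.comp_def] at h2
  rw [h2]
  simp

theorem inner_ds {p : N} (hp : p ∈ U.horizon) (v : TangentSpace (𝓡 4) p) :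
    inner ℝ (U.s p : E3) (mvfderiv (𝓡 4) (fun q => (U.s q : E3)) p v) = 0 := by
  rw [U.ds_eq hp, ← range_mvfderiv_coe]
  exact ⟨_, rfl⟩

variable {U}

/-- The metric on the horizon. -/
theorem metric_coneMap {z : ℝ × E3} (hz : z.2 ≠ 0) (ζ η : ℝ × E3) :
    U.ambient.metric (U.coneMap z) (mfderiv 𝓘(ℝ, ℝ × E3) (𝓡 4) U.coneMap z ζ)
      (mfderiv 𝓘(ℝ, ℝ × E3) (𝓡 4) U.coneMap z η) = U.gamma ^ 2 * ((‖z.2‖ ^ 4)⁻¹ *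
        (‖z.2‖ ^ 2 * inner ℝ ζ.2 η.2 - inner ℝ z.2 ζ.2 * inner ℝ z.2 η.2)) := by
  have hn : ‖z.2‖ ≠ 0 := norm_ne_zero_iff.2 hz
  rw [U.bondi_form _ (U.coneMap_mem z), U.ds_coneMap hz, U.ds_coneMap hz, U.dOmega_coneMap hz,
    U.dOmega_coneMap hz]
  congr 1
  simp only [inner_sub_left, inner_sub_right, inner_smul_left, inner_smul_right,
    real_inner_self_eq_norm_sq, real_inner_comm z.2]
  simp
  field_simp
  ring

/-- `W` is smooth only within `M ∪ ℑ⁻`, but a map with values in the horizon never leaves this set,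
so the composition is smooth without restriction. -/
theorem IsSmoothExtension.contMDiffAt_mvfderiv {Y : VField M} {W : VField N}
    (hW : U.IsSmoothExtension Y W) {H F X V : Type*} [NormedAddCommGroup F] [NormedSpace ℝ F]
    [NormedAddCommGroup V] [NormedSpace ℝ V]
    [TopologicalSpace H] {I : ModelWithCorners ℝ F H} [TopologicalSpace X] [ChartedSpace H X]
    {h : X → N} {x : X} (hh : ContMDiffAt I (𝓡 4) ∞ h x) (hhor : ∀ y, h y ∈ U.horizon)
    {φ : N → V} (hφ : ContMDiffAt (𝓡 4) 𝓘(ℝ, V) ∞ φ (h x)) :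
    ContMDiffAt I 𝓘(ℝ, V) ∞ (fun y => mvfderiv (𝓡 4) φ (h y) (W (h y))) x := by
  set e := chartAt E4 (h x)
  have he : e ∈ IsManifold.maximalAtlas (𝓡 4) ∞ N := IsManifold.chart_mem_maximalAtlas _
  have hem := mdifferentiable_of_mem_maximalAtlas he
  have hs : h x ∈ e.source := mem_chart_source E4 (h x)
  have h1 := contDiffWithinAt_coordField he hs (hW.1 _ (Or.inr (hhor x)))
  have h2 : ContDiffAt ℝ ∞ (φ ∘ e.symm) (e (h x)) := by
    refine contMDiffAt_iff_contDiffAt.1 (ContMDiffAt.comp (e (h x)) ?_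
      (contMDiffAt_symm_of_mem_maximalAtlas he (e.map_source hs)))
    rwa [e.left_inv hs]
  have h3 : ContDiffWithinAt ℝ ∞ (fun y => fderiv ℝ (φ ∘ e.symm) y (coordField e W y))
      (e.symm ⁻¹' (range U.embed ∪ U.horizon)) (e (h x)) :=
    ((h2.fderiv_right (m := ∞) (by simp)).contDiffWithinAt).clm_apply h1
  have h4 : ContMDiffAt I (𝓡 4) ∞ (fun y => e (h y)) x :=
    (contMDiffAt_of_mem_maximalAtlas he hs).comp x hh
  have hsrc : ∀ᶠ y in 𝓝 x, h y ∈ e.source := hh.continuousAt.eventually (e.open_source.mem_nhds hs)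
  have h5 := ContMDiffWithinAt.comp' x (contMDiffWithinAt_iff_contDiffWithinAt.2 h3)
    h4.contMDiffWithinAt (s := univ)
  have h7 : univ ∩ (fun y => e (h y)) ⁻¹' (e.symm ⁻¹' (range U.embed ∪ U.horizon)) ∈ 𝓝 x := by
    filter_upwards [hsrc] with y hy
    refine ⟨mem_univ _, ?_⟩
    rw [mem_preimage, mem_preimage, e.left_inv hy]
    exact Or.inr (hhor y)
  refine (h5.contMDiffAt h7).congr_of_eventuallyEq ?_
  have : IsManifold (𝓡 4) 1 N := IsManifold.of_le (n := ∞) (by simp)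
  have h6 : ∀ᶠ y in 𝓝 x, ContMDiffAt (𝓡 4) 𝓘(ℝ, V) 1 φ (h y) :=
    hh.continuousAt.eventually ((contMDiffAt_iff_contMDiffAt_nhds (by simp)).1
      (hφ.of_le (m := 1) (by simp)))
  filter_upwards [hsrc, h6] with y hy hy'
  simp only [Function.comp_apply]
  rw [coordField_apply e W hy, fderiv_comp_symm_mfderiv hem hy (hy'.mdifferentiableAt (by simp))]

end ExpandingUniverse

/-! ### Killing fields of the degenerate metric of `ℝ × 𝕊²`. -/

section SkewFields

/-- Killing fields pull back under maps to which they are tangent. -/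
theorem killing_pullback {E E' : Type*} [NormedAddCommGroup E] [NormedSpace ℝ E]
    [NormedAddCommGroup E'] [NormedSpace ℝ E'] {G : E → E →L[ℝ] E →L[ℝ] ℝ} {T : Set E}
    {F : E' → E} {y : E → E} {m : E →L[ℝ] E} {V : E' → E'} {z : E'} (hF : ContDiffAt ℝ ∞ F z)
    (hV : DifferentiableAt ℝ V z) (hmaps : ∀ᶠ w in 𝓝 z, F w ∈ T)
    (hy : HasFDerivWithinAt y m T (F z)) (heq : ∀ᶠ w in 𝓝 z, y (F w) = fderiv ℝ F w (V w))
    (hG : DifferentiableAt ℝ G (F z)) (hkill : ∀ a b, lieForm G (F z) (y (F z)) m a b = 0)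
    (a b : E') :
    fderiv ℝ (fun w => G (F w) (fderiv ℝ F w a) (fderiv ℝ F w b)) z (V z)
      + G (F z) (fderiv ℝ F z (fderiv ℝ V z a)) (fderiv ℝ F z b)
      + G (F z) (fderiv ℝ F z a) (fderiv ℝ F z (fderiv ℝ V z b)) = 0 := by
  have hF1 := (hF.differentiableAt (by simp)).hasFDerivAt
  have hF2 := ((hF.fderiv_right (m := ∞) (by simp)).differentiableAt (by simp)).hasFDerivAt
  have hsym : ∀ a b, fderiv ℝ (fderiv ℝ F) z a b = fderiv ℝ (fderiv ℝ F) z b a := fun a b =>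
    (hF.isSymmSndFDerivAt (by simpa using two_le_infty)) a b
  have h1 : HasFDerivAt (fun w => y (F w)) (m ∘L fderiv ℝ F z) z := by
    rw [← hasFDerivWithinAt_univ] at hF1 ⊢
    have h2 : HasFDerivWithinAt F (fderiv ℝ F z) {w | F w ∈ T} z := hF1.mono (subset_univ _)
    have h3 := hy.comp z h2 (fun w hw => hw)
    rw [hasFDerivWithinAt_univ]
    exact h3.hasFDerivAt hmaps
  have h2 := (hF2.clm_apply hV.hasFDerivAt).congr_of_eventuallyEq heq
  -- Differentiating `y ∘ F = DF(V)`; symmetry of `D²F` makes the extra term the one from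
  -- differentiating `DF` along `V` in the pulled-back metric.
  have h3 : ∀ a, m (fderiv ℝ F z a)
      = fderiv ℝ F z (fderiv ℝ V z a) + fderiv ℝ (fderiv ℝ F) z (V z) a := by
    intro a
    have := congrArg (fun T : E' →L[ℝ] E => T a) (h1.unique h2)
    rw [hsym]
    simpa using this
  have h4 := ((hG.hasFDerivAt.comp z hF1).clm_apply (hF2.clm_apply (hasFDerivAt_const a z))).clm_apply
    (hF2.clm_apply (hasFDerivAt_const b z))
  have h5 : fderiv ℝ (fun w => G (F w) (fderiv ℝ F w a) (fderiv ℝ F w b)) z = _ := h4.fderiv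
  have h6 := hkill (fderiv ℝ F z a) (fderiv ℝ F z b)
  rw [lieForm, h3, h3, heq.self_of_nhds] at h6
  rw [h5, ← h6]
  simp
  ring

/-- Euclidean Killing fields on the punctured space which are homogeneous of degree one are
linear. -/
theorem exists_skew_of_skew_fderiv {t : E3 → E3} (ht : ∀ x ≠ 0, ContDiffAt ℝ ∞ t x)
    (hskew : ∀ x ≠ 0, ∀ a b, inner ℝ (fderiv ℝ t x a) b + inner ℝ a (fderiv ℝ t x b) = 0)
    (hom : ∀ x ≠ 0, t ((2 : ℝ) • x) = (2 : ℝ) • t x) :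
    ∃ A : E3 →L[ℝ] E3, (∀ a b, inner ℝ (A a) b + inner ℝ a (A b) = 0) ∧ ∀ x ≠ 0, t x = A x := by
  have hO : IsOpen {x : E3 | x ≠ 0} := isOpen_ne
  have hconn : IsPreconnected {x : E3 | x ≠ 0} := by
    have h1 : 1 < Module.rank ℝ E3 := by
      rw [rank_eq_card_basis (EuclideanSpace.basisFun (Fin 3) ℝ).toBasis]
      simp
    exact (isConnected_compl_singleton_of_one_lt_rank h1 0).isPreconnected
  have h2 : ∀ x ≠ 0, ∀ a b, fderiv ℝ (fderiv ℝ t) x a b = fderiv ℝ (fderiv ℝ t) x b a :=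
    fun x hx a b => ((ht x hx).isSymmSndFDerivAt (by simpa using two_le_infty)) a b
  have hd2 : ∀ x ≠ 0, DifferentiableAt ℝ (fderiv ℝ t) x := fun x hx =>
    ((ht x hx).fderiv_right (m := ∞) (by simp)).differentiableAt (by simp)
  have h3 : ∀ x ≠ 0, ∀ c a b, inner ℝ (fderiv ℝ (fderiv ℝ t) x c a) b
      + inner ℝ a (fderiv ℝ (fderiv ℝ t) x c b) = 0 := by
    intro x hx c a b
    have h4 := (hd2 x hx).hasFDerivAt
    have h5 := (((h4.clm_apply (hasFDerivAt_const a x)).inner ℝ (hasFDerivAt_const b x)).add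
      ((hasFDerivAt_const a x).inner ℝ (h4.clm_apply (hasFDerivAt_const b x))))
    have h6 : (fun y => inner ℝ (fderiv ℝ t y a) b + inner ℝ a (fderiv ℝ t y b)) =ᶠ[𝓝 x]
        fun _ => 0 := by
      filter_upwards [hO.mem_nhds hx] with y hy using hskew y hy a b
    have h7 := h5.unique ((hasFDerivAt_const (0 : ℝ) x).congr_of_eventuallyEq h6)
    have h8 := congrArg (fun T : E3 →L[ℝ] ℝ => T c) h7
    simpa [fderivInnerCLM_apply] using h8
  -- A trilinear form symmetric in its first two arguments and antisymmetric in its last two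
  -- vanishes.
  have h4 : ∀ x ≠ 0, fderiv ℝ (fderiv ℝ t) x = 0 := by
    intro x hx
    ext1 c
    ext1 a
    refine ext_inner_right ℝ fun b => ?_
    have e1 := h3 x hx c a b
    have e2 := h3 x hx a b c
    have e3 := h3 x hx b c a
    rw [h2 x hx a b] at e2
    rw [h2 x hx b c] at e3
    rw [h2 x hx a c] at e2
    rw [real_inner_comm] at e2
    simp only [zero_apply, inner_zero_left]
    have f1 := real_inner_comm a (fderiv ℝ (fderiv ℝ t) x c b)
    have f2 := real_inner_comm c (fderiv ℝ (fderiv ℝ t) x b a)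
    have f3 := real_inner_comm b (fderiv ℝ (fderiv ℝ t) x c a)
    linarith
  obtain ⟨A, hA⟩ := hO.exists_is_const_of_fderiv_eq_zero (𝕜 := ℝ) (f := fderiv ℝ t) hconn
    (fun x hx => (hd2 x hx).differentiableWithinAt) (fun x hx => h4 x hx)
  have hA' : ∀ x : E3, x ≠ 0 → fderiv ℝ t x = A := fun x hx => hA x hx
  obtain ⟨x₀, hx₀⟩ : ∃ x : E3, x ≠ 0 := ⟨EuclideanSpace.single 0 1, by simp⟩
  obtain ⟨c, hc⟩ := hO.exists_is_const_of_fderiv_eq_zero (𝕜 := ℝ) (f := fun x => t x - A x) hconn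
    (fun x hx => (((ht x hx).differentiableAt (by simp)).sub
      A.differentiableAt).differentiableWithinAt)
    (fun x hx => by
      have h5 := (((ht x hx).differentiableAt (by simp)).hasFDerivAt.sub A.hasFDerivAt).fderiv
      rw [hA' x hx, sub_self] at h5
      exact h5)
  refine ⟨A, fun a b => ?_, fun x hx => ?_⟩
  · rw [← hA' x₀ hx₀]
    exact hskew x₀ hx₀ a b
  · have e1 : t x - A x = c := hc x hx
    have e2 : t ((2 : ℝ) • x) - A ((2 : ℝ) • x) = c := hc ((2 : ℝ) • x) (by simpa using hx)
    rw [hom x hx, map_smul, ← smul_sub, e1] at e2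
    -- An affine map compatible with dilation by `2` has constant term satisfying `2 c = c`.
    have e3 : c = 0 := by
      have : (2 : ℝ) • c - c = 0 := by rw [e2, sub_self]
      rwa [two_smul, add_sub_cancel_right] at this
    rwa [e3, sub_eq_zero] at e1

/-- The degenerate metric of `ℝ × 𝕊²` on `ℝ × (ℝ³ \ {0})`. -/
def coneForm (z a b : ℝ × E3) : ℝ :=
  (‖z.2‖ ^ 4)⁻¹ * (‖z.2‖ ^ 2 * inner ℝ a.2 b.2 - inner ℝ z.2 a.2 * inner ℝ z.2 b.2)

/-- In a direction orthogonal to `z.2` the squared norm has zero first derivative, so only the inner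
products with `z.2` contribute. -/
theorem fderiv_coneForm {z v : ℝ × E3} (hz : z.2 ≠ 0) (hv : inner ℝ z.2 v.2 = 0) (a b : ℝ × E3) :
    fderiv ℝ (fun w => coneForm w a b) z v = (‖z.2‖ ^ 4)⁻¹ *
      (-(inner ℝ v.2 a.2 * inner ℝ z.2 b.2) - inner ℝ z.2 a.2 * inner ℝ v.2 b.2) := by
  have hn : ‖z.2‖ ≠ 0 := norm_ne_zero_iff.2 hz
  have hN : DifferentiableAt ℝ (fun w : ℝ × E3 => ‖w.2‖) z := differentiableAt_snd.norm ℝ hz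
  have hd : DifferentiableAt ℝ (fun w => coneForm w a b) z := by
    unfold coneForm
    refine DifferentiableAt.mul (DifferentiableAt.inv (hN.pow 4) (by positivity)) ?_
    refine DifferentiableAt.sub ((hN.pow 2).mul_const _) ?_
    exact (differentiableAt_snd.inner ℝ (differentiableAt_const _)).mul
      (differentiableAt_snd.inner ℝ (differentiableAt_const _))
  have h1 : HasDerivAt (fun t : ℝ => z + t • v) v 0 := by
    simpa using ((hasDerivAt_id (0 : ℝ)).smul_const v).const_add z
  have h2 : HasDerivAt (fun t : ℝ => coneForm (z + t • v) a b)
      (fderiv ℝ (fun w => coneForm w a b) z v) 0 := by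
    have h3 : HasFDerivAt (fun w => coneForm w a b) (fderiv ℝ (fun w => coneForm w a b) z)
        (z + (0 : ℝ) • v) := by
      rw [zero_smul, add_zero]
      exact hd.hasFDerivAt
    exact h3.comp_hasDerivAt (0 : ℝ) h1
  have hsq : ∀ t : ℝ, ‖(z + t • v).2‖ ^ 2 = ‖z.2‖ ^ 2 + t ^ 2 * ‖v.2‖ ^ 2 := by
    intro t
    have : (z + t • v).2 = z.2 + t • v.2 := rfl
    rw [this, norm_add_sq_real, inner_smul_right, hv, norm_smul, mul_pow]
    simp
  have hin : ∀ (t : ℝ) (c : E3), inner ℝ (z + t • v).2 c = inner ℝ z.2 c + t * inner ℝ v.2 c := by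
    intro t c
    have : (z + t • v).2 = z.2 + t • v.2 := rfl
    rw [this, inner_add_left, inner_smul_left]
    simp
  have h4 : (fun t : ℝ => coneForm (z + t • v) a b) = fun t : ℝ =>
      ((‖z.2‖ ^ 2 + t ^ 2 * ‖v.2‖ ^ 2) ^ 2)⁻¹ * ((‖z.2‖ ^ 2 + t ^ 2 * ‖v.2‖ ^ 2) * inner ℝ a.2 b.2
        - (inner ℝ z.2 a.2 + t * inner ℝ v.2 a.2) * (inner ℝ z.2 b.2 + t * inner ℝ v.2 b.2)) := by
    ext t
    rw [coneForm, hin, hin, ← hsq, ← pow_mul]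
  rw [h4] at h2
  have e1 : HasDerivAt (fun t : ℝ => ‖z.2‖ ^ 2 + t ^ 2 * ‖v.2‖ ^ 2) 0 0 := by
    simpa using (((hasDerivAt_id (0 : ℝ)).pow 2).mul_const (‖v.2‖ ^ 2)).const_add (‖z.2‖ ^ 2)
  have e2 : ∀ c : E3, HasDerivAt (fun t : ℝ => inner ℝ z.2 c + t * inner ℝ v.2 c) (inner ℝ v.2 c) 0 := by
    intro c
    simpa using ((hasDerivAt_id (0 : ℝ)).mul_const (inner ℝ v.2 c)).const_add (inner ℝ z.2 c)
  have e3 := ((e1.pow 2).inv (by simpa using hn)).mul ((e1.mul_const (inner ℝ a.2 b.2)).sub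
    ((e2 a.2).mul (e2 b.2)))
  rw [h2.unique e3]
  simp
  field_simp
  ring

/-- Killing fields of the degenerate metric of `ℝ × 𝕊²`. -/
theorem skew_of_coneForm {z : ℝ × E3} (hz : z.2 ≠ 0) {f : ℝ × E3 → ℝ} {τ : ℝ × E3 → E3}
    (hf : DifferentiableAt ℝ f z) (hτ : DifferentiableAt ℝ τ z)
    (horth : ∀ w, inner ℝ w.2 (τ w) = 0)
    (h : ∀ a b, fderiv ℝ (fun w => coneForm w a b) z (f z, τ z)
      + coneForm z (fderiv ℝ (fun w => (f w, τ w)) z a) b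
      + coneForm z a (fderiv ℝ (fun w => (f w, τ w)) z b) = 0) (a b : ℝ × E3) :
    inner ℝ (fderiv ℝ τ z a) b.2 + inner ℝ a.2 (fderiv ℝ τ z b) = 0 := by
  have hn : ‖z.2‖ ≠ 0 := norm_ne_zero_iff.2 hz
  have h1 := h a b
  rw [fderiv_coneForm hz (horth z), DifferentiableAt.fderiv_prodMk hf hτ] at h1
  -- Differentiating the orthogonality of `τ` to the radius; these relations cancel all terms except
  -- the symmetrised derivative of `τ`.
  have h2 : ∀ a, inner ℝ a.2 (τ z) + inner ℝ z.2 (fderiv ℝ τ z a) = 0 := by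
    intro a
    have h3 := (hasFDerivAt_snd (𝕜 := ℝ) (p := z)).inner ℝ hτ.hasFDerivAt
    have h4 : (fun w : ℝ × E3 => inner ℝ w.2 (τ w)) = fun _ => (0 : ℝ) := funext horth
    have h5 := h3.fderiv
    rw [h4] at h5
    have h6 := congrArg (fun T : ℝ × E3 →L[ℝ] ℝ => T a) h5
    simp [fderivInnerCLM_apply] at h6
    linarith
  have ea := h2 a
  have eb := h2 b
  simp only [coneForm, ContinuousLinearMap.prod_apply] at h1
  have hn4 : (‖z.2‖ ^ 4)⁻¹ ≠ 0 := by positivity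
  rw [real_inner_comm] at ea eb
  have h7 : (‖z.2‖ ^ 4)⁻¹ * (‖z.2‖ ^ 2 * (inner ℝ (fderiv ℝ τ z a) b.2
      + inner ℝ a.2 (fderiv ℝ τ z b))) = 0 := by
    linear_combination h1 + (‖z.2‖ ^ 4)⁻¹ * inner ℝ z.2 b.2 * ea
      + (‖z.2‖ ^ 4)⁻¹ * inner ℝ z.2 a.2 * eb
  have hn2 : ‖z.2‖ ^ 2 ≠ 0 := by positivity
  exact (mul_eq_zero.1 ((mul_eq_zero.1 h7).resolve_left hn4)).resolve_left hn2

end SkewFields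

/-! ### The spherical component of a Killing field on the horizon. -/

namespace ExpandingUniverse

variable {M : Type*} [TopologicalSpace M] [T2Space M] [SecondCountableTopology M]
    [ConnectedSpace M] [ChartedSpace E4 M] [IsManifold (𝓡 4) ∞ M]
    {N : Type*} [TopologicalSpace N] [T2Space N] [SecondCountableTopology N]
    [ConnectedSpace N] [ChartedSpace E4 N] [IsManifold (𝓡 4) ∞ N] (U : ExpandingUniverse M N)

/-- The `∂_u` component of a vector field on the horizon. -/
def coneU (W : VField N) (z : ℝ × E3) : ℝ := mvfderiv (𝓡 4) U.u (U.coneMap z) (W (U.coneMap z))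

/-- The spherical component of a vector field on the horizon, extended to be homogeneous of degree
one. -/
def coneT (W : VField N) (z : ℝ × E3) : E3 :=
  ‖z.2‖ • mvfderiv (𝓡 4) (fun q => (U.s q : E3)) (U.coneMap z) (W (U.coneMap z))

theorem inner_coneT (W : VField N) (z : ℝ × E3) : inner ℝ z.2 (U.coneT W z) = 0 := by
  rcases eq_or_ne z.2 0 with hz | hz
  · simp [hz]
  have h := U.inner_ds (U.coneMap_mem z) (W (U.coneMap z))
  have h1 : (U.s (U.coneMap z) : E3) = ‖z.2‖⁻¹ • z.2 := by
    rw [coneMap, U.s_bondi, coe_sphereProj hz]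
  have hn : ‖z.2‖ ≠ 0 := norm_ne_zero_iff.2 hz
  rw [h1, inner_smul_left] at h
  rw [coneT, inner_smul_right]
  rcases mul_eq_zero.1 h with h2 | h2
  · exact absurd h2 (by simpa using hz)
  · rw [h2, mul_zero]

variable {U}

theorem IsSmoothExtension.contDiffAt_coneU {Y : VField M} {W : VField N}
    (hW : U.IsSmoothExtension Y W) {z : ℝ × E3} (hz : z.2 ≠ 0) :
    ContDiffAt ℝ ∞ (U.coneU W) z :=
  contMDiffAt_iff_contDiffAt.1 (hW.contMDiffAt_mvfderiv (U.contMDiffAt_coneMap hz) U.coneMap_mem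
    (U.contMDiffAt_u (U.coneMap_mem z)))

theorem IsSmoothExtension.contDiffAt_coneT {Y : VField M} {W : VField N}
    (hW : U.IsSmoothExtension Y W) {z : ℝ × E3} (hz : z.2 ≠ 0) :
    ContDiffAt ℝ ∞ (U.coneT W) z :=
  (contDiffAt_snd.norm ℝ hz).smul (contMDiffAt_iff_contDiffAt.1
    (hW.contMDiffAt_mvfderiv (U.contMDiffAt_coneMap hz) U.coneMap_mem
      (U.contMDiffAt_coe_s (U.coneMap_mem z))))

/-- Tangency supplies the missing `Omega` component; the factor `‖z.2‖` in `coneT` cancels the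
scaling of the radial projection. -/
theorem IsSmoothExtension.eq_mfderiv_coneMap {Y : VField M} (hP : U.PreservesHorizon Y)
    {W : VField N} (hW : U.IsSmoothExtension Y W) {z : ℝ × E3} (hz : z.2 ≠ 0) :
    W (U.coneMap z) = mfderiv 𝓘(ℝ, ℝ × E3) (𝓡 4) U.coneMap z (U.coneU W z, U.coneT W z) := by
  have hn : ‖z.2‖ ≠ 0 := norm_ne_zero_iff.2 hz
  rw [← sub_eq_zero]
  refine U.eq_zero_of_coordinates (U.coneMap_mem z) ?_ ?_ ?_
  · rw [map_sub, U.du_coneMap hz]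
    exact sub_self _
  · rw [map_sub, U.dOmega_coneMap hz, hW.dOmega_eq_zero hP (U.coneMap_mem z), sub_zero]
  · rw [map_sub, U.ds_coneMap hz]
    simp only [U.inner_coneT]
    rw [coneT, smul_smul, inv_mul_cancel₀ hn]
    simp

/-- The Killing equation on the horizon. -/
theorem IsSmoothExtension.skew_coneT {Y : VField M} (hY : U.bulk.IsKillingField Y)
    (hP : U.PreservesHorizon Y) {W : VField N} (hW : U.IsSmoothExtension Y W) {z : ℝ × E3}
    (hz : z.2 ≠ 0) (a b : ℝ × E3) :
    inner ℝ (fderiv ℝ (U.coneT W) z a) b.2 + inner ℝ a.2 (fderiv ℝ (U.coneT W) z b) = 0 := by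
  have hf := (hW.contDiffAt_coneU hz).differentiableAt (by simp)
  have hτ := (hW.contDiffAt_coneT hz).differentiableAt (by simp)
  refine skew_of_coneForm hz hf hτ (U.inner_coneT W) (fun a b => ?_) a b
  obtain ⟨e, r, Y₁, Y₂, he, hpe, hr, hrt, hjet⟩ := hW.exists_killingJet hY (U.coneMap_mem z)
  have hem := mdifferentiable_of_mem_maximalAtlas he.mem_atlas
  have hB := U.contMDiffAt_coneMap hz
  have hz' : ∀ᶠ w : ℝ × E3 in 𝓝 z, w.2 ≠ 0 :=
    continuous_snd.continuousAt.eventually (isOpen_ne.mem_nhds hz)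
  have hsrc : ∀ᶠ w in 𝓝 z, U.coneMap w ∈ e.source :=
    hB.continuousAt.eventually (e.open_source.mem_nhds hpe)
  have hF : ContDiffAt ℝ ∞ (e ∘ U.coneMap) z :=
    contMDiffAt_iff_contDiffAt.1 ((contMDiffAt_of_mem_maximalAtlas he.mem_atlas hpe).comp z hB)
  have hmaps : ∀ᶠ w in 𝓝 z, (e ∘ U.coneMap) w ∈ halfBall' (e (U.coneMap z)) r := by
    filter_upwards [hsrc, hF.continuousAt.eventually (Metric.ball_mem_nhds _ hr)] with w h1 h2
    exact ⟨h2, ((he.mem_horizon_iff h1).1 (U.coneMap_mem w)).ge⟩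
  have hDF : ∀ w : ℝ × E3, w.2 ≠ 0 → U.coneMap w ∈ e.source → ∀ ζ, fderiv ℝ (e ∘ U.coneMap) w ζ
      = mfderiv (𝓡 4) (𝓡 4) e (U.coneMap w) (mfderiv 𝓘(ℝ, ℝ × E3) (𝓡 4) U.coneMap w ζ) := by
    intro w hw hws ζ
    exact (congrArg (fun T : ℝ × E3 →L[ℝ] E4 => T ζ) mfderiv_eq_fderiv).symm.trans
      (mfderiv_comp_apply w (hem.mdifferentiableAt hws) (U.mdifferentiableAt_coneMap hw) ζ)
  have hform : ∀ w : ℝ × E3, w.2 ≠ 0 → U.coneMap w ∈ e.source → ∀ ζ η,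
      U.ambient.chartMetricL e ((e ∘ U.coneMap) w) (fderiv ℝ (e ∘ U.coneMap) w ζ)
        (fderiv ℝ (e ∘ U.coneMap) w η) = U.gamma ^ 2 * coneForm w ζ η := by
    intro w hw hws ζ η
    rw [hDF w hw hws, hDF w hw hws]
    exact (U.ambient.chartMetricL_mfderiv hem hws _ _).trans (metric_coneMap hw ζ η)
  have key := killing_pullback (G := U.ambient.chartMetricL e) (T := halfBall' (e (U.coneMap z)) r)
    (y := coordField e W) (V := fun w => (U.coneU W w, U.coneT W w)) hF (hf.prodMk hτ) hmaps
    (hjet.hasFDerivWithinAt _ hmaps.self_of_nhds) (by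
      filter_upwards [hz', hsrc] with w h1 h2
      rw [hDF w h1 h2]
      refine (coordField_apply e W h2).trans ?_
      rw [hW.eq_mfderiv_coneMap hP h1])
    (((U.ambient.contDiffOn_chartMetricL he.mem_atlas).contDiffAt
      (e.open_target.mem_nhds (e.map_source hpe))).differentiableAt (by simp))
    (hjet.killing _ hmaps.self_of_nhds) a b
  rw [hform z hz hpe, hform z hz hpe] at key
  have h1 : (fun w => U.ambient.chartMetricL e ((e ∘ U.coneMap) w) (fderiv ℝ (e ∘ U.coneMap) w a)
      (fderiv ℝ (e ∘ U.coneMap) w b)) =ᶠ[𝓝 z] fun w => U.gamma ^ 2 * coneForm w a b := by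
    filter_upwards [hz', hsrc] with w h1 h2 using hform w h1 h2 a b
  rw [h1.fderiv_eq] at key
  have h2 : fderiv ℝ (fun w => U.gamma ^ 2 * coneForm w a b) z
      = U.gamma ^ 2 • fderiv ℝ (fun w => coneForm w a b) z := by
    have : (fun w => U.gamma ^ 2 * coneForm w a b) = U.gamma ^ 2 • fun w => coneForm w a b := rfl
    rw [this, fderiv_const_smul_field]
    rfl
  rw [h2, smul_apply, smul_eq_mul] at key
  have hγ : U.gamma ^ 2 ≠ 0 := pow_ne_zero 2 U.gamma_ne_zero
  refine (mul_eq_zero.1 (Eq.trans ?_ key)).resolve_left hγ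
  ring

/-- The spherical part of a Killing field preserving the horizon is a fixed rotation field. -/
theorem IsSmoothExtension.exists_skew {Y : VField M} (hY : U.bulk.IsKillingField Y)
    (hP : U.PreservesHorizon Y) {W : VField N} (hW : U.IsSmoothExtension Y W) :
    ∃ A : E3 →L[ℝ] E3, (∀ a b, inner ℝ (A a) b + inner ℝ a (A b) = 0) ∧
      ∀ z : ℝ × E3, z.2 ≠ 0 → U.coneT W z = A z.2 := by
  have hd : ∀ z : ℝ × E3, z.2 ≠ 0 → HasFDerivAt (U.coneT W) (fderiv ℝ (U.coneT W) z) z :=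
    fun z hz => ((hW.contDiffAt_coneT hz).differentiableAt (by simp)).hasFDerivAt
  have hskew := fun (z : ℝ × E3) (hz : z.2 ≠ 0) => hW.skew_coneT hY hP hz
  -- The vector `∂_u` has no spherical part, so skew-symmetry makes the `u`-derivative orthogonal to
  -- everything.
  have hu : ∀ z : ℝ × E3, z.2 ≠ 0 → fderiv ℝ (U.coneT W) z (1, 0) = 0 := by
    intro z hz
    refine ext_inner_right ℝ fun b => ?_
    have := hskew z hz (1, 0) (0, b)
    simpa using this
  have hconst : ∀ (x : E3) (v : ℝ), x ≠ 0 → U.coneT W (v, x) = U.coneT W (0, x) := by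
    intro x v hx
    have h1 : ∀ t : ℝ, HasDerivAt (fun t : ℝ => U.coneT W (t, x)) 0 t := by
      intro t
      have h2 : HasDerivAt (fun t : ℝ => (t, x)) (1, 0) t :=
        (hasDerivAt_id t).prodMk (hasDerivAt_const t x)
      have h3 := (hd (t, x) hx).comp_hasDerivAt t h2
      rwa [hu (t, x) hx] at h3
    exact is_const_of_deriv_eq_zero (fun t => (h1 t).differentiableAt) (fun t => (h1 t).deriv) _ _
  have hd0 : ∀ x : E3, x ≠ 0 → ∀ a,
      fderiv ℝ (fun x => U.coneT W (0, x)) x a = fderiv ℝ (U.coneT W) (0, x) (0, a) := by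
    intro x hx a
    have h1 := (hd (0, x) hx).comp x (hasFDerivAt_prodMk_right (𝕜 := ℝ) (0 : ℝ) x)
    have h2 : fderiv ℝ (fun x => U.coneT W (0, x)) x = _ := h1.fderiv
    rw [h2]
    simp
  obtain ⟨A, hA, hAx⟩ := exists_skew_of_skew_fderiv (t := fun x => U.coneT W (0, x))
    (fun x hx => ContDiffAt.comp (g := U.coneT W) (f := fun x => ((0 : ℝ), x)) x
      (hW.contDiffAt_coneT hx) (contDiffAt_const.prodMk contDiffAt_id))
    (fun x hx a b => by
      rw [hd0 x hx, hd0 x hx]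
      exact hskew (0, x) hx (0, a) (0, b))
    (fun x hx => by
      have h1 : U.coneMap (0, (2 : ℝ) • x) = U.coneMap (0, x) := by
        have h2 : sphereProj ((2 : ℝ) • x) = sphereProj x := by
          apply Subtype.ext
          rw [coe_sphereProj hx, coe_sphereProj (by simpa using hx), norm_smul, smul_smul]
          congr 1
          have hn : ‖x‖ ≠ 0 := norm_ne_zero_iff.2 hx
          simp
        simp only [coneMap, h2]
      have hdep : ∀ n n', n = n' → mvfderiv (𝓡 4) (fun q => (U.s q : E3)) n (W n)
          = mvfderiv (𝓡 4) (fun q => (U.s q : E3)) n' (W n') := by rintro _ _ rfl; rfl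
      simp only [coneT, norm_smul]
      rw [hdep _ _ h1, smul_smul]
      simp)
  refine ⟨A, hA, fun z hz => ?_⟩
  rw [← hAx z.2 hz, ← hconst z.2 z.1 hz]

end ExpandingUniverse

/-! ### Variations through geodesics. -/

section JacobiFields

variable {E E' : Type*} [NormedAddCommGroup E] [NormedSpace ℝ E] [NormedAddCommGroup E']
  [NormedSpace ℝ E']

/-- The variation field of a family of geodesics satisfies the Jacobi equation; `ζ` may also point
along the geodesic itself. -/
theorem jacobiForm_of_family {G : E → E →L[ℝ] E →L[ℝ] ℝ} {F K L : E' → E} {z : E'} {v : E}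
    (hG : ContDiffAt ℝ ∞ G (F z)) (hF : DifferentiableAt ℝ F z) (hK : DifferentiableAt ℝ K z)
    (hL : DifferentiableAt ℝ L z)
    (h : ∀ᶠ w in 𝓝 z, geodesicForm G (F w) (K w) (L w) v = 0) (ζ : E') :
    jacobiForm G (F z) (K z) (L z) (fderiv ℝ F z ζ) (fderiv ℝ K z ζ) (fderiv ℝ L z ζ) v = 0 := by
  have h1 : HasDerivAt (fun t : ℝ => z + t • ζ) ζ 0 := by
    simpa using ((hasDerivAt_id (0 : ℝ)).smul_const ζ).const_add z
  have h0 : z + (0 : ℝ) • ζ = z := by simp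
  have h2 : ∀ Φ : E' → E, DifferentiableAt ℝ Φ z →
      HasDerivAt (fun t : ℝ => Φ (z + t • ζ)) (fderiv ℝ Φ z ζ) 0 := by
    intro Φ hΦ
    have h3 : HasFDerivAt Φ (fderiv ℝ Φ z) (z + (0 : ℝ) • ζ) := by
      rw [h0]; exact hΦ.hasFDerivAt
    exact h3.comp_hasDerivAt (0 : ℝ) h1
  have h4 : Tendsto (fun t : ℝ => z + t • ζ) (𝓝 0) (𝓝 z) := by
    have := h1.continuousAt.tendsto
    rwa [h0] at this
  have h5 := HasDerivAt.jacobiForm_eq_zero (G := G) (w := v) (by rwa [h0]) (h2 F hF) (h2 K hK)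
    (h2 L hL) (h4.eventually h)
  rwa [h0] at h5

/-- A curve that stays in `T` turns a derivative within `T` into a genuine one. This is what allows
differentiation along the generators, which run in the flat face of the half ball. -/
theorem comp_hasDerivAt_of_eventually {F : Type*} [NormedAddCommGroup F]
    [NormedSpace ℝ F] {y : E → F} {m : E →L[ℝ] F} {T : Set E} {x : ℝ → E} {k : E} {t : ℝ}
    (hy : HasFDerivWithinAt y m T (x t)) (hx : HasDerivAt x k t) (h : ∀ᶠ s in 𝓝 t, x s ∈ T) :
    HasDerivAt (fun s => y (x s)) (m k) t := by
  have h1 := hy.comp_hasDerivWithinAt t (hx.hasDerivWithinAt (s := {s | x s ∈ T})) fun s hs => hs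
  exact h1.hasDerivAt h

end JacobiFields

/-! ### The component along the generators is affine in `u`. -/

namespace ExpandingUniverse

variable {M : Type*} [TopologicalSpace M] [T2Space M] [SecondCountableTopology M]
    [ConnectedSpace M] [ChartedSpace E4 M] [IsManifold (𝓡 4) ∞ M]
    {N : Type*} [TopologicalSpace N] [T2Space N] [SecondCountableTopology N]
    [ConnectedSpace N] [ChartedSpace E4 N] [IsManifold (𝓡 4) ∞ N] {U : ExpandingUniverse M N}

/-- Along a generator the Killing field is `f ∂_u` plus the variation field in the fixed direction
`A q`. The Killing field, `∂_u` and that variation field all satisfy the Jacobi equation, so `f''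
G(∂_u, w) = 0` for all `w`, and `∂_u ≠ 0`. Affine parametrisation by `u` enters through the geodesic
equation for `∂_u`. -/
theorem IsSmoothExtension.fderiv_fderiv_coneU {Y : VField M} (hY : U.bulk.IsKillingField Y)
    (hP : U.PreservesHorizon Y) {W : VField N} (hW : U.IsSmoothExtension Y W) {z : ℝ × E3}
    (hz : z.2 ≠ 0) :
    fderiv ℝ (fun w => fderiv ℝ (U.coneU W) w (1, 0)) z (1, 0) = 0 := by
  obtain ⟨A, -, hA⟩ := hW.exists_skew hY hP
  obtain ⟨e, r, Y₁, Y₂, he, hpe, hr, hrt, hjet⟩ := hW.exists_killingJet hY (U.coneMap_mem z)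
  have hem := mdifferentiable_of_mem_maximalAtlas he.mem_atlas
  set G := U.ambient.chartMetricL e
  set F := e ∘ U.coneMap
  set T := halfBall' (e (U.coneMap z)) r
  let ε : ℝ × E3 := (1, 0)
  let Fu : ℝ × E3 → E4 := fun w => fderiv ℝ F w ε
  let Fuu : ℝ × E3 → E4 := fun w => fderiv ℝ Fu w ε
  let f := U.coneU W
  let fu : ℝ × E3 → ℝ := fun w => fderiv ℝ f w ε
  let P : ℝ × E3 → Prop := fun w => w.2 ≠ 0 ∧ U.coneMap w ∈ e.source ∧ F w ∈ T
  have hFs : ∀ w : ℝ × E3, w.2 ≠ 0 → U.coneMap w ∈ e.source → ContDiffAt ℝ ∞ F w := fun w h1 h2 =>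
    contMDiffAt_iff_contDiffAt.1 ((contMDiffAt_of_mem_maximalAtlas he.mem_atlas h2).comp w
      (U.contMDiffAt_coneMap h1))
  have hPz : ∀ᶠ w in 𝓝 z, P w := by
    have h1 : ∀ᶠ w : ℝ × E3 in 𝓝 z, w.2 ≠ 0 :=
      continuous_snd.continuousAt.eventually (isOpen_ne.mem_nhds hz)
    have h2 : ∀ᶠ w in 𝓝 z, U.coneMap w ∈ e.source :=
      (U.contMDiffAt_coneMap hz).continuousAt.eventually (e.open_source.mem_nhds hpe)
    filter_upwards [h1, h2, (hFs z hz hpe).continuousAt.eventually (Metric.ball_mem_nhds _ hr)]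
      with w h1 h2 h3
    exact ⟨h1, h2, h3, ((he.mem_horizon_iff h2).1 (U.coneMap_mem w)).ge⟩
  have hF : ∀ w, P w → ContDiffAt ℝ ∞ F w := fun w hw => hFs w hw.1 hw.2.1
  have hFu : ∀ w, P w → ContDiffAt ℝ ∞ Fu w := fun w hw =>
    ((hF w hw).fderiv_right (m := ∞) (by simp)).clm_apply contDiffAt_const
  have hFuu : ∀ w, P w → ContDiffAt ℝ ∞ Fuu w := fun w hw =>
    ((hFu w hw).fderiv_right (m := ∞) (by simp)).clm_apply contDiffAt_const
  have hf : ∀ w, P w → ContDiffAt ℝ ∞ f w := fun w hw => hW.contDiffAt_coneU hw.1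
  have hfu : ∀ w, P w → ContDiffAt ℝ ∞ fu w := fun w hw =>
    ((hf w hw).fderiv_right (m := ∞) (by simp)).clm_apply contDiffAt_const
  have hline : ∀ {V : Type} [NormedAddCommGroup V] [NormedSpace ℝ V] (Φ : ℝ × E3 → V) (x : E3)
      (t : ℝ), ContDiffAt ℝ ∞ Φ (t, x) →
      HasDerivAt (fun s => Φ (s, x)) (fderiv ℝ Φ (t, x) ε) t := by
    intro V _ _ Φ x t hΦ
    exact ((hΦ.differentiableAt (by simp)).hasFDerivAt).comp_hasDerivAt t
      ((hasDerivAt_id t).prodMk (hasDerivAt_const t x))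
  have hlineP : ∀ w, (∀ᶠ w' in 𝓝 w, P w') → ∀ᶠ t in 𝓝 w.1, P (t, w.2) := by
    intro w hw
    have h1 : ContinuousAt (fun t : ℝ => (t, w.2)) w.1 := by fun_prop
    exact h1.eventually hw
  -- Derivatives in `u` and in the variation direction commute, so the derivatives of the variation
  -- field match those entering the Jacobi equation of the family.
  have hsw : ∀ (Φ : ℝ × E3 → E4) w, ContDiffAt ℝ ∞ Φ w → ∀ ζ,
      fderiv ℝ (fun w => fderiv ℝ Φ w ε) w ζ = fderiv ℝ (fderiv ℝ Φ) w ε ζ := by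
    intro Φ w hΦ ζ
    have h1 := ((hΦ.fderiv_right (m := ∞) (by simp)).differentiableAt (by simp)).hasFDerivAt
    have h2 := (h1.clm_apply (hasFDerivAt_const ε w)).fderiv
    rw [h2]
    have h3 := (hΦ.isSymmSndFDerivAt (by simpa using two_le_infty)) ζ ε
    simpa using h3
  -- the geodesic equation of the generators
  have hgeo : ∀ᶠ w in 𝓝 z, ∀ v, geodesicForm G (F w) (Fu w) (Fuu w) v = 0 := by
    filter_upwards [hPz.eventually_nhds] with w hw v
    have h1 := (U.bondi_geodesic (sphereProj w.2)).geodesicForm_eq_zero he.mem_atlas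
      (t := w.1) (hw.self_of_nhds).2.1 v
    have h2 : ∀ᶠ t in 𝓝 w.1, deriv (e ∘ fun r => U.bondi (r, sphereProj w.2)) t = Fu (t, w.2) := by
      filter_upwards [hlineP w hw] with t ht
      exact (hline F w.2 t (hF _ ht)).deriv
    have h3 : deriv (deriv (e ∘ fun r => U.bondi (r, sphereProj w.2))) w.1 = Fuu w := by
      rw [Filter.EventuallyEq.deriv_eq h2]
      exact (hline Fu w.2 w.1 (hFu _ hw.self_of_nhds)).deriv
    rw [h2.self_of_nhds, h3] at h1
    exact h1
  have hPz0 := hPz.self_of_nhds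
  have hG : ContDiffAt ℝ ∞ G (F z) := (U.ambient.contDiffOn_chartMetricL he.mem_atlas).contDiffAt
      (e.open_target.mem_nhds (e.map_source hpe))
  have hjac := fun v ζ => jacobiForm_of_family (v := v) hG
    ((hF z hPz0).differentiableAt (by simp)) ((hFu z hPz0).differentiableAt (by simp))
    ((hFuu z hPz0).differentiableAt (by simp)) (hgeo.mono fun w hw => hw v) ζ
  -- the Killing field along the generators
  have hDF : ∀ w, P w → ∀ ζ, fderiv ℝ F w ζ
      = mfderiv (𝓡 4) (𝓡 4) e (U.coneMap w) (mfderiv 𝓘(ℝ, ℝ × E3) (𝓡 4) U.coneMap w ζ) := by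
    intro w hw ζ
    exact (congrArg (fun T : ℝ × E3 →L[ℝ] E4 => T ζ) mfderiv_eq_fderiv).symm.trans
      (mfderiv_comp_apply w (hem.mdifferentiableAt hw.2.1) (U.mdifferentiableAt_coneMap hw.1) ζ)
  have hy : ∀ w, P w → coordField e W (F w) = f w • Fu w + fderiv ℝ F w (0, A w.2) := by
    intro w hw
    have h1 : ((f w, A w.2) : ℝ × E3) = f w • ε + (0, A w.2) := by simp [ε]
    have h2 : fderiv ℝ F w (f w, A w.2) = f w • Fu w + fderiv ℝ F w (0, A w.2) := by
      rw [h1, map_add, map_smul]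
    rw [← h2, hDF w hw, ← hA w hw.1]
    refine (coordField_apply e W hw.2.1).trans ?_
    rw [hW.eq_mfderiv_coneMap hP hw.1]
  obtain ⟨r₀, q⟩ := z
  set a := A q
  have hPq : ∀ᶠ t in 𝓝 r₀, P (t, q) := hlineP (r₀, q) hPz
  -- The derivative of the Killing field along the generator, valid for nearby parameters so that it
  -- can be differentiated again. The direction `a = A q` is constant there.
  have hfirst : ∀ᶠ t in 𝓝 r₀, Y₁ (F (t, q)) (Fu (t, q))
      = fu (t, q) • Fu (t, q) + f (t, q) • Fuu (t, q) + fderiv ℝ Fu (t, q) (0, a) := by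
    filter_upwards [hPq.eventually_nhds] with t ht
    have hPt := ht.self_of_nhds
    have h1 := comp_hasDerivAt_of_eventually (hjet.hasFDerivWithinAt _ hPt.2.2)
      (x := fun s => F (s, q)) (hline F q t (hF _ hPt)) (ht.mono fun s hs => hs.2.2)
    have h2 : HasDerivAt (fun s => fderiv ℝ F (s, q)) (fderiv ℝ (fderiv ℝ F) (t, q) ε) t :=
      hline (fderiv ℝ F) q t ((hF _ hPt).fderiv_right (m := ∞) (by simp))
    have h3 := ((hline f q t (hf _ hPt)).smul (hline Fu q t (hFu _ hPt))).add
      (h2.clm_apply (hasDerivAt_const t ((0 : ℝ), a)))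
    have h4 : (fun s => coordField e W (F (s, q))) =ᶠ[𝓝 t]
        (fun s => f (s, q) • Fu (s, q)) + fun s => fderiv ℝ F (s, q) (0, a) := by
      filter_upwards [ht] with s hs using hy _ hs
    refine (h1.unique (h3.congr_of_eventuallyEq h4)).trans ?_
    rw [← hsw F (t, q) (hF _ hPt)]
    simp [fu, Fuu]
    abel
  have hl0 := hline Fuu q r₀ (hFuu _ hPz0)
  have h2 : HasDerivAt (fun s => fderiv ℝ Fu (s, q)) (fderiv ℝ (fderiv ℝ Fu) (r₀, q) ε) r₀ :=
    hline (fderiv ℝ Fu) q r₀ ((hFu _ hPz0).fderiv_right (m := ∞) (by simp))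
  have h3 := (((hline fu q r₀ (hfu _ hPz0)).smul (hline Fu q r₀ (hFu _ hPz0))).add
    ((hline f q r₀ (hf _ hPz0)).smul hl0)).add (h2.clm_apply (hasDerivAt_const r₀ ((0 : ℝ), a)))
  have h5 := (comp_hasDerivAt_of_eventually (hjet.hasFDerivWithinAt' _ hPz0.2.2)
      (x := fun s => F (s, q)) (hline F q r₀ (hF _ hPz0)) (hPq.mono fun s hs => hs.2.2)).clm_apply
      (hline Fu q r₀ (hFu _ hPz0))
  have hsecond := h5.unique (h3.congr_of_eventuallyEq hfirst)
  rw [← hsw Fu (r₀, q) (hFu _ hPz0)] at hsecond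
  have hG2 : ∀ a b, fderiv ℝ (fderiv ℝ G) (F (r₀, q)) a b = fderiv ℝ (fderiv ℝ G) (F (r₀, q)) b a :=
    fun a b => (hG.isSymmSndFDerivAt (by simpa using two_le_infty)) a b
  have hs1 : ∀ v a b, fderiv ℝ G (F (r₀, q)) v a b = fderiv ℝ G (F (r₀, q)) v b a := by
    intro v a b
    have hGd := (hG.differentiableAt (by simp)).hasFDerivAt
    have e1 := (hGd.clm_apply (hasFDerivAt_const a _)).clm_apply (hasFDerivAt_const b _)
    have e2 := (hGd.clm_apply (hasFDerivAt_const b _)).clm_apply (hasFDerivAt_const a _)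
    have e3 : (fun x => G x a b) = fun x => G x b a :=
      funext fun x => U.ambient.chartMetricL_symm e x a b
    rw [e3] at e1
    simpa using congrArg (fun T : E4 →L[ℝ] ℝ => T v) (e1.unique e2)
  have hkj := fun w => jacobiForm_killing (hjet.symm _ hPz0.2.2) hG2
    (U.ambient.chartMetricL_symm e _) hs1 (hjet.killing _ hPz0.2.2) (hjet.killing' _ hPz0.2.2)
    hgeo.self_of_nhds w
  have hfin : ∀ w, fderiv ℝ fu (r₀, q) ε * G (F (r₀, q)) (Fu (r₀, q)) w = 0 := by
    intro w
    refine jacobiForm_combination G (F (r₀, q)) (Fu (r₀, q)) (Fuu (r₀, q)) (fderiv ℝ Fuu (r₀, q) ε)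
      (fderiv ℝ F (r₀, q) (0, a)) (fderiv ℝ Fu (r₀, q) (0, a)) (fderiv ℝ Fuu (r₀, q) (0, a)) w
      (f (r₀, q)) (fu (r₀, q)) (fderiv ℝ fu (r₀, q) ε) hs1 ?_ (hjac w ε) (hjac w (0, a))
      (hgeo.self_of_nhds w)
    have h6 := hkj w
    rw [hy _ hPz0, hfirst.self_of_nhds] at h6
    convert h6 using 2
    refine Eq.trans ?_ hsecond.symm
    simp only [map_zero, add_zero, two_mul, add_smul]
    abel
  -- If `f'' ≠ 0`, nondegeneracy forces the velocity of the generator to vanish, against `du(∂_u) =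
  -- 1`.
  by_contra hne
  have h7 : Fu (r₀, q) = 0 :=
    U.ambient.chartMetricL_nondegenerate hem (e.map_source hpe) _ fun w =>
      (mul_eq_zero.1 (hfin w)).resolve_left hne
  have h8 : mfderiv 𝓘(ℝ, ℝ × E3) (𝓡 4) U.coneMap (r₀, q) ε = 0 := by
    apply (isInvertible_mfderiv hem hpe).injective
    rw [map_zero, ← hDF _ hPz0]
    exact h7
  have h9 := U.du_coneMap hz ε
  rw [h8, map_zero] at h9
  exact zero_ne_one h9

/-- The `∂_u` component of a Killing field preserving the horizon is affine in `u`. -/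
theorem IsSmoothExtension.coneU_eq {Y : VField M} (hY : U.bulk.IsKillingField Y)
    (hP : U.PreservesHorizon Y) {W : VField N} (hW : U.IsSmoothExtension Y W) (t : ℝ) {x : E3}
    (hx : x ≠ 0) :
    U.coneU W (t, x) = t * (U.coneU W (1, x) - U.coneU W (0, x)) + U.coneU W (0, x) := by
  have hline : ∀ (Φ : ℝ × E3 → ℝ) (t : ℝ), ContDiffAt ℝ ∞ Φ (t, x) →
      HasDerivAt (fun s => Φ (s, x)) (fderiv ℝ Φ (t, x) (1, 0)) t := by
    intro Φ t hΦ
    exact ((hΦ.differentiableAt (by simp)).hasFDerivAt).comp_hasDerivAt t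
      ((hasDerivAt_id t).prodMk (hasDerivAt_const t x))
  have hf : ∀ t, ContDiffAt ℝ ∞ (U.coneU W) (t, x) := fun t => hW.contDiffAt_coneU hx
  have h1 : ∀ t, HasDerivAt (fun s => fderiv ℝ (U.coneU W) (s, x) (1, 0)) 0 t := by
    intro t
    have h2 := hline (fun w => fderiv ℝ (U.coneU W) w (1, 0)) t
      (((hf t).fderiv_right (m := ∞) (by simp)).clm_apply contDiffAt_const)
    rwa [hW.fderiv_fderiv_coneU hY hP hx] at h2
  have h3 : ∀ t, fderiv ℝ (U.coneU W) (t, x) (1, 0) = fderiv ℝ (U.coneU W) (0, x) (1, 0) :=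
    fun t => is_const_of_deriv_eq_zero (fun t => (h1 t).differentiableAt) (fun t => (h1 t).deriv) _ _
  set D := fderiv ℝ (U.coneU W) (0, x) (1, 0)
  have h4 : ∀ t, HasDerivAt (fun s => U.coneU W (s, x) - s * D) 0 t := by
    intro t
    have h5 := hline _ t (hf t)
    rw [h3 t] at h5
    exact (h5.sub ((hasDerivAt_id' t).mul_const D)).congr_deriv (by simp)
  have h6 : ∀ t, U.coneU W (t, x) - t * D = U.coneU W (0, x) - 0 * D :=
    fun t => is_const_of_deriv_eq_zero (fun t => (h4 t).differentiableAt) (fun t => (h4 t).deriv) _ _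
  have h7 := h6 t
  have h8 := h6 1
  linear_combination h7 - t * h8

end ExpandingUniverse

/-! ### The restricted field on `ℝ × 𝕊²`. -/

namespace ExpandingUniverse

variable {M : Type*} [TopologicalSpace M] [T2Space M] [SecondCountableTopology M]
    [ConnectedSpace M] [ChartedSpace E4 M] [IsManifold (𝓡 4) ∞ M]
    {N : Type*} [TopologicalSpace N] [T2Space N] [SecondCountableTopology N]
    [ConnectedSpace N] [ChartedSpace E4 N] [IsManifold (𝓡 4) ∞ N] (U : ExpandingUniverse M N)

/-- The vector field on `ℝ × 𝕊²` with the same components as `W` along the horizon. -/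
def scriField (W : VField N) : ScriField := fun z =>
  ((mvfderiv (𝓡 4) U.u (U.bondi z) (W (U.bondi z)) : ℝ),
    (mfderiv (𝓡 4) (𝓡 2) U.s (U.bondi z) (W (U.bondi z)) : EuclideanSpace ℝ (Fin 2)))

theorem mvfderiv_coe_scriField (W : VField N) (z : ℝ × S2) :
    mvfderiv (𝓡 2) (fun q : S2 => (q : E3)) z.2 (U.scriField W z).2
      = mvfderiv (𝓡 4) (fun q => (U.s q : E3)) (U.bondi z) (W (U.bondi z)) := by
  rw [U.ds_eq (U.bondi_mem z)]
  have h : ∀ (q : S2) (v : EuclideanSpace ℝ (Fin 2)), q = z.2 →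
      mvfderiv (𝓡 2) (fun q : S2 => (q : E3)) z.2 v
      = mvfderiv (𝓡 2) (fun q : S2 => (q : E3)) q v := by
    rintro q v rfl; rfl
  exact h _ _ (U.s_bondi z)

variable {U}

/-- Both sides have the same `u` and `s` components by construction, and tangency takes care of the
`Omega` component. -/
theorem IsSmoothExtension.eq_mfderiv_bondi {Y : VField M} (hP : U.PreservesHorizon Y)
    {W : VField N} (hW : U.IsSmoothExtension Y W) (z : ℝ × S2) :
    W (U.bondi z) = mfderiv scriModel (𝓡 4) U.bondi z (U.scriField W z) := by
  have hz := U.bondi_mem z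
  refine sub_eq_zero.1 (U.eq_zero_of_coordinates hz ?_ ?_ ?_)
  · rw [map_sub, U.du_bondi, sub_eq_zero]; rfl
  · rw [map_sub, U.dOmega_bondi, hW.dOmega_eq_zero hP hz, sub_zero]
  · rw [map_sub, U.ds_bondi, U.mvfderiv_coe_scriField, sub_self]

theorem coneMap_coe (t : ℝ) (q : S2) : U.coneMap (t, (q : E3)) = U.bondi (t, q) := by
  rw [coneMap, sphereProj_coe]

theorem coe_S2_ne_zero (q : S2) : (q : E3) ≠ 0 := ne_zero_of_mem_unit_sphere q

theorem coneU_coe (W : VField N) (t : ℝ) (q : S2) :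
    U.coneU W (t, (q : E3)) = mvfderiv (𝓡 4) U.u (U.bondi (t, q)) (W (U.bondi (t, q))) := by
  rw [coneU, coneMap_coe]

theorem IsSmoothExtension.contMDiff_coneU {Y : VField M} {W : VField N}
    (hW : U.IsSmoothExtension Y W) (t : ℝ) :
    ContMDiff (𝓡 2) 𝓘(ℝ, ℝ) ∞ (fun q : S2 => U.coneU W (t, (q : E3))) := by
  intro q
  simp only [coneU_coe]
  refine hW.contMDiffAt_mvfderiv (h := fun q => U.bondi (t, q)) (φ := U.u) ?_
    (fun q => U.bondi_mem _) (U.contMDiffAt_u (U.bondi_mem _))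
  exact (U.bondi_smooth.comp (contMDiff_const.prodMk contMDiff_id)).contMDiffAt

/-- The restriction to the horizon of a Killing field which preserves the horizon. -/
theorem IsSmoothExtension.scriField_eq {Y : VField M} (hY : U.bulk.IsKillingField Y)
    (hP : U.PreservesHorizon Y) {W : VField N} (hW : U.IsSmoothExtension Y W) :
    ∃ (α β : S2 → ℝ) (A : E3 →L[ℝ] E3), ContMDiff (𝓡 2) 𝓘(ℝ, ℝ) ∞ α ∧
      ContMDiff (𝓡 2) 𝓘(ℝ, ℝ) ∞ β ∧ (∀ a b, inner ℝ (A a) b + inner ℝ a (A b) = 0) ∧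
      ∀ z : ℝ × S2, (U.scriField W z).1 = z.1 * α z.2 + β z.2 ∧
        mvfderiv (𝓡 2) (fun q : S2 => (q : E3)) z.2 (U.scriField W z).2 = A z.2 := by
  obtain ⟨A, hA, hAT⟩ := hW.exists_skew hY hP
  -- Slope and intercept are read off at `u = 0` and `u = 1`, so they inherit smoothness from these
  -- two slices.
  refine ⟨fun q => U.coneU W (1, (q : E3)) - U.coneU W (0, (q : E3)),
    fun q => U.coneU W (0, (q : E3)), A,
    (hW.contMDiff_coneU 1).sub (hW.contMDiff_coneU 0), hW.contMDiff_coneU 0, hA, ?_⟩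
  rintro ⟨t, q⟩
  refine ⟨?_, ?_⟩
  · rw [← hW.coneU_eq hY hP t (coe_S2_ne_zero q), coneU_coe]; rfl
  · rw [U.mvfderiv_coe_scriField, ← hAT (t, (q : E3)) (coe_S2_ne_zero q), coneT, coneMap_coe]
    simp

end ExpandingUniverse

/-! ### Membership in the horizon Lie algebra. -/

section Algebra

/-- The rotation field about the `i`-th axis. -/
theorem exists_isRotationField (i : Fin 3) : ∃ Z : ScriField, IsRotationField i Z := by
  have h : ∀ z : ℝ × S2, ∃ ζ : EuclideanSpace ℝ (Fin 2),
      mvfderiv (𝓡 2) (fun q : S2 => (q : E3)) z.2 ζ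
      = WithLp.toLp 2 (crossProduct (Pi.single i (1 : ℝ)) (WithLp.ofLp (z.2 : E3))) := by
    intro z
    refine (range_mvfderiv_coe z.2 _).2 ?_
    have := dot_cross_self (Pi.single i (1 : ℝ)) (WithLp.ofLp (z.2 : E3))
    simpa [PiLp.inner_apply, dotProduct, Fin.sum_univ_three, mul_comm] using this
  choose ζ hζ using h
  exact ⟨fun z => ((0 : ℝ), ζ z), fun z => ⟨rfl, hζ z⟩⟩

/-- A skew map of `ℝ³` is the cross product with its axial vector, whose entries are matrix entries
of `A`. -/
theorem skew_eq_cross {A : E3 →L[ℝ] E3} (hA : ∀ a b, inner ℝ (A a) b + inner ℝ a (A b) = 0) :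
    ∃ c : Fin 3 → ℝ, ∀ x : E3, A x = ∑ i, c i •
      (WithLp.toLp 2 (crossProduct (Pi.single i (1 : ℝ)) (WithLp.ofLp x)) : E3) := by
  let e : Fin 3 → E3 := fun i => EuclideanSpace.single i 1
  have h : ∀ i j, A (e i) j + A (e j) i = 0 := by
    intro i j
    have := hA (e i) (e j)
    simpa [e, EuclideanSpace.inner_single_left, EuclideanSpace.inner_single_right] using this
  refine ⟨![A (e 1) 2, A (e 2) 0, A (e 0) 1], fun x => ?_⟩
  have hx : x = x 0 • e 0 + x 1 • e 1 + x 2 • e 2 := by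
    ext i; fin_cases i <;> simp [e]
  have h00 := h 0 0
  have h11 := h 1 1
  have h22 := h 2 2
  have h01 := h 0 1
  have h02 := h 0 2
  have h12 := h 1 2
  ext i
  conv_lhs => rw [hx]
  simp only [map_add, map_smul]
  fin_cases i <;> simp [Fin.sum_univ_three, crossProduct]
  · linear_combination (x 0 / 2) * h00 + x 1 * h01
  · linear_combination (x 1 / 2) * h11 + x 2 * h12
  · linear_combination (x 2 / 2) * h22 + x 0 * h02

/-- The field is a linear combination of generators; no bracket is needed. The sphere components are
compared after embedding the tangent spaces in `ℝ³`. -/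
theorem mem_horizonLieAlgebra {Z : ScriField} {α β : S2 → ℝ} {A : E3 →L[ℝ] E3}
    (hα : ContMDiff (𝓡 2) 𝓘(ℝ, ℝ) ∞ α) (hβ : ContMDiff (𝓡 2) 𝓘(ℝ, ℝ) ∞ β)
    (hA : ∀ a b, inner ℝ (A a) b + inner ℝ a (A b) = 0)
    (h1 : ∀ z : ℝ × S2, (Z z).1 = z.1 * α z.2 + β z.2)
    (h2 : ∀ z : ℝ × S2, mvfderiv (𝓡 2) (fun q : S2 => (q : E3)) z.2 (Z z).2 = A z.2) :
    Z ∈ horizonLieAlgebra := by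
  choose S hS using exists_isRotationField
  obtain ⟨c, hc⟩ := skew_eq_cross hA
  let Zα : ScriField := fun z => (z.1 * α z.2, (0 : EuclideanSpace ℝ (Fin 2)))
  let Zβ : ScriField := fun z => (β z.2, (0 : EuclideanSpace ℝ (Fin 2)))
  have hZ : Z = ∑ i, c i • S i + Zβ + Zα := by
    funext z
    refine Prod.ext ?_ (injective_mvfderiv_coe z.2 ?_)
    · refine (h1 z).trans ?_
      have h3 : ((∑ i, c i • S i + Zβ + Zα) z).1
          = c 0 * (S 0 z).1 + c 1 * (S 1 z).1 + c 2 * (S 2 z).1 + β z.2 + z.1 * α z.2 := by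
        simp only [Fin.sum_univ_three]; rfl
      rw [h3, (hS 0 z).1, (hS 1 z).1, (hS 2 z).1]
      ring
    · refine (h2 z).trans ?_
      have h3 : ((∑ i, c i • S i + Zβ + Zα) z).2
          = (c 0 • (S 0 z).2 + c 1 • (S 1 z).2 + c 2 • (S 2 z).2 :) := by
        simp only [Fin.sum_univ_three]
        refine Eq.trans ?_ ((add_zero _).trans (add_zero _)); rfl
      refine Eq.trans ?_ (congrArg (mvfderiv (𝓡 2) (fun q : S2 => (q : E3)) z.2) h3.symm)
      rw [hc]
      have h4 : ∀ x y w : EuclideanSpace ℝ (Fin 2),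
          mvfderiv (𝓡 2) (fun q : S2 => (q : E3)) z.2 (c 0 • x + c 1 • y + c 2 • w)
          = c 0 • mvfderiv (𝓡 2) (fun q : S2 => (q : E3)) z.2 x
          + c 1 • mvfderiv (𝓡 2) (fun q : S2 => (q : E3)) z.2 y
          + c 2 • mvfderiv (𝓡 2) (fun q : S2 => (q : E3)) z.2 w := by
        intro x y w
        exact (map_add _ _ _).trans (congrArg₂ _ ((map_add _ _ _).trans
          (congrArg₂ _ (map_smul _ _ _) (map_smul _ _ _))) (map_smul _ _ _))
      refine Eq.trans ?_ (h4 _ _ _).symm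
      rw [(hS 0 z).2, (hS 1 z).2, (hS 2 z).2, Fin.sum_univ_three]
  rw [hZ, horizonLieAlgebra, Submodule.mem_sInf]
  rintro V ⟨hV, -⟩
  refine V.add_mem (V.add_mem (V.sum_mem fun i _ => V.smul_mem _ (hV ?_)) (hV ?_)) (hV ?_)
  · exact Or.inl (Or.inl ⟨i, hS i⟩)
  · exact Or.inl (Or.inr ⟨β, hβ, fun z => rfl⟩)
  · exact Or.inr ⟨α, hα, fun z => rfl⟩

end Algebra

/-! ### Smooth dependence of integrals on parameters. -/

section ParametricIntegral

open MeasureTheory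

theorem continuousOn_integral_of_continuousOn {H E : Type*} [TopologicalSpace H]
    [FirstCountableTopology H] [NormedAddCommGroup E] [NormedSpace ℝ E] {s : Set H}
    {f : H → ℝ → E} (a b : ℝ) (hf : ContinuousOn (Function.uncurry f) (s ×ˢ univ)) :
    ContinuousOn (fun x => ∫ t in a..b, f x t) s := by
  rw [continuousOn_iff_continuous_domRestrict]
  refine intervalIntegral.continuous_parametric_intervalIntegral_of_continuous'
    (f := fun (x : s) t => f x t) ?_ a b
  exact hf.comp_continuous (f := fun p : s × ℝ => ((p.1 : H), p.2)) (by fun_prop)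
    fun p => ⟨p.1.2, mem_univ _⟩

/-- The dominating function is a constant, the maximum of the derivative over a closed ball times
the compact interval. -/
theorem hasFDerivAt_integral_of_contDiffOn {H E : Type*} [NormedAddCommGroup H] [NormedSpace ℝ H]
    [ProperSpace H] [NormedAddCommGroup E] [NormedSpace ℝ E] {s : Set H} (hs : IsOpen s)
    {f : H → ℝ → E} (a b : ℝ) (hf : ContDiffOn ℝ 1 (Function.uncurry f) (s ×ˢ univ)) {x : H}
    (hx : x ∈ s) :
    HasFDerivAt (fun x => ∫ t in a..b, f x t) (∫ t in a..b,
      (fderiv ℝ (Function.uncurry f) (x, t)).comp (ContinuousLinearMap.inl ℝ H ℝ)) x := by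
  have ho : IsOpen (s ×ˢ (univ : Set ℝ)) := hs.prod isOpen_univ
  have hF' : ContinuousOn (fun p : H × ℝ =>
      (fderiv ℝ (Function.uncurry f) p).comp (ContinuousLinearMap.inl ℝ H ℝ)) (s ×ˢ univ) :=
    (hf.continuousOn_fderiv_of_isOpen ho le_rfl).clm_comp continuousOn_const
  have hsl : ∀ y ∈ s, Continuous fun t : ℝ => (fderiv ℝ (Function.uncurry f) (y, t)).comp
      (ContinuousLinearMap.inl ℝ H ℝ) := fun y hy =>
    hF'.comp_continuous (f := fun t : ℝ => (y, t)) (by fun_prop) fun t => ⟨hy, mem_univ _⟩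
  have hsf : ∀ y ∈ s, Continuous (f y) := fun y hy =>
    hf.continuousOn.comp_continuous (f := fun t : ℝ => (y, t)) (by fun_prop)
      fun t => ⟨hy, mem_univ _⟩
  obtain ⟨r, hr, hrs⟩ := Metric.nhds_basis_closedBall.mem_iff.1 (hs.mem_nhds hx)
  obtain ⟨C, hC⟩ := ((isCompact_closedBall x r).prod (isCompact_uIcc (a := a) (b := b))
    ).exists_bound_of_continuousOn (hF'.mono (prod_mono hrs (subset_univ _)))
  refine intervalIntegral.hasFDerivAt_integral_of_dominated_of_fderiv_le (bound := fun _ => C)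
    (F' := fun y t => (fderiv ℝ (Function.uncurry f) (y, t)).comp (ContinuousLinearMap.inl ℝ H ℝ))
    (Metric.closedBall_mem_nhds x hr) ?_ ((hsf x hx).intervalIntegrable a b)
    (hsl x hx).aestronglyMeasurable ?_ intervalIntegrable_const ?_
  · filter_upwards [hs.mem_nhds hx] with y hy using (hsf y hy).aestronglyMeasurable
  · exact Eventually.of_forall fun t ht y hy => hC (y, t) ⟨hy, uIoc_subset_uIcc ht⟩
  · refine Eventually.of_forall fun t _ y hy => ?_
    have h1 : HasFDerivAt (Function.uncurry f) (fderiv ℝ (Function.uncurry f) (y, t)) (y, t) :=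
      ((hf.differentiableOn (by simp)).differentiableAt
        (ho.mem_nhds ⟨hrs hy, mem_univ _⟩)).hasFDerivAt
    exact HasFDerivAt.comp (f := fun e : H => (e, t)) y h1 (hasFDerivAt_prodMk_left y t)

/-- The target `E` is quantified inside the induction because the derivative takes values in `H
→L[ℝ] E`. -/
theorem contDiffOn_integral_of_contDiffOn {H : Type} [NormedAddCommGroup H] [NormedSpace ℝ H]
    [ProperSpace H] {s : Set H} (hs : IsOpen s) (a b : ℝ) (n : ℕ) :
    ∀ {E : Type} [NormedAddCommGroup E] [NormedSpace ℝ E] {f : H → ℝ → E},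
      ContDiffOn ℝ n (Function.uncurry f) (s ×ˢ univ) →
      ContDiffOn ℝ n (fun x => ∫ t in a..b, f x t) s := by
  have ho : IsOpen (s ×ˢ (univ : Set ℝ)) := hs.prod isOpen_univ
  induction n with
  | zero =>
    intro E _ _ f hf
    exact contDiffOn_zero.2 (continuousOn_integral_of_continuousOn a b hf.continuousOn)
  | succ n ih =>
    intro E _ _ f hf
    have hd : ∀ x ∈ s, HasFDerivAt (fun x => ∫ t in a..b, f x t) (∫ t in a..b,
        (fderiv ℝ (Function.uncurry f) (x, t)).comp (ContinuousLinearMap.inl ℝ H ℝ)) x :=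
      fun x hx => hasFDerivAt_integral_of_contDiffOn hs a b (hf.of_le (by simp)) hx
    push_cast at hf ⊢
    rw [contDiffOn_succ_iff_fderiv_of_isOpen hs]
    refine ⟨fun x hx => (hd x hx).differentiableAt.differentiableWithinAt, by simp, ?_⟩
    refine ContDiffOn.congr (ih (f := fun x t => (fderiv ℝ (Function.uncurry f) (x, t)).comp
      (ContinuousLinearMap.inl ℝ H ℝ)) ?_) fun x hx => (hd x hx).fderiv
    exact ((contDiffOn_succ_iff_fderiv_of_isOpen ho).1 hf).2.2.clm_comp contDiffOn_const

theorem contDiffOn_integral {H E : Type} [NormedAddCommGroup H] [NormedSpace ℝ H]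
    [ProperSpace H] [NormedAddCommGroup E] [NormedSpace ℝ E] {s : Set H} (hs : IsOpen s)
    {f : H → ℝ → E} (a b : ℝ) (hf : ContDiffOn ℝ ∞ (Function.uncurry f) (s ×ˢ univ)) :
    ContDiffOn ℝ ∞ (fun x => ∫ t in a..b, f x t) s :=
  contDiffOn_infty.2 fun n => contDiffOn_integral_of_contDiffOn hs a b n (contDiffOn_infty.1 hf n)

end ParametricIntegral

/-! ### The rotation group generated by a skew map. -/

section Rotation

variable {A : E3 →L[ℝ] E3}

theorem mem_unitary_exp (hA : ∀ a b, inner ℝ (A a) b + inner ℝ a (A b) = 0) (t : ℝ) :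
    NormedSpace.exp (t • A) ∈ unitary (E3 →L[ℝ] E3) := by
  let := NormedAlgebra.restrictScalars ℚ ℝ (E3 →L[ℝ] E3)
  refine NormedSpace.exp_mem_unitary_of_mem_skewAdjoint ?_
  rw [skewAdjoint.mem_iff, ContinuousLinearMap.star_eq_adjoint, eq_comm,
    ContinuousLinearMap.eq_adjoint_iff]
  intro x y
  have := hA x y
  simp only [neg_apply, smul_apply, inner_neg_left,
    inner_smul_left, inner_smul_right]
  simp only [conj_trivial]
  linear_combination (-t) * this

/-- The rotations generated by a skew-symmetric operator. -/
def rotationFlow (hA : ∀ a b, inner ℝ (A a) b + inner ℝ a (A b) = 0) (t : ℝ) : E3 ≃ₗᵢ[ℝ] E3 :=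
  Unitary.linearIsometryEquiv ⟨NormedSpace.exp (t • A), mem_unitary_exp hA t⟩

variable (hA : ∀ a b, inner ℝ (A a) b + inner ℝ a (A b) = 0)

theorem rotationFlow_apply (t : ℝ) (x : E3) :
    rotationFlow hA t x = NormedSpace.exp (t • A) x := rfl

theorem exp_add_smul (s t : ℝ) :
    NormedSpace.exp ((s + t) • A) = NormedSpace.exp (s • A) * NormedSpace.exp (t • A) := by
  let := NormedAlgebra.restrictScalars ℚ ℝ (E3 →L[ℝ] E3)
  rw [add_smul, NormedSpace.exp_add_of_commute]
  exact ((Commute.refl A).smul_left s).smul_right t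

theorem rotationFlow_add (s t : ℝ) : rotationFlow hA (s + t) = rotationFlow hA s * rotationFlow hA t := by
  ext1 x
  rw [rotationFlow_apply, exp_add_smul]; rfl

theorem rotationFlow_zero (x : E3) : rotationFlow hA 0 x = x := by
  rw [rotationFlow_apply, zero_smul, NormedSpace.exp_zero]; rfl

/-- The rotation at time `t` is the square of the one at time `t / 2`, whose determinant is `±1`. -/
theorem det_rotationFlow (t : ℝ) :
    LinearMap.det ((rotationFlow hA t).toLinearEquiv : E3 →ₗ[ℝ] E3) = 1 := by
  have h : (rotationFlow hA t).toLinearEquiv.toLinearMap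
      = (rotationFlow hA (t / 2)).toLinearEquiv.toLinearMap
        ∘ₗ (rotationFlow hA (t / 2)).toLinearEquiv.toLinearMap := by
    rw [← add_halves t, rotationFlow_add, add_halves]; rfl
  have h1 := (rotationFlow hA (t / 2)).toLinearIsometry.normDet_eq_one
  rw [LinearMap.normDet_eq_abs_det] at h1
  have h2 : |LinearMap.det (rotationFlow hA (t / 2)).toLinearEquiv.toLinearMap| = 1 := h1
  rw [h, LinearMap.det_comp, ← abs_mul_abs_self, h2, one_mul]

theorem hasDerivAt_rotationFlow (t : ℝ) (x : E3) :
    HasDerivAt (fun t => rotationFlow hA t x) (A (rotationFlow hA t x)) t :=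
  ((hasDerivAt_exp_smul_const' A t).clm_apply (hasDerivAt_const t x)).congr_deriv (by
    simp [rotationFlow_apply])

theorem contDiff_rotationFlow : ContDiff ℝ ∞ fun p : E3 × ℝ => rotationFlow hA p.2 p.1 := by
  have h : ContDiff ℝ ∞ fun p : E3 × ℝ => NormedSpace.exp (p.2 • A) := by
    have : ContDiff ℝ ∞ (NormedSpace.exp : (E3 →L[ℝ] E3) → (E3 →L[ℝ] E3)) :=
      contDiff_iff_contDiffAt.2 fun x => (NormedSpace.exp_analytic (𝕂 := ℝ) x).contDiffAt
    exact this.comp (contDiff_snd.smul contDiff_const)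
  exact h.clm_apply contDiff_fst

/-- Uniqueness of the solutions of `x' = A x`. -/
theorem eq_rotationFlow {x : ℝ → E3} (hx : ∀ t, HasDerivAt x (A (x t)) t) (t : ℝ) :
    x t = rotationFlow hA t (x 0) := by
  -- Multiplying a solution by `exp (-s A)` makes it constant.
  have h1 : ∀ s, HasDerivAt (fun s => NormedSpace.exp ((-s) • A) (x s)) 0 s := by
    intro s
    have h2 := (hasDerivAt_exp_smul_const A (-s)).scomp s (hasDerivAt_neg s)
    refine (h2.clm_apply (hx s)).congr_deriv ?_
    simp
  have h3 : NormedSpace.exp ((-t) • A) (x t) = x 0 := by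
    have := is_const_of_deriv_eq_zero (fun s => (h1 s).differentiableAt) (fun s => (h1 s).deriv) t 0
    simpa using this
  rw [← h3, rotationFlow_apply]
  have h4 := exp_add_smul (A := A) t (-t)
  rw [add_neg_cancel, zero_smul, NormedSpace.exp_zero] at h4
  exact congrArg (fun T : E3 →L[ℝ] E3 => T (x t)) h4

theorem rotate_rotationFlow_add (s t : ℝ) (q : S2) :
    rotate (rotationFlow hA (s + t)) q = rotate (rotationFlow hA s) (rotate (rotationFlow hA t) q) := by
  rw [rotationFlow_add]; rfl

theorem rotate_rotationFlow_zero (q : S2) : rotate (rotationFlow hA 0) q = q :=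
  Subtype.ext (rotationFlow_zero hA _)

theorem contMDiff_rotate_rotationFlow (q : S2) :
    ContMDiff 𝓘(ℝ, ℝ) (𝓡 2) ∞ fun t => rotate (rotationFlow hA t) q := fun _ =>
  contMDiffAt_of_coe ((contDiff_rotationFlow hA).comp
    (contDiff_const.prodMk contDiff_id (f := fun _ => (q : E3)))).contMDiff.contMDiffAt

end Rotation

/-! ### The explicit flow of `(u α + β) ∂_u + A`. -/

section Flow

open MeasureTheory

variable {A : E3 →L[ℝ] E3} (hA : ∀ a b, inner ℝ (A a) b + inner ℝ a (A b) = 0)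
  (α β : S2 → ℝ)

/-- The logarithm of the dilation of the generators of the horizon under the flow of
`(u α + β) ∂_u + A`. -/
def dilationExponent (t : ℝ) (q : S2) : ℝ := ∫ s in (0 : ℝ)..t, α (rotate (rotationFlow hA s) q)

/-- The integral of the translation part in the flow of `(u α + β) ∂_u + A`. -/
def translationIntegral (t : ℝ) (q : S2) : ℝ :=
  ∫ s in (0 : ℝ)..t, Real.exp (-dilationExponent hA α s q) * β (rotate (rotationFlow hA s) q)

/-- The flow of the vector field `(u α + β) ∂_u + A` on `ℝ × 𝕊²`. -/
def scriFlow (t : ℝ) (z : ℝ × S2) : ℝ × S2 :=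
  (Real.exp (dilationExponent hA α t z.2) * (z.1 + translationIntegral hA α β t z.2),
    rotate (rotationFlow hA t) z.2)

variable {α β}

theorem contDiffOn_comp_rotate_sphereProj (hα : ContMDiff (𝓡 2) 𝓘(ℝ, ℝ) ∞ α) :
    ContDiffOn ℝ ∞ (fun p : E3 × ℝ => α (rotate (rotationFlow hA p.2) (sphereProj p.1)))
      ({0}ᶜ ×ˢ univ) := by
  rintro ⟨x, t⟩ ⟨hx, -⟩
  refine ContDiffAt.contDiffWithinAt (contMDiffAt_iff_contDiffAt.1 ?_)
  refine hα.contMDiffAt.comp (x, t) (contMDiffAt_of_coe ?_)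
  have h1 : ContMDiffAt 𝓘(ℝ, E3 × ℝ) 𝓘(ℝ, E3) ∞ (fun p : E3 × ℝ => (sphereProj p.1 : E3)) (x, t) :=
    contMDiff_coe_S2.contMDiffAt.comp (x, t) (ContMDiffAt.comp (x, t) (contMDiffAt_sphereProj hx)
      contDiff_fst.contMDiff.contMDiffAt)
  exact contMDiffAt_iff_contDiffAt.2 ((contDiff_rotationFlow hA).contDiffAt.comp (x, t)
    ((contMDiffAt_iff_contDiffAt.1 h1).prodMk contDiffAt_snd))

/-- Rescaling to the interval `[0, 1]` turns the variable upper limit into a parameter of the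
integrand. -/
theorem contDiffOn_integral_zero_right {f : E3 × ℝ → ℝ}
    (hf : ContDiffOn ℝ ∞ f ({0}ᶜ ×ˢ univ)) :
    ContDiffOn ℝ ∞ (fun p : E3 × ℝ => ∫ s in (0 : ℝ)..p.2, f (p.1, s)) ({0}ᶜ ×ˢ univ) := by
  have ho : IsOpen (({0}ᶜ : Set E3) ×ˢ (univ : Set ℝ)) := isOpen_compl_singleton.prod isOpen_univ
  have h1 : ∀ p : E3 × ℝ, ∫ s in (0 : ℝ)..p.2, f (p.1, s)
      = ∫ s in (0 : ℝ)..1, p.2 * f (p.1, p.2 * s) := by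
    intro p
    rw [intervalIntegral.integral_const_mul,
      intervalIntegral.mul_integral_comp_mul_left (f := fun s => f (p.1, s))]
    simp
  simp only [h1]
  refine contDiffOn_integral ho 0 1 ?_
  have h2 : ContDiff ℝ ∞ fun p : (E3 × ℝ) × ℝ => (p.1.1, p.1.2 * p.2) := by fun_prop
  have h3 : ContDiff ℝ ∞ fun p : (E3 × ℝ) × ℝ => p.1.2 := by fun_prop
  exact h3.contDiffOn.mul (hf.comp h2.contDiffOn fun p hp => ⟨hp.1.1, mem_univ _⟩)

theorem contDiffOn_dilationExponent (hα : ContMDiff (𝓡 2) 𝓘(ℝ, ℝ) ∞ α) :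
    ContDiffOn ℝ ∞ (fun p : E3 × ℝ => dilationExponent hA α p.2 (sphereProj p.1))
      ({0}ᶜ ×ˢ univ) :=
  contDiffOn_integral_zero_right (contDiffOn_comp_rotate_sphereProj hA hα)

theorem contDiffOn_translationIntegrand (hα : ContMDiff (𝓡 2) 𝓘(ℝ, ℝ) ∞ α)
    (hβ : ContMDiff (𝓡 2) 𝓘(ℝ, ℝ) ∞ β) :
    ContDiffOn ℝ ∞ (fun p : E3 × ℝ => Real.exp (-dilationExponent hA α p.2 (sphereProj p.1))
      * β (rotate (rotationFlow hA p.2) (sphereProj p.1))) ({0}ᶜ ×ˢ univ) :=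
  (contDiffOn_dilationExponent hA hα).neg.exp.mul (contDiffOn_comp_rotate_sphereProj hA hβ)

theorem contDiffOn_translationIntegral (hα : ContMDiff (𝓡 2) 𝓘(ℝ, ℝ) ∞ α)
    (hβ : ContMDiff (𝓡 2) 𝓘(ℝ, ℝ) ∞ β) :
    ContDiffOn ℝ ∞ (fun p : E3 × ℝ => translationIntegral hA α β p.2 (sphereProj p.1))
      ({0}ᶜ ×ˢ univ) :=
  contDiffOn_integral_zero_right (contDiffOn_translationIntegrand hA hα hβ)

/-- Functions on the sphere are handled as functions on the punctured space constant along rays;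
restricting to unit vectors recovers them. -/
theorem contMDiff_of_contDiffOn_sphereProj {f : ℝ → S2 → ℝ}
    (hf : ContDiffOn ℝ ∞ (fun p : E3 × ℝ => f p.2 (sphereProj p.1)) ({0}ᶜ ×ˢ univ)) (t : ℝ) :
    ContMDiff (𝓡 2) 𝓘(ℝ, ℝ) ∞ (f t) := by
  intro q
  have ho : IsOpen (({0}ᶜ : Set E3) ×ˢ (univ : Set ℝ)) := isOpen_compl_singleton.prod isOpen_univ
  have h1 := (hf.contDiffAt (ho.mem_nhds (x := ((q : E3), t))
    ⟨ne_zero_of_mem_unit_sphere q, mem_univ _⟩)).contMDiffAt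
  have h2 : ContMDiffAt (𝓡 2) 𝓘(ℝ, E3 × ℝ) ∞ (fun q : S2 => ((q : E3), t)) q :=
    (contMDiff_coe_S2.prodMk_space contMDiff_const).contMDiffAt
  have h3 := h1.comp q h2
  simp only [Function.comp_def, sphereProj_coe] at h3
  exact h3

theorem continuous_of_contDiffOn_sphereProj {f : ℝ → S2 → ℝ}
    (hf : ContDiffOn ℝ ∞ (fun p : E3 × ℝ => f p.2 (sphereProj p.1)) ({0}ᶜ ×ˢ univ)) (q : S2) :
    Continuous fun t => f t q := by
  have h1 := hf.continuousOn.comp_continuous (f := fun t : ℝ => ((q : E3), t)) (by fun_prop)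
    fun t => ⟨ne_zero_of_mem_unit_sphere q, mem_univ _⟩
  simpa only [Function.comp_def, sphereProj_coe] using h1

theorem continuous_comp_rotationFlow (hα : ContMDiff (𝓡 2) 𝓘(ℝ, ℝ) ∞ α) (q : S2) :
    Continuous fun t => α (rotate (rotationFlow hA t) q) :=
  continuous_of_contDiffOn_sphereProj (f := fun t q => α (rotate (rotationFlow hA t) q))
    (contDiffOn_comp_rotate_sphereProj hA hα) q

theorem continuous_translationIntegrand (hα : ContMDiff (𝓡 2) 𝓘(ℝ, ℝ) ∞ α)
    (hβ : ContMDiff (𝓡 2) 𝓘(ℝ, ℝ) ∞ β) (q : S2) :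
    Continuous fun t =>
      Real.exp (-dilationExponent hA α t q) * β (rotate (rotationFlow hA t) q) :=
  continuous_of_contDiffOn_sphereProj
    (f := fun t q => Real.exp (-dilationExponent hA α t q) * β (rotate (rotationFlow hA t) q))
    (contDiffOn_translationIntegrand hA hα hβ) q

theorem hasDerivAt_dilationExponent (hα : ContMDiff (𝓡 2) 𝓘(ℝ, ℝ) ∞ α) (t : ℝ) (q : S2) :
    HasDerivAt (fun t => dilationExponent hA α t q) (α (rotate (rotationFlow hA t) q)) t :=
  (continuous_comp_rotationFlow hA hα q).integral_hasStrictDerivAt 0 t |>.hasDerivAt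

theorem hasDerivAt_translationIntegral (hα : ContMDiff (𝓡 2) 𝓘(ℝ, ℝ) ∞ α)
    (hβ : ContMDiff (𝓡 2) 𝓘(ℝ, ℝ) ∞ β) (t : ℝ) (q : S2) :
    HasDerivAt (fun t => translationIntegral hA α β t q)
      (Real.exp (-dilationExponent hA α t q) * β (rotate (rotationFlow hA t) q)) t :=
  (continuous_translationIntegrand hA hα hβ q).integral_hasStrictDerivAt 0 t |>.hasDerivAt

theorem hasDerivAt_scriFlow_fst (hα : ContMDiff (𝓡 2) 𝓘(ℝ, ℝ) ∞ α)
    (hβ : ContMDiff (𝓡 2) 𝓘(ℝ, ℝ) ∞ β) (t : ℝ) (z : ℝ × S2) :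
    HasDerivAt (fun t => (scriFlow hA α β t z).1)
      ((scriFlow hA α β t z).1 * α (scriFlow hA α β t z).2 + β (scriFlow hA α β t z).2) t := by
  refine ((hasDerivAt_dilationExponent hA hα t z.2).exp.mul
    ((hasDerivAt_translationIntegral hA hα hβ t z.2).const_add z.1)).congr_deriv ?_
  have h : Real.exp (dilationExponent hA α t z.2) * Real.exp (-dilationExponent hA α t z.2) = 1 := by
    rw [← Real.exp_add]; simp
  simp only [scriFlow]
  linear_combination (β (rotate (rotationFlow hA t) z.2)) * h

/-- Uniqueness of the solutions of the linear equation for the first component of the flow. -/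
theorem eq_scriFlow_fst (hα : ContMDiff (𝓡 2) 𝓘(ℝ, ℝ) ∞ α) (hβ : ContMDiff (𝓡 2) 𝓘(ℝ, ℝ) ∞ β)
    {y : ℝ → ℝ} {q : S2} (hy : ∀ t, HasDerivAt y (y t * α (rotate (rotationFlow hA t) q)
      + β (rotate (rotationFlow hA t) q)) t) (t : ℝ) :
    y t = (scriFlow hA α β t (y 0, q)).1 := by
  -- The integrating factor `exp (-a)`: the derivative of `exp (-a) y` is the integrand of the
  -- translation part.
  have h1 : ∀ t, HasDerivAt (fun t => Real.exp (-dilationExponent hA α t q) * y t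
      - translationIntegral hA α β t q) 0 t := by
    intro t
    refine (((hasDerivAt_dilationExponent hA hα t q).fun_neg.exp.mul (hy t)).sub
      (hasDerivAt_translationIntegral hA hα hβ t q)).congr_deriv ?_
    ring
  have h2 := is_const_of_deriv_eq_zero (fun s => (h1 s).differentiableAt) (fun s => (h1 s).deriv) t 0
  have h3 : Real.exp (dilationExponent hA α t q) * Real.exp (-dilationExponent hA α t q) = 1 := by
    rw [← Real.exp_add]; simp
  simp only [dilationExponent, translationIntegral, intervalIntegral.integral_same, neg_zero,
    Real.exp_zero, one_mul, sub_zero] at h2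
  simp only [dilationExponent] at h3
  simp only [scriFlow, dilationExponent, translationIntegral]
  linear_combination (-y t) * h3
    + Real.exp (∫ s in (0 : ℝ)..t, α (rotate (rotationFlow hA s) q)) * h2

/-- The cocycle identity: split the integral at `t` and shift the second piece by the group law of
the rotations. -/
theorem dilationExponent_add (hα : ContMDiff (𝓡 2) 𝓘(ℝ, ℝ) ∞ α) (s t : ℝ) (q : S2) :
    dilationExponent hA α (s + t) q = dilationExponent hA α t q
      + dilationExponent hA α s (rotate (rotationFlow hA t) q) := by
  have hc := fun a b => (continuous_comp_rotationFlow hA hα q).intervalIntegrable (μ := volume) a b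
  unfold dilationExponent
  rw [← intervalIntegral.integral_add_adjacent_intervals (hc 0 t) (hc t (s + t))]
  simp only [← rotate_rotationFlow_add]
  rw [intervalIntegral.integral_comp_add_right
    (f := fun σ => α (rotate (rotationFlow hA σ) q)), zero_add]

theorem translationIntegral_add (hα : ContMDiff (𝓡 2) 𝓘(ℝ, ℝ) ∞ α)
    (hβ : ContMDiff (𝓡 2) 𝓘(ℝ, ℝ) ∞ β) (s t : ℝ) (q : S2) :
    translationIntegral hA α β (s + t) q = translationIntegral hA α β t q
      + Real.exp (-dilationExponent hA α t q)
        * translationIntegral hA α β s (rotate (rotationFlow hA t) q) := by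
  have hc := fun a b =>
    (continuous_translationIntegrand hA hα hβ q).intervalIntegrable (μ := volume) a b
  unfold translationIntegral
  rw [← intervalIntegral.integral_add_adjacent_intervals (hc 0 t) (hc t (s + t)),
    ← intervalIntegral.integral_const_mul]
  simp only [← mul_assoc, ← Real.exp_add, ← neg_add, ← dilationExponent_add hA hα,
    ← rotate_rotationFlow_add]
  rw [intervalIntegral.integral_comp_add_right (f := fun σ =>
    Real.exp (-dilationExponent hA α σ q) * β (rotate (rotationFlow hA σ) q)), zero_add]

/-- The two cocycle identities, for the dilation and for the translation, combine into the group
law. -/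
theorem scriFlow_add (hα : ContMDiff (𝓡 2) 𝓘(ℝ, ℝ) ∞ α) (hβ : ContMDiff (𝓡 2) 𝓘(ℝ, ℝ) ∞ β)
    (s t : ℝ) (z : ℝ × S2) :
    scriFlow hA α β (s + t) z = scriFlow hA α β s (scriFlow hA α β t z) := by
  refine Prod.ext ?_ (rotate_rotationFlow_add hA s t z.2)
  have h : Real.exp (dilationExponent hA α t z.2) * Real.exp (-dilationExponent hA α t z.2) = 1 := by
    rw [← Real.exp_add]; simp
  simp only [scriFlow, dilationExponent_add hA hα, translationIntegral_add hA hα hβ, Real.exp_add]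
  linear_combination (Real.exp (dilationExponent hA α s (rotate (rotationFlow hA t) z.2))
    * translationIntegral hA α β s (rotate (rotationFlow hA t) z.2)) * h

theorem scriFlow_zero (z : ℝ × S2) : scriFlow hA α β 0 z = z := by
  refine Prod.ext ?_ (rotate_rotationFlow_zero hA z.2)
  simp [scriFlow, dilationExponent, translationIntegral]

theorem isHorizonSymmetry_scriFlow (hα : ContMDiff (𝓡 2) 𝓘(ℝ, ℝ) ∞ α)
    (hβ : ContMDiff (𝓡 2) 𝓘(ℝ, ℝ) ∞ β) (t : ℝ) : IsHorizonSymmetry (scriFlow hA α β t) := by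
  have h1 := contMDiff_of_contDiffOn_sphereProj (contDiffOn_dilationExponent hA hα) t
  have h2 := contMDiff_of_contDiffOn_sphereProj (contDiffOn_translationIntegral hA hα hβ) t
  exact ⟨dilationExponent hA α t,
    fun q => Real.exp (dilationExponent hA α t q) * translationIntegral hA α β t q,
    rotationFlow hA t, h1, (Real.contDiff_exp.contMDiff.comp h1).mul h2, det_rotationFlow hA t,
    fun z => Prod.ext (mul_add _ _ _) rfl⟩

/-- The flow as a one-parameter group of horizon symmetries. -/
def scriFlowHom (hα : ContMDiff (𝓡 2) 𝓘(ℝ, ℝ) ∞ α) (hβ : ContMDiff (𝓡 2) 𝓘(ℝ, ℝ) ∞ β) :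
    Multiplicative ℝ →* horizonSymmetryGroup where
  toFun t := ⟨⟨scriFlow hA α β t.toAdd, scriFlow hA α β (-t.toAdd),
    fun z => by rw [← scriFlow_add hA hα hβ, neg_add_cancel, scriFlow_zero],
    fun z => by rw [← scriFlow_add hA hα hβ, add_neg_cancel, scriFlow_zero]⟩,
    isHorizonSymmetry_scriFlow hA hα hβ t.toAdd⟩
  map_one' := Subtype.ext (Equiv.ext fun z => scriFlow_zero hA z)
  map_mul' s t := Subtype.ext (Equiv.ext fun z => scriFlow_add hA hα hβ s.toAdd t.toAdd z)

end Flow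

/-! ### Integral curves and uniqueness of the one-parameter group. -/

section IntegralCurves

variable {Z : ScriField} {α β : S2 → ℝ} {A : E3 →L[ℝ] E3}

/-- The velocity on the sphere is compared inside `ℝ³`, where it solves `q' = A q`; injectivity of
the differential of the inclusion brings the equality back. -/
theorem isMIntegralCurve_scriFlow (hA : ∀ a b, inner ℝ (A a) b + inner ℝ a (A b) = 0)
    (hα : ContMDiff (𝓡 2) 𝓘(ℝ, ℝ) ∞ α) (hβ : ContMDiff (𝓡 2) 𝓘(ℝ, ℝ) ∞ β)
    (h1 : ∀ z : ℝ × S2, (Z z).1 = z.1 * α z.2 + β z.2)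
    (h2 : ∀ z : ℝ × S2, mvfderiv (𝓡 2) (fun q : S2 => (q : E3)) z.2 (Z z).2 = A z.2)
    (z : ℝ × S2) : IsMIntegralCurve (I := scriModel) (fun t => scriFlow hA α β t z) Z := by
  intro t
  have hr : MDifferentiableAt 𝓘(ℝ, ℝ) (𝓡 2) (fun t => rotate (rotationFlow hA t) z.2) t :=
    (contMDiff_rotate_rotationFlow hA z.2).mdifferentiableAt (by simp)
  have hd := (hasMFDerivAt_iff_hasFDerivAt.2 (hasDerivAt_scriFlow_fst hA hα hβ t z).hasFDerivAt
    ).prodMk hr.hasMFDerivAt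
  have hs : mfderiv 𝓘(ℝ, ℝ) (𝓡 2) (fun t => rotate (rotationFlow hA t) z.2) t (1 : ℝ)
      = (Z (scriFlow hA α β t z)).2 := by
    refine injective_mvfderiv_coe (rotate (rotationFlow hA t) z.2) ?_
    refine (mfderiv_comp_apply t (contMDiff_coe_S2.mdifferentiableAt (by simp)) hr
      (1 : ℝ)).symm.trans ?_
    refine Eq.trans ?_ (h2 (scriFlow hA α β t z)).symm
    refine (congrArg (fun T : ℝ →L[ℝ] E3 => T 1) mfderiv_eq_fderiv).trans ?_
    exact (hasDerivAt_rotationFlow hA t z.2).deriv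
  refine hd.congr_mfderiv ?_
  refine ContinuousLinearMap.ext_ring (Prod.ext ?_ ?_)
  · refine Eq.trans ?_ ((h1 (scriFlow hA α β t z)).symm.trans (one_smul ℝ _).symm)
    exact one_smul ℝ _
  · exact hs.trans (one_smul ℝ _).symm

/-- The equations decouple: the spherical part solves `q' = A q` in `ℝ³`, and along the resulting
rotation the `u` component solves a scalar linear equation. Each is solved uniquely by an
integrating factor. -/
theorem eq_scriFlow (hA : ∀ a b, inner ℝ (A a) b + inner ℝ a (A b) = 0)
    (hα : ContMDiff (𝓡 2) 𝓘(ℝ, ℝ) ∞ α) (hβ : ContMDiff (𝓡 2) 𝓘(ℝ, ℝ) ∞ β)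
    (h1 : ∀ z : ℝ × S2, (Z z).1 = z.1 * α z.2 + β z.2)
    (h2 : ∀ z : ℝ × S2, mvfderiv (𝓡 2) (fun q : S2 => (q : E3)) z.2 (Z z).2 = A z.2)
    {γ : ℝ → ℝ × S2} (hγ : IsMIntegralCurve (I := scriModel) γ Z) (t : ℝ) :
    γ t = scriFlow hA α β t (γ 0) := by
  have hq : ∀ t, HasDerivAt (fun t => ((γ t).2 : E3)) (A (γ t).2) t := by
    intro t
    have h3 : HasMFDerivAt scriModel 𝓘(ℝ, E3) (fun z : ℝ × S2 => (z.2 : E3)) (γ t)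
        ((mfderiv (𝓡 2) 𝓘(ℝ, E3) (fun q : S2 => (q : E3)) (γ t).2).comp
          (ContinuousLinearMap.snd ℝ ℝ (EuclideanSpace ℝ (Fin 2)))) :=
      HasMFDerivAt.comp (γ t) (contMDiff_coe_S2.mdifferentiableAt (by simp)).hasMFDerivAt
        (hasMFDerivAt_snd (γ t))
    refine hasMFDerivAt_iff_hasFDerivAt.1 ?_
    refine (h3.comp t (hγ t)).congr_mfderiv ?_
    refine ContinuousLinearMap.ext_ring ?_
    refine Eq.trans ?_ ((h2 (γ t)).trans (one_smul ℝ (A (γ t).2)).symm)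
    exact congrArg (fun ζ : ℝ × EuclideanSpace ℝ (Fin 2) =>
      mvfderiv (𝓡 2) (fun q : S2 => (q : E3)) (γ t).2 ζ.2) (one_smul ℝ (Z (γ t)))
  have hu : ∀ t, HasDerivAt (fun t => (γ t).1) ((γ t).1 * α (γ t).2 + β (γ t).2) t := by
    intro t
    refine hasMFDerivAt_iff_hasFDerivAt.1 ?_
    refine ((hasMFDerivAt_fst (γ t)).comp t (hγ t)).congr_mfderiv ?_
    refine ContinuousLinearMap.ext_ring ?_
    refine Eq.trans ?_ ((h1 (γ t)).trans (one_smul ℝ _).symm)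
    exact congrArg (fun ζ : ℝ × EuclideanSpace ℝ (Fin 2) => ζ.1) (one_smul ℝ (Z (γ t)))
  have hq' : ∀ t, (γ t).2 = rotate (rotationFlow hA t) (γ 0).2 := fun t =>
    Subtype.ext (eq_rotationFlow hA hq t)
  refine Prod.ext ?_ (hq' t)
  refine eq_scriFlow_fst hA hα hβ (y := fun t => (γ t).1) (fun t => ?_) t
  rw [← hq' t]
  exact hu t

/-- Existence expresses completeness of the field together with the inclusion of its flow in the
symmetry group; uniqueness holds because a homomorphism starts at the identity and integral curves
are determined by their starting point. -/
theorem existsUnique_scriFlowHom (hA : ∀ a b, inner ℝ (A a) b + inner ℝ a (A b) = 0)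
    (hα : ContMDiff (𝓡 2) 𝓘(ℝ, ℝ) ∞ α) (hβ : ContMDiff (𝓡 2) 𝓘(ℝ, ℝ) ∞ β)
    (h1 : ∀ z : ℝ × S2, (Z z).1 = z.1 * α z.2 + β z.2)
    (h2 : ∀ z : ℝ × S2, mvfderiv (𝓡 2) (fun q : S2 => (q : E3)) z.2 (Z z).2 = A z.2) :
    ∃! φ : Multiplicative ℝ →* horizonSymmetryGroup, ∀ z : ℝ × S2,
      IsMIntegralCurve (I := scriModel)
        (fun t : ℝ => (φ (Multiplicative.ofAdd t) : Equiv.Perm (ℝ × S2)) z) Z := by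
  refine ⟨scriFlowHom hA hα hβ, fun z => isMIntegralCurve_scriFlow hA hα hβ h1 h2 z, ?_⟩
  intro ψ hψ
  refine MonoidHom.ext fun t => Subtype.ext (Equiv.ext fun z => ?_)
  have h3 := eq_scriFlow hA hα hβ h1 h2 (hψ z) t.toAdd
  rw [ofAdd_zero, map_one] at h3
  exact h3

end IntegralCurves

end CosmologicalHorizon

end

/-! ### The theorem assembled. -/

theorem mainTheorem12
    {M : Type*} [TopologicalSpace M] [T2Space M] [SecondCountableTopology M]
    [ConnectedSpace M] [ChartedSpace E4 M] [IsManifold (𝓡 4) ∞ M]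
    {N : Type*} [TopologicalSpace N] [T2Space N] [SecondCountableTopology N]
    [ConnectedSpace N] [ChartedSpace E4 N] [IsManifold (𝓡 4) ∞ N]
    (U : ExpandingUniverse M N) (Y : VField M)
    (hKilling : U.bulk.IsKillingField Y) (hPreserves : U.PreservesHorizon Y) :
    (∃ W : VField N, U.IsSmoothExtension Y W) ∧
    (∀ W W' : VField N, U.IsSmoothExtension Y W → U.IsSmoothExtension Y W' →
      ∀ p ∈ U.horizon, W p = W' p) ∧
    ∃ Z : ScriField,
      (∀ W : VField N, U.IsSmoothExtension Y W →
        ∀ z : ℝ × S2, W (U.bondi z) = mfderiv scriModel (𝓡 4) U.bondi z (Z z)) ∧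
      Z ∈ horizonLieAlgebra ∧
      ∃! φ : Multiplicative ℝ →* horizonSymmetryGroup, ∀ z : ℝ × S2,
        IsMIntegralCurve (I := scriModel)
          (fun t : ℝ => (φ (Multiplicative.ofAdd t) : Equiv.Perm (ℝ × S2)) z) Z := by
  obtain ⟨W, hW⟩ := U.exists_isSmoothExtension hKilling
  have hunique : ∀ W W' : VField N, U.IsSmoothExtension Y W → U.IsSmoothExtension Y W' →
      ∀ p ∈ U.horizon, W p = W' p :=
    fun W W' hW hW' p hp => ExpandingUniverse.isSmoothExtension_unique hW hW' hp
  obtain ⟨α, β, A, hα, hβ, hA, hZ⟩ := hW.scriField_eq hKilling hPreserves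
  -- The restriction is computed from one chosen extension and serves all others by uniqueness on
  -- the horizon.
  refine ⟨⟨W, hW⟩, hunique, U.scriField W, fun W' hW' z => ?_, ?_, ?_⟩
  · rw [hunique W' W hW' hW _ (U.bondi_mem z)]
    exact hW.eq_mfderiv_bondi hPreserves z
  · exact mem_horizonLieAlgebra hα hβ hA (fun z => (hZ z).1) fun z => (hZ z).2
  · exact existsUnique_scriFlowHom hA hα hβ (fun z => (hZ z).1) fun z => (hZ z).2
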